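/- Let $d\ge 2$, $\mathbb T^d=(\mathbb R/\mathbb Z)^d$, $0<T<\infty$, $\gamma>1$, and let $\mu\ge 0$ and $\lambda$ be real constants with $2\mu+d\lambda>0$. Consider $$\varrho_t+\operatorname{div}(\varrho v)=0,\qquad (\varrho v)_t+\operatorname{div}(\varrho v\otimes v)+\nabla\varrho^\gamma-\mu\Delta v-(\mu+\lambda)\nabla\operatorname{div}v=0\quad\text{in }(0,T)\times\mathbb T^d,$$ with initial data $\varrho(0)=\varrho_0\ge 0$, $(\varrho v)(0)=\varrho_0v_0$, where $\varrho_0^\gamma,\ \varrho_0|v_0|^2\in L^1(\mathbb T^d)$. For a state $(\varrho,v)$ put $E(\varrho,v)=\int_{\mathbb T^d}\big(\tfrac12\varrho|v|^2+\tfrac{\varrho^\gamma}{\gamma-1}\big)dx$. A pair $(\varrho,v)$ with $\varrho\ge0$ and $v\in L^1((0,T)\times\mathbb T^d)$ is a (finite energy) weak solution if (i) the equations with the initial data hold in the sense of distributions, i.e. against all test functions in $C_c^\infty([0,T)\times\mathbb T^d)$, and $\varrho^\gamma,\ \varrho|v|^2\in L^\infty(0,T;L^1(\mathbb T^d))$,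 $\nabla v\in L^2(0,T;L^2(\mathbb T^d))$ ($\nabla v$ is the distributional gradient); (ii) $\varrho$ is a renormalized solution: $b(\varrho)_t+\operatorname{div}(b(\varrho)v)+(b'(\varrho)\varrho-b(\varrho))\operatorname{div}v=0$ in $\mathcal D'((0,T)\times\mathbb T^d)$ for every $b\in C^1(\mathbb R)$ with $b'(z)=0$ for all large $z$; (iii) for almost every $t\in(0,T)$, $$E(\varrho(t),v(t))+\int_0^t\!\!\int_{\mathbb T^d}\big(\mu|\nabla v|^2+(\mu+\lambda)|\operatorname{div}v|^2\big)\,dx\,ds\le E(\varrho_0,v_0).$$ **Theorem.** Let $p,q>2$ and let $k,l$ be real numbers with $$k>\max\Big\{\tfrac{4p}{p-2},\tfrac{(\gamma-2)p}{2}\Big\},\quad l>\max\Big\{\tfrac{4q}{q-2},\tfrac{(\gamma-2)q}{2}\Big\},\quad k(4-p)+7p\ge0,\quad l(4-q)+7q\ge0.$$ Let $(\varrho,v)$ be a weak solution such that, for some constant $c>0$, $$c\le\varrho\in L^k(0,T;L^l(\mathbb T^d)),\quad v\in L^p(0,T;L^q(\mathbb T^d)),\quad \nabla v\in L^{\frac{kp}{k(p-2)-4p}}\big(0,T;L^{\frac{lq}{l(q-2)-4q}}(\mathbb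 T^d)\big).$$ Then the energy equality $$E(\varrho(t),v(t))+\int_0^t\!\!\int_{\mathbb T^d}\big(\mu|\nabla v|^2+(\mu+\lambda)|\operatorname{div}v|^2\big)\,dx\,ds=E(\varrho_0,v_0)$$ holds for every $t\in[0,T]$. Here, for the values at individual times, $(\varrho,v)$ is taken in the representative for which $t\mapsto\varrho(t)$ and $t\mapsto(\varrho v)(t)$ are weakly continuous on $[0,T]$ (i.e. continuous when integrated against each fixed function in $C^\infty(\mathbb T^d)$) with values $\varrho_0$, $\varrho_0v_0$ at $t=0$; the existence of such a representative, with finite energy at every time, is part of the claim. For an arbitrary representative the equality holds for almost every $t\in(0,T)$. -/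

import Mathlib

open MeasureTheory Set
open scoped ContDiff

noncomputable section

namespace CompressibleNS

/-- The flat torus `(ℝ/ℤ)^d`, with its Haar probability measure as `volume`. -/
abbrev Torus (d : ℕ) : Type := UnitAddTorus (Fin d)

/-- Vectors of `ℝ^d` with the Euclidean norm. -/
abbrev Vec (d : ℕ) : Type := EuclideanSpace ℝ (Fin d)

/-- `d × d` arrays with the Frobenius norm; the entry `(i, j)` of a velocity gradient is
`∂_j v_i`. -/
abbrev Grad (d : ℕ) : Type := EuclideanSpace ℝ (Fin d × Fin d)

/-- The covering map `ℝ^d → (ℝ/ℤ)^d`. -/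
def proj {d : ℕ} (y : Fin d → ℝ) : Torus d := fun i => (y i : UnitAddCircle)

/-- The partial derivative `∂_i φ` of a function on the torus. -/
def pderiv {d : ℕ} (i : Fin d) (φ : Torus d → ℝ) (x : Torus d) : ℝ :=
  deriv (fun s : ℝ => φ (x + proj (Pi.single i s))) 0

/-- The divergence, i.e. the trace of a velocity gradient. -/
def divergence {d : ℕ} (G : Grad d) : ℝ := ∑ i, G (i, i)

/-- Lebesgue measure on the space-time cylinder `(0,T) × 𝕋^d`. -/
def cylinder (d : ℕ) (T : ℝ) : Measure (ℝ × Torus d) :=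
  (volume.restrict (Ioo 0 T)).prod volume

/-- `f ∈ L^p(0,T; L^q(𝕋^d))`. -/
def MemMixed {d : ℕ} {E : Type*} [NormedAddCommGroup E] (T : ℝ) (p q : ENNReal)
    (f : ℝ → Torus d → E) : Prop :=
  AEStronglyMeasurable (fun z : ℝ × Torus d => f z.1 z.2) (cylinder d T) ∧
    eLpNorm (fun t => eLpNorm (f t) q volume) p (volume.restrict (Ioo 0 T)) < ⊤

/-- Smooth functions of space on the torus. -/
def SmoothSpace {d : ℕ} (φ : Torus d → ℝ) : Prop :=
  ContDiff ℝ ∞ (fun y : Fin d → ℝ => φ (proj y))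

/-- Smooth functions of time and space on `ℝ × 𝕋^d`. -/
def SmoothSpaceTime {d : ℕ} (φ : ℝ → Torus d → ℝ) : Prop :=
  ContDiff ℝ ∞ (fun z : ℝ × (Fin d → ℝ) => φ z.1 (proj z.2))

/-- Test functions in `C_c^∞((0,T) × 𝕋^d)`. -/
def IsTestInterior {d : ℕ} (T : ℝ) (φ : ℝ → Torus d → ℝ) : Prop :=
  SmoothSpaceTime φ ∧ ∃ a b : ℝ, 0 < a ∧ b < T ∧ ∀ t, t ∉ Icc a b → ∀ x, φ t x = 0

/-- Test functions in `C_c^∞([0,T) × 𝕋^d)`; they need not vanish at time `0`. -/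
def IsTestInitial {d : ℕ} (T : ℝ) (φ : ℝ → Torus d → ℝ) : Prop :=
  SmoothSpaceTime φ ∧ ∃ b : ℝ, b < T ∧ ∀ t, b ≤ t → ∀ x, φ t x = 0

/-- `G` is the spatial gradient of `v` in the sense of distributions on `(0,T) × 𝕋^d`. -/
structure IsWeakGradient {d : ℕ} (T : ℝ) (v : ℝ → Torus d → Vec d)
    (G : ℝ → Torus d → Grad d) : Prop where
  integrable : Integrable (fun z : ℝ × Torus d => v z.1 z.2) (cylinder d T)
  integrable_grad : Integrable (fun z : ℝ × Torus d => G z.1 z.2) (cylinder d T)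
  integral_eq : ∀ (i j : Fin d) (φ : ℝ → Torus d → ℝ), IsTestInterior T φ →
    ∫ t in Ioo 0 T, ∫ x, v t x i * pderiv j (φ t) x =
      -∫ t in Ioo 0 T, ∫ x, G t x (i, j) * φ t x

/-- The total energy `∫ (½ ϱ |v|² + ϱ^γ / (γ - 1)) dx` of a state `(ϱ, v)`. -/
def energy {d : ℕ} (γ : ℝ) (rho : Torus d → ℝ) (v : Torus d → Vec d) : ℝ :=
  ∫ x, (1 / 2 * (rho x * ‖v x‖ ^ 2) + rho x ^ γ / (γ - 1))

/-- The dissipation `∫_0^t ∫ (μ |∇v|² + (μ + lam) |div v|²) dx ds`. -/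
def dissipation {d : ℕ} (μ lam : ℝ) (G : ℝ → Torus d → Grad d) (t : ℝ) : ℝ :=
  ∫ s in Ioo 0 t, ∫ x, (μ * ‖G s x‖ ^ 2 + (μ + lam) * divergence (G s x) ^ 2)

/-- Finite energy weak solutions on `(0,T) × 𝕋^d`, with initial data `(ϱ₀, ϱ₀ v₀)`, of
`ϱ_t + div (ϱ v) = 0`,
`(ϱ v)_t + div (ϱ v ⊗ v) + ∇ ϱ^γ - μ Δ v - (μ + lam) ∇ div v = 0`.
Here `G` is the distributional gradient `∇ v`. The equations and the initial conditions are
expressed together, with test functions in `C_c^∞([0,T) × 𝕋^d)`. No continuity in time of `ϱ` or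
`ϱ v` is imposed. -/
structure IsWeakSolution {d : ℕ} (γ μ lam T : ℝ) (rho0 : Torus d → ℝ) (v0 : Torus d → Vec d)
    (rho : ℝ → Torus d → ℝ) (v : ℝ → Torus d → Vec d) (G : ℝ → Torus d → Grad d) : Prop where
  -- initial data of finite energy
  rho0_nonneg : ∀ᵐ x, 0 ≤ rho0 x
  rho0_meas : AEStronglyMeasurable rho0 volume
  v0_meas : AEStronglyMeasurable v0 volume
  pressure0 : Integrable (fun x => rho0 x ^ γ) volume
  kinetic0 : Integrable (fun x => rho0 x * ‖v0 x‖ ^ 2) volume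
  -- regularity class
  rho_nonneg : ∀ᵐ z ∂(cylinder d T), 0 ≤ rho z.1 z.2
  rho_meas : AEStronglyMeasurable (fun z : ℝ × Torus d => rho z.1 z.2) (cylinder d T)
  weakGradient : IsWeakGradient T v G
  pressure : MemMixed T ⊤ 1 (fun t x => rho t x ^ γ)
  kinetic : MemMixed T ⊤ 1 (fun t x => rho t x * ‖v t x‖ ^ 2)
  gradient : MemMixed T 2 2 G
  -- conservation of mass
  mass : ∀ φ : ℝ → Torus d → ℝ, IsTestInitial T φ →
    (∫ t in Ioo 0 T, ∫ x, (rho t x * deriv (fun s => φ s x) t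
        + ∑ j, rho t x * v t x j * pderiv j (φ t) x))
      + ∫ x, rho0 x * φ 0 x = 0
  -- balance of momentum, component by component
  momentum : ∀ (i : Fin d) (φ : ℝ → Torus d → ℝ), IsTestInitial T φ →
    (∫ t in Ioo 0 T, ∫ x, (rho t x * v t x i * deriv (fun s => φ s x) t
        + ∑ j, rho t x * v t x i * v t x j * pderiv j (φ t) x
        + rho t x ^ γ * pderiv i (φ t) x
        - μ * ∑ j, G t x (i, j) * pderiv j (φ t) x
        - (μ + lam) * divergence (G t x) * pderiv i (φ t) x))
      + ∫ x, rho0 x * v0 x i * φ 0 x = 0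
  -- `ϱ` is a renormalized solution of the continuity equation
  renormalized : ∀ b : ℝ → ℝ, ContDiff ℝ 1 b → (∃ M, ∀ z, M ≤ z → deriv b z = 0) →
    ∀ φ : ℝ → Torus d → ℝ, IsTestInterior T φ →
    ∫ t in Ioo 0 T, ∫ x, (b (rho t x) * deriv (fun s => φ s x) t
        + ∑ j, b (rho t x) * v t x j * pderiv j (φ t) x
        - (deriv b (rho t x) * rho t x - b (rho t x)) * divergence (G t x) * φ t x) = 0
  -- the energy inequality
  energy_le : ∀ᵐ t ∂(volume.restrict (Ioo 0 T)),
    energy γ (rho t) (v t) + dissipation μ lam G t ≤ energy γ rho0 v0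

/-- `(rho', v')` is the representative of the time-dependent state `(rho, v)` for which density and
momentum are weakly continuous on the closed interval `[0,T]` and start from `rho0` and
`rho0 * v0`. It equals `(rho, v)` almost everywhere on `(0,T) × 𝕋^d` and has finite energy at every
time. -/
structure IsWeaklyContinuousRepresentative {d : ℕ} (γ T : ℝ)
    (rho0 : Torus d → ℝ) (v0 : Torus d → Vec d)
    (rho : ℝ → Torus d → ℝ) (v : ℝ → Torus d → Vec d)
    (rho' : ℝ → Torus d → ℝ) (v' : ℝ → Torus d → Vec d) : Prop where
  ae_eq : ∀ᵐ t ∂(volume.restrict (Ioo 0 T)),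
    rho' t =ᵐ[volume] rho t ∧ v' t =ᵐ[volume] v t
  rho_meas : ∀ t ∈ Icc 0 T, AEStronglyMeasurable (rho' t) volume
  v_meas : ∀ t ∈ Icc 0 T, AEStronglyMeasurable (v' t) volume
  rho_nonneg : ∀ t ∈ Icc 0 T, ∀ᵐ x, 0 ≤ rho' t x
  pressure : ∀ t ∈ Icc 0 T, Integrable (fun x => rho' t x ^ γ) volume
  kinetic : ∀ t ∈ Icc 0 T, Integrable (fun x => rho' t x * ‖v' t x‖ ^ 2) volume
  rho_cont : ∀ φ : Torus d → ℝ, SmoothSpace φ →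
    ContinuousOn (fun t => ∫ x, rho' t x * φ x) (Icc 0 T)
  momentum_cont : ∀ (i : Fin d) (φ : Torus d → ℝ), SmoothSpace φ →
    ContinuousOn (fun t => ∫ x, rho' t x * v' t x i * φ x) (Icc 0 T)
  rho_init : rho' 0 =ᵐ[volume] rho0
  momentum_init : (fun x => rho' 0 x • v' 0 x) =ᵐ[volume] fun x => rho0 x • v0 x

end CompressibleNS

end

/-!
A solution that is regular enough to be tested with its own velocity conserves energy. The velocity
is not an admissible test function, so the equations are mollified in space at scale `1 / (n + 1)`,
and the momentum balance is tested with the Favre average `V = (ϱ v)ⁿ / ϱⁿ` (`favre`), the velocity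
of the mollified density and momentum. This choice keeps the mollified continuity equation exact,
`∂_t ϱⁿ + div (ϱⁿ V) = 0`, so that the energy of the mollified state satisfies an exact identity
(`RegularFlow.momEnergy_sub`) whose right hand side (`energyRate`) contains only

* the convective commutator `(ϱ v ⊗ v)ⁿ - (ϱ v)ⁿ ⊗ V`, tested with `∇V`,
* the pressure defect `(ϱ^γ)ⁿ - (ϱⁿ)^γ`, tested with `∇V`,
* the mollified viscous stress, tested with `∇V`.

The gradient `∇V` is bounded, uniformly in `n`, by the product of the norms of `ϱ` and `∇v`
(`lintegral_mul_favreD_le`). For this the mollifier is a product of one-dimensional kernels (`ker`)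
whose gradient is dominated by a multiple of `n` times the kernel itself, so that `∇V` is controlled
by a weighted difference quotient of `v`, whatever the size of the density. With the vacuum excluded
by `c ≤ ϱ`, Hölder's inequality makes all three terms bounded under the relations `ExpRel` between
the reciprocal exponents; `expRel_of_lt` derives the relations from the hypotheses, in space and in
time alike. At almost every time the first two terms tend to zero and the third one to the
dissipation (`tendsto_energyRate`); dominated convergence in time gives the limit of the
differences of energies at every time `t` (`RegularFlow.tendsto_momEnergy_sub`).

The mollified density and momentum are absolutely continuous in time, hence are defined at every
`t` (`smoothVal`). At a fixed time, density and velocity are bounded in `L²`, uniformly in `n`, and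
their weak limits form the weakly continuous representative: the mollifications of the limit state
are the given ones (`RegularFlow.exists_isStateAt`). For a single state, the energies of the
mollifications converge to the energy of the state, by Jensen's inequality from above and Fatou's
lemma from below (`energy_eq_of_tendsto`). Applied at time `t` and at time `0`,
this turns the limit of differences of mollified energies into the energy equality.
-/

noncomputable section

namespace CompressibleNS

open Filter Topology

variable {d : ℕ}

/-! ### Calculus on the torus -/

instance isProbabilityMeasure_unitAddCircle :
    IsProbabilityMeasure (volume : Measure UnitAddCircle) :=
  ⟨UnitAddCircle.measure_univ⟩

instance isNegInvariant_torus : (volume : Measure (Torus d)).IsNegInvariant := by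
  have : (volume : Measure UnitAddCircle).Regular := inferInstance
  have : (volume : Measure UnitAddCircle).IsNegInvariant :=
    Measure.IsAddHaarMeasure.isNegInvariant_of_regular _
  infer_instance

lemma proj_add (y z : Fin d → ℝ) : proj (y + z) = proj y + proj z := by
  funext i; simp [proj]

lemma proj_zero : proj (0 : Fin d → ℝ) = 0 := by
  funext i; simp [proj]

lemma proj_neg (y : Fin d → ℝ) : proj (-y) = -proj y := by
  funext i; simp [proj]

lemma isOpenQuotientMap_proj : IsOpenQuotientMap (proj : (Fin d → ℝ) → Torus d) :=
  IsOpenQuotientMap.piMap (f := fun (_ : Fin d) (y : ℝ) => (y : UnitAddCircle))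
    fun _ => QuotientAddGroup.isOpenQuotientMap_mk

lemma continuous_proj : Continuous (proj : (Fin d → ℝ) → Torus d) :=
  isOpenQuotientMap_proj.continuous

lemma exists_proj_eq (x : Torus d) : ∃ y : Fin d → ℝ, proj y = x :=
  isOpenQuotientMap_proj.surjective x

/-- Every point of the torus has a lift whose coordinates are the distances to `0`. -/
lemma exists_proj_eq_abs_eq_norm (x : Torus d) :
    ∃ y : Fin d → ℝ, proj y = x ∧ ∀ i, |y i| = ‖x i‖ := by
  obtain ⟨z, rfl⟩ := exists_proj_eq x
  refine ⟨fun i => z i - round (z i), ?_, fun i => ?_⟩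
  · funext i
    have : ((round (z i) : ℝ) : UnitAddCircle) = 0 := by
      rw [AddCircle.coe_eq_zero_iff]; exact ⟨round (z i), by simp⟩
    simp [proj, this]
  · simp [proj, UnitAddCircle.norm_eq]

lemma exists_bound_of_continuous {X : Type*} [TopologicalSpace X] [CompactSpace X] {f : X → ℝ}
    (hf : Continuous f) : ∃ C, 0 ≤ C ∧ ∀ x, |f x| ≤ C := by
  obtain ⟨C, hC⟩ := isCompact_univ.exists_bound_of_continuousOn hf.continuousOn
  exact ⟨max C 0, le_max_right _ _, fun x => (hC x (mem_univ _)).trans (le_max_left _ _)⟩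

lemma integrable_of_continuous {f : Torus d → ℝ} (hf : Continuous f) : Integrable f := by
  obtain ⟨C, -, hC⟩ := exists_bound_of_continuous hf
  exact Integrable.of_bound hf.aestronglyMeasurable C (Eventually.of_forall hC)

/-- `g` is the derivative of `f` along the constant vector field `w`. -/
def HasDirDeriv (w : Fin d → ℝ) (f g : Torus d → ℝ) : Prop :=
  ∀ x, HasDerivAt (fun s : ℝ => f (x + proj (s • w))) (g x) 0

/-- The coordinate vector `e_j`. -/
abbrev coordVec (j : Fin d) : Fin d → ℝ := Pi.single j 1

lemma smul_coordVec (j : Fin d) (s : ℝ) : s • coordVec j = Pi.single j s := by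
  rw [← Pi.single_smul]; simp

namespace HasDirDeriv

variable {w : Fin d → ℝ} {f f' g g' : Torus d → ℝ}

lemma hasDerivAt_line (h : HasDirDeriv w f f') (x : Torus d) (s : ℝ) :
    HasDerivAt (fun s : ℝ => f (x + proj (s • w))) (f' (x + proj (s • w))) s := by
  have h1 := h (x + proj (s • w))
  have h2 : HasDerivAt (fun r : ℝ => r - s) 1 s := (hasDerivAt_id s).sub_const s
  have h3 := HasDerivAt.comp (h := fun r : ℝ => r - s)
    (h₂ := fun r : ℝ => f (x + proj (s • w) + proj (r • w))) s (by simpa using h1) h2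
  simp only [mul_one] at h3
  refine h3.congr_of_eventuallyEq (Eventually.of_forall fun r => ?_)
  simp only [Function.comp]
  rw [add_assoc, ← proj_add, ← add_smul]
  simp

lemma const_mul (c : ℝ) (hf : HasDirDeriv w f f') :
    HasDirDeriv w (fun x => c * f x) (fun x => c * f' x) :=
  fun x => (hf x).const_mul c

lemma mul (hf : HasDirDeriv w f f') (hg : HasDirDeriv w g g') :
    HasDirDeriv w (fun x => f x * g x) (fun x => f' x * g x + f x * g' x) := fun x => by
  simpa [proj_zero] using! (hf x).mul (hg x)

lemma div (hf : HasDirDeriv w f f') (hg : HasDirDeriv w g g') (h0 : ∀ x, g x ≠ 0) :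
    HasDirDeriv w (fun x => f x / g x) (fun x => (f' x * g x - f x * g' x) / g x ^ 2) :=
  fun x => by
    simpa [proj_zero] using! (hf x).div (hg x) (by simpa [proj_zero] using h0 x)

lemma rpow (hf : HasDirDeriv w f f') (h0 : ∀ x, 0 < f x) (a : ℝ) :
    HasDirDeriv w (fun x => f x ^ a) (fun x => a * f x ^ (a - 1) * f' x) := fun x => by
  have := (hf x).rpow_const (p := a) (Or.inl (by simpa [proj_zero] using (h0 x).ne'))
  simp only [zero_smul, proj_zero, add_zero] at this
  convert! this using 1
  ring

/-- The integral of a directional derivative over the torus vanishes. -/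
lemma integral_eq_zero (hf : HasDirDeriv w f f') (hfc0 : Continuous f)
    (hf' : Continuous f') : ∫ x, f' x = 0 := by
  -- the average over `s ∈ [0, 1]` of `f(x + h w) - f x` computed in two ways
  have hfc : ∀ x, ∫ s in (0 : ℝ)..1, f' (x + proj (s • w)) = f (x + proj w) - f x := fun x => by
    have hc : Continuous fun s : ℝ => f' (x + proj (s • w)) :=
      hf'.comp (continuous_const.add (continuous_proj.comp (by fun_prop)))
    have := intervalIntegral.integral_eq_sub_of_hasDerivAt (a := 0) (b := 1)
      (f := fun s : ℝ => f (x + proj (s • w)))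
      (fun s _ => hf.hasDerivAt_line x s) (hc.intervalIntegrable _ _)
    simpa [proj_zero] using this
  have hcont : Continuous fun z : Torus d × ℝ => f' (z.1 + proj (z.2 • w)) :=
    hf'.comp (continuous_fst.add (continuous_proj.comp (by fun_prop)))
  obtain ⟨C, hC⟩ := isCompact_univ.exists_bound_of_continuousOn hf'.continuousOn
  have hint : Integrable (fun z : Torus d × ℝ => f' (z.1 + proj (z.2 • w)))
      (volume.prod (volume.restrict (Ioc (0 : ℝ) 1))) :=
    Integrable.of_bound hcont.aestronglyMeasurable C
      (Eventually.of_forall fun z => hC _ (mem_univ _))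
  have h1 := integral_integral_swap (f := fun x (s : ℝ) => f' (x + proj (s • w))) hint
  simp only [integral_add_right_eq_self] at h1
  have h2 : ∀ x, ∫ s in Ioc (0 : ℝ) 1, f' (x + proj (s • w)) = f (x + proj w) - f x := fun x => by
    rw [← hfc x, intervalIntegral.integral_of_le zero_le_one]
  simp only [h2, integral_const, measureReal_restrict_apply_univ, Real.volume_real_Ioc,
    sub_zero, zero_le_one, sup_of_le_left, one_smul] at h1
  rw [← h1]
  have hi := integrable_of_continuous hfc0
  rw [integral_sub (hi.comp_add_right _) hi, integral_add_right_eq_self, sub_self]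

/-- Integration by parts on the torus. -/
lemma integral_mul_eq_neg (hf : HasDirDeriv w f f') (hg : HasDirDeriv w g g')
    (hfc : Continuous f) (hgc : Continuous g) (hfc' : Continuous f') (hgc' : Continuous g') :
    ∫ x, f' x * g x = -∫ x, f x * g' x := by
  have h := (hf.mul hg).integral_eq_zero (hfc.mul hgc) ((hfc'.mul hgc).add (hfc.mul hgc'))
  have h2 := integral_add (integrable_of_continuous (f := fun x => f' x * g x) (hfc'.mul hgc))
    (integrable_of_continuous (f := fun x => f x * g' x) (hfc.mul hgc'))
  linarith [h.symm.trans h2]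

lemma comp_sub_left (hf : HasDirDeriv w f f') (x : Torus d) :
    HasDirDeriv w (fun z => f (x - z)) (fun z => -f' (x - z)) := fun z => by
  have h2 := HasDerivAt.comp (h := fun r : ℝ => -r) (h₂ := fun r : ℝ =>
    f (x - z + proj (r • w))) 0 (by simpa using hf (x - z)) (hasDerivAt_neg 0)
  convert! h2 using 1
  · funext s
    simp only [Function.comp_def, neg_smul, proj_neg]
    congr 1
    abel
  · ring

end HasDirDeriv

lemma continuous_of_comp_proj {f : Torus d → ℝ} (h : Continuous fun y => f (proj y)) :
    Continuous f :=
  isOpenQuotientMap_proj.isQuotientMap.continuous_iff.2 h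

namespace SmoothSpace

variable {ψ : Torus d → ℝ}

lemma continuous (h : SmoothSpace ψ) : Continuous ψ :=
  continuous_of_comp_proj (ContDiff.continuous h)

lemma hasDerivAt (h : SmoothSpace ψ) (w y : Fin d → ℝ) :
    HasDerivAt (fun s : ℝ => ψ (proj y + proj (s • w)))
      (fderiv ℝ (fun y => ψ (proj y)) y w) 0 := by
  have h1 : HasFDerivAt (fun y => ψ (proj y)) (fderiv ℝ (fun y => ψ (proj y)) y)
      (y + (0 : ℝ) • w) := by
    simpa using (h.differentiable (by simp) y).hasFDerivAt
  have h2 : HasDerivAt (fun s : ℝ => y + s • w) w 0 := by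
    simpa using ((hasDerivAt_id (0 : ℝ)).smul_const w).const_add y
  simpa [Function.comp_def, proj_add] using! h1.comp_hasDerivAt (0 : ℝ) h2

lemma pderiv_proj (h : SmoothSpace ψ) (j : Fin d) (y : Fin d → ℝ) :
    pderiv j ψ (proj y) = fderiv ℝ (fun y => ψ (proj y)) y (coordVec j) := by
  simpa [pderiv, smul_coordVec] using (h.hasDerivAt (coordVec j) y).deriv

lemma continuous_pderiv (h : SmoothSpace ψ) (j : Fin d) : Continuous (pderiv j ψ) := by
  refine continuous_of_comp_proj ?_
  simp only [h.pderiv_proj j]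
  exact (h.continuous_fderiv (by simp)).clm_apply continuous_const

lemma hasDirDeriv (h : SmoothSpace ψ) (w : Fin d → ℝ) :
    HasDirDeriv w ψ (fun x => ∑ j, w j * pderiv j ψ x) := fun x => by
  obtain ⟨y, rfl⟩ := exists_proj_eq x
  convert! h.hasDerivAt w y using 1
  simp only [h.pderiv_proj]
  conv_rhs => rw [pi_eq_sum_univ' w]
  simp [map_sum]

lemma hasDirDeriv_coord (h : SmoothSpace ψ) (j : Fin d) :
    HasDirDeriv (coordVec j) ψ (pderiv j ψ) := by
  convert! h.hasDirDeriv (coordVec j) using 1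
  funext x
  simp [Pi.single_apply]

lemma comp_sub_left (h : SmoothSpace ψ) (x : Torus d) : SmoothSpace fun z => ψ (x - z) := by
  obtain ⟨y, rfl⟩ := exists_proj_eq x
  have : (fun z => ψ (proj y - proj z)) = (fun y => ψ (proj y)) ∘ fun z => y - z := by
    funext z
    simp [sub_eq_add_neg, proj_add, proj_neg]
  unfold SmoothSpace
  rw [this]
  exact ContDiff.comp h (contDiff_const.sub contDiff_id)

lemma pderiv_comp_sub_left (h : SmoothSpace ψ) (j : Fin d) (x z : Torus d) :
    pderiv j (fun z => ψ (x - z)) z = -pderiv j ψ (x - z) := by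
  have h1 := ((h.hasDirDeriv_coord j).comp_sub_left x z).deriv
  simpa only [pderiv, smul_coordVec] using h1

end SmoothSpace

/-! ### The mollifying kernel -/

/-- The profile `(1 + N² (1 - cos 2πa))⁻²`. -/
def profile (N a : ℝ) : ℝ := ((1 + N ^ 2 * (1 - Real.cos (2 * Real.pi * a))) ^ 2)⁻¹

lemma profile_base_pos (N a : ℝ) : 0 < 1 + N ^ 2 * (1 - Real.cos (2 * Real.pi * a)) := by
  have := Real.cos_le_one (2 * Real.pi * a)
  nlinarith [sq_nonneg N]

lemma profile_pos (N a : ℝ) : 0 < profile N a :=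
  inv_pos.2 (pow_pos (profile_base_pos N a) 2)

lemma profile_periodic (N : ℝ) : Function.Periodic (profile N) 1 := fun a => by
  simp only [profile, mul_add, mul_one, Real.cos_add_two_pi]

lemma contDiff_profile (N : ℝ) : ContDiff ℝ ∞ (profile N) := by
  unfold profile
  refine ContDiff.inv (by fun_prop) fun a => (pow_pos (profile_base_pos N a) 2).ne'

lemma abs_deriv_profile_le {N : ℝ} (hN : 0 ≤ N) (a : ℝ) :
    |deriv (profile N) a| ≤ 4 * Real.pi * N * profile N a := by
  set s := Real.sin (2 * Real.pi * a) with hs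
  set c := Real.cos (2 * Real.pi * a) with hc
  set b := 1 + N ^ 2 * (1 - c) with hb
  have hbpos : 0 < b := profile_base_pos N a
  have hcos : HasDerivAt (fun a : ℝ => Real.cos (2 * Real.pi * a)) (-s * (2 * Real.pi)) a := by
    have h1 : HasDerivAt (fun a : ℝ => 2 * Real.pi * a) (2 * Real.pi) a := by
      simpa using (hasDerivAt_id a).const_mul (2 * Real.pi)
    exact h1.cos
  have hbase : HasDerivAt (fun a : ℝ => 1 + N ^ 2 * (1 - Real.cos (2 * Real.pi * a)))
      (N ^ 2 * (2 * Real.pi * s)) a := by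
    convert! ((hcos.const_sub 1).const_mul (N ^ 2)).const_add 1 using 1
    ring
  have hder : HasDerivAt (profile N) (-(2 * b * (N ^ 2 * (2 * Real.pi * s))) / (b ^ 2) ^ 2) a := by
    have := (hbase.pow 2).inv (pow_pos hbpos 2).ne'
    convert! this using 1
    simp [hb, hc]
  rw [hder.deriv]
  have hsq : s ^ 2 + c ^ 2 = 1 := Real.sin_sq_add_cos_sq _
  -- `N |sin| ≤ 1 + N² (1 - cos)`, since `sin² ≤ 2 (1 - cos)`
  have key : |N * s| ≤ b := by
    refine abs_le_of_sq_le_sq ?_ hbpos.le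
    have h1 : (N * s) ^ 2 ≤ 2 * (N ^ 2 * (1 - c)) := by
      have : s ^ 2 ≤ 2 * (1 - c) := by nlinarith [sq_nonneg (1 - c)]
      nlinarith [sq_nonneg N]
    nlinarith [sq_nonneg (N ^ 2 * (1 - c))]
  have hp : profile N a = (b ^ 2)⁻¹ := rfl
  rw [hp, abs_div, abs_neg, abs_of_pos (by positivity : 0 < (b ^ 2) ^ 2),
    div_le_iff₀ (by positivity)]
  have e1 : |2 * b * (N ^ 2 * (2 * Real.pi * s))| = 4 * Real.pi * N * b * |N * s| := by
    rw [show 2 * b * (N ^ 2 * (2 * Real.pi * s)) = (4 * Real.pi * N * b) * (N * s) by ring,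
      abs_mul, abs_of_nonneg (by positivity : 0 ≤ 4 * Real.pi * N * b)]
  rw [e1]
  have e2 : 4 * Real.pi * N * (b ^ 2)⁻¹ * (b ^ 2) ^ 2 = 4 * Real.pi * N * b * b := by
    field_simp
  rw [e2]
  exact mul_le_mul_of_nonneg_left key (by positivity)

lemma profile_le {N a : ℝ} (ha : |a| ≤ 1 / 2) :
    N * |a| * profile N a ≤ (1 + (N * a) ^ 2)⁻¹ := by
  have hpi := Real.pi_pos
  have h1 : Real.cos (2 * Real.pi * a) ≤ 1 - 8 * a ^ 2 := by
    have h := Real.cos_le_one_sub_mul_cos_sq (x := 2 * Real.pi * a) (by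
      rw [abs_mul, abs_of_pos (by positivity)]; nlinarith)
    have e : 2 / Real.pi ^ 2 * (2 * Real.pi * a) ^ 2 = 8 * a ^ 2 := by field_simp; ring
    linarith
  have h2 : 1 + (N * a) ^ 2 ≤ 1 + N ^ 2 * (1 - Real.cos (2 * Real.pi * a)) := by
    nlinarith [sq_nonneg N, sq_nonneg (N * a)]
  have h3 : N * |a| ≤ 1 + (N * a) ^ 2 := by
    have : (N * a) ^ 2 = (N * |a|) ^ 2 := by rw [mul_pow, mul_pow, sq_abs]
    rw [this]; nlinarith [sq_nonneg (N * |a| - 1)]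
  have h4 : 0 < 1 + (N * a) ^ 2 := by positivity
  have h5 : profile N a ≤ ((1 + (N * a) ^ 2) ^ 2)⁻¹ := by
    unfold profile; gcongr
  calc N * |a| * profile N a ≤ (1 + (N * a) ^ 2) * ((1 + (N * a) ^ 2) ^ 2)⁻¹ :=
        mul_le_mul h3 h5 (profile_pos N a).le h4.le
    _ = _ := by field_simp

lemma le_profile {N a : ℝ} (ha : |N * a| ≤ 1 / 2) :
    ((1 + Real.pi ^ 2 / 2) ^ 2)⁻¹ ≤ profile N a := by
  have h1 := Real.one_sub_sq_div_two_le_cos (x := 2 * Real.pi * a)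
  have h2 : (N * a) ^ 2 ≤ 1 / 4 := by rw [← sq_abs]; nlinarith [abs_nonneg (N * a)]
  have hb := profile_base_pos N a
  unfold profile
  have : 1 + N ^ 2 * (1 - Real.cos (2 * Real.pi * a)) ≤ 1 + Real.pi ^ 2 / 2 := by
    have e : N ^ 2 * (1 - Real.cos (2 * Real.pi * a)) ≤ N ^ 2 * (2 * Real.pi ^ 2 * a ^ 2) := by
      gcongr; nlinarith
    nlinarith [sq_nonneg Real.pi]
  gcongr

/-- The profile as a function on the circle. -/
def circleProfile (N : ℝ) : UnitAddCircle → ℝ := (profile_periodic N).lift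

@[simp] lemma circleProfile_coe (N a : ℝ) : circleProfile N (a : UnitAddCircle) = profile N a :=
  rfl

lemma continuous_circleProfile (N : ℝ) : Continuous (circleProfile N) :=
  (contDiff_profile N).continuous.quotient_lift _

lemma circleProfile_pos (N : ℝ) (y : UnitAddCircle) : 0 < circleProfile N y := by
  induction y using QuotientAddGroup.induction_on
  exact profile_pos N _

lemma circleProfile_neg (N : ℝ) (y : UnitAddCircle) :
    circleProfile N (-y) = circleProfile N y := by
  induction y using QuotientAddGroup.induction_on with
  | H a =>
    change profile N (-a) = profile N a
    simp [profile]

/-- The mass of the circle profile. -/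
def circleMass (N : ℝ) : ℝ := ∫ y, circleProfile N y

/-- A constant controlling the first moment of the kernel. -/
def momentConst : ℝ := 2 * Real.pi * (1 + Real.pi ^ 2 / 2) ^ 2

lemma momentConst_pos : 0 < momentConst := by unfold momentConst; positivity

lemma le_circleMass {N : ℝ} (hN : 1 ≤ N) :
    (2 * N)⁻¹ * ((1 + Real.pi ^ 2 / 2) ^ 2)⁻¹ ≤ circleMass N := by
  have h0 : 0 < N := by linarith
  have h1 : circleMass N = ∫ a in (0 : ℝ)..1, profile N a := by
    have := UnitAddCircle.intervalIntegral_preimage 0 (circleProfile N)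
    simpa [circleMass] using this.symm
  have hi : ∀ a b : ℝ, IntervalIntegrable (profile N) volume a b :=
    fun a b => (contDiff_profile N).continuous.intervalIntegrable _ _
  have hle : (2 * N)⁻¹ ≤ 1 := inv_le_one_of_one_le₀ (by linarith)
  calc (2 * N)⁻¹ * ((1 + Real.pi ^ 2 / 2) ^ 2)⁻¹
      = ∫ a in (0 : ℝ)..(2 * N)⁻¹, ((1 + Real.pi ^ 2 / 2) ^ 2)⁻¹ := by simp
    _ ≤ ∫ a in (0 : ℝ)..(2 * N)⁻¹, profile N a := by
        refine intervalIntegral.integral_mono_on (by positivity) (by simp) (hi _ _) fun a ha => ?_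
        refine le_profile ?_
        rw [abs_of_nonneg (mul_nonneg h0.le ha.1)]
        calc N * a ≤ N * (2 * N)⁻¹ := by gcongr; exact ha.2
          _ = 1 / 2 := by field_simp
    _ ≤ ∫ a in (0 : ℝ)..1, profile N a := by
        rw [← intervalIntegral.integral_add_adjacent_intervals (hi 0 (2 * N)⁻¹) (hi _ 1)]
        have := intervalIntegral.integral_nonneg (μ := volume) hle
          (fun a _ => (profile_pos N a).le)
        linarith
    _ = circleMass N := h1.symm

lemma circleMass_pos {N : ℝ} (hN : 1 ≤ N) : 0 < circleMass N :=
  lt_of_lt_of_le (by have : 0 < N := by linarith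
                     positivity) (le_circleMass hN)

lemma circle_moment_le {N : ℝ} (hN : 1 ≤ N) :
    ∫ y : UnitAddCircle, ‖y‖ * (circleProfile N y / circleMass N) ≤ momentConst / N := by
  have h0 : 0 < N := by linarith
  have h1 : ∫ y : UnitAddCircle, ‖y‖ * circleProfile N y ≤ Real.pi / N ^ 2 := by
    have := UnitAddCircle.intervalIntegral_preimage (-(1 / 2))
      (fun y => ‖y‖ * circleProfile N y)
    rw [← this]
    have hb : (-(1 / 2) + 1 : ℝ) = 1 / 2 := by norm_num
    rw [hb]
    have hcont : Continuous fun a : ℝ => ‖(a : UnitAddCircle)‖ * circleProfile N a :=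
      (continuous_norm.comp (AddCircle.continuous_mk' 1)).mul (contDiff_profile N).continuous
    have hder : ∀ a : ℝ, HasDerivAt (fun a => Real.arctan (N * a) / N ^ 2)
        (N⁻¹ * (1 + (N * a) ^ 2)⁻¹) a := fun a => by
      have := (((hasDerivAt_id a).const_mul N).arctan).div_const (N ^ 2)
      convert! this using 1
      simp only [id, mul_one]
      field_simp
    have hcont2 : Continuous fun a : ℝ => N⁻¹ * (1 + (N * a) ^ 2)⁻¹ :=
      continuous_const.mul (Continuous.inv₀ (by fun_prop) fun a => by positivity)
    calc ∫ a in (-(1 / 2) : ℝ)..1 / 2, ‖(a : UnitAddCircle)‖ * circleProfile N a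
        ≤ ∫ a in (-(1 / 2) : ℝ)..1 / 2, N⁻¹ * (1 + (N * a) ^ 2)⁻¹ := by
          refine intervalIntegral.integral_mono_on (by norm_num) (hcont.intervalIntegrable _ _)
            (hcont2.intervalIntegrable _ _) fun a ha => ?_
          have ha' : |a| ≤ 1 / 2 := abs_le.2 ha
          have hna : ‖(a : UnitAddCircle)‖ = |a| := by
            rw [AddCircle.norm_coe_eq_abs_iff]
            · simpa using ha'
            · norm_num
          rw [hna, circleProfile_coe]
          have := profile_le (N := N) ha'
          rw [inv_mul_eq_div, le_div_iff₀ h0]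
          linarith
      _ = Real.arctan (N * (1 / 2)) / N ^ 2 - Real.arctan (N * (-(1 / 2))) / N ^ 2 :=
          intervalIntegral.integral_eq_sub_of_hasDerivAt (fun a _ => hder a)
            (hcont2.intervalIntegrable _ _)
      _ ≤ Real.pi / N ^ 2 := by
          rw [← sub_div]
          gcongr
          have := Real.arctan_lt_pi_div_two (N * (1 / 2))
          have := Real.neg_pi_div_two_lt_arctan (N * (-(1 / 2)))
          linarith
  have h2 := le_circleMass hN
  have h3 := circleMass_pos hN
  simp only [← mul_div_assoc]
  rw [integral_div, div_le_div_iff₀ h3 h0]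
  calc (∫ y : UnitAddCircle, ‖y‖ * circleProfile N y) * N ≤ Real.pi / N ^ 2 * N := by gcongr
    _ = momentConst * ((2 * N)⁻¹ * ((1 + Real.pi ^ 2 / 2) ^ 2)⁻¹) := by
        unfold momentConst; field_simp
    _ ≤ momentConst * circleMass N := by
        have := momentConst_pos
        gcongr

/-- The mollifying kernel at scale `1 / N` on the torus: a product of normalized circle profiles.
Its tails are heavy enough for its gradient to be at most `C N` times the kernel itself, and light
enough for its first moment to be at most `C / N`. -/
def ker (N : ℝ) (y : Torus d) : ℝ := ∏ i, circleProfile N (y i) / circleMass N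

variable {N : ℝ}

lemma continuous_ker : Continuous (ker N : Torus d → ℝ) := by
  unfold ker
  exact continuous_finsetProd _ fun i _ =>
    ((continuous_circleProfile N).comp (continuous_apply i)).div_const _

lemma ker_pos (hN : 1 ≤ N) (y : Torus d) : 0 < ker N y :=
  Finset.prod_pos fun _ _ => div_pos (circleProfile_pos N _) (circleMass_pos hN)

lemma ker_neg (y : Torus d) : ker N (-y) = ker N y := by
  simp [ker, circleProfile_neg]

lemma integral_ker (hN : 1 ≤ N) : ∫ y : Torus d, ker N y = 1 := by
  unfold ker
  rw [volume_pi, integral_fintype_prod_eq_prod (fun (_ : Fin d) (y : UnitAddCircle) =>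
    circleProfile N y / circleMass N)]
  refine Finset.prod_eq_one fun i _ => ?_
  rw [integral_div]
  exact div_self (circleMass_pos hN).ne'

lemma smoothSpace_ker : SmoothSpace (ker N : Torus d → ℝ) := by
  unfold SmoothSpace ker
  simp only [proj, circleProfile_coe]
  exact contDiff_prod fun i _ => ((contDiff_profile N).comp (contDiff_apply ℝ ℝ i)).div_const _

/-- The sum of the distances of the coordinates to `0`. -/
def dist1 (y : Torus d) : ℝ := ∑ j, ‖y j‖

lemma continuous_dist1 : Continuous (dist1 : Torus d → ℝ) := by
  unfold dist1
  fun_prop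

lemma dist1_nonneg (y : Torus d) : 0 ≤ dist1 y := Finset.sum_nonneg fun _ _ => norm_nonneg _

lemma integral_dist1_ker_le (hN : 1 ≤ N) :
    ∫ y : Torus d, dist1 y * ker N y ≤ d * momentConst / N := by
  have h1 : ∀ j : Fin d, ∫ y : Torus d, ‖y j‖ * ker N y ≤ momentConst / N := fun j => by
    have e : ∀ y : Torus d, ‖y j‖ * ker N y =
        ∏ i, (if i = j then ‖y i‖ else 1) * (circleProfile N (y i) / circleMass N) := fun y => by
      rw [Finset.prod_mul_distrib, ker, Finset.prod_ite_eq' Finset.univ j]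
      simp
    simp only [e]
    rw [volume_pi, integral_fintype_prod_eq_prod (fun (i : Fin d) (y : UnitAddCircle) =>
      (if i = j then ‖y‖ else 1) * (circleProfile N y / circleMass N)),
      Finset.prod_eq_single j]
    · simpa using circle_moment_le hN
    · intro i _ hij
      simp only [hij, if_false, one_mul]
      rw [integral_div]
      exact div_self (circleMass_pos hN).ne'
    · simp
  unfold dist1
  simp only [Finset.sum_mul]
  rw [integral_finsetSum _ fun j _ => integrable_of_continuous (by
    have := continuous_ker (d := d) (N := N)
    fun_prop)]
  calc ∑ j, ∫ y : Torus d, ‖y j‖ * ker N y ≤ ∑ _j : Fin d, momentConst / N :=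
        Finset.sum_le_sum fun j _ => h1 j
    _ = _ := by simp [mul_div_assoc]

lemma abs_pderiv_ker_le (hN : 1 ≤ N) (j : Fin d) (x : Torus d) :
    |pderiv j (ker N) x| ≤ 4 * Real.pi * N * ker N x := by
  obtain ⟨y, rfl⟩ := exists_proj_eq x
  set A : ℝ := ∏ i ∈ Finset.univ.erase j, profile N (y i) / circleMass N with hA
  have hApos : 0 < A := Finset.prod_pos fun i _ => div_pos (profile_pos N _) (circleMass_pos hN)
  have e : ∀ s : ℝ, ker N (proj y + proj (Pi.single j s)) =
      profile N (y j + s) / circleMass N * A := fun s => by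
    rw [← proj_add]
    unfold ker
    rw [← Finset.mul_prod_erase _ _ (Finset.mem_univ j)]
    congr 1
    · simp only [proj, Pi.add_apply, Pi.single_eq_same, circleProfile_coe]
    · refine Finset.prod_congr rfl fun i hi => ?_
      simp [proj, Finset.ne_of_mem_erase hi]
  have h0 : ker N (proj y) = profile N (y j) / circleMass N * A := by
    simpa [proj_zero] using e 0
  have hd : HasDerivAt (fun s => profile N (y j + s) / circleMass N * A)
      (deriv (profile N) (y j) / circleMass N * A) 0 := by
    have h1 : HasDerivAt (profile N) (deriv (profile N) (y j)) (y j + 0) := by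
      rw [add_zero]
      exact ((contDiff_profile N).differentiable (by simp) (y j)).hasDerivAt
    exact ((h1.comp_const_add (y j) 0).div_const _).mul_const A
  have h2 : pderiv j (ker N) (proj y) = deriv (profile N) (y j) / circleMass N * A := by
    unfold pderiv
    simp only [e]
    exact hd.deriv
  have hm := circleMass_pos hN
  rw [h2, h0, abs_mul, abs_div, abs_of_pos hm, abs_of_pos hApos]
  calc |deriv (profile N) (y j)| / circleMass N * A
      ≤ 4 * Real.pi * N * profile N (y j) / circleMass N * A := by
        gcongr
        exact abs_deriv_profile_le (by linarith) _
    _ = _ := by ring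

/-! ### Convolution on the torus -/

/-- The convolution of `f` with the kernel `k`. -/
def cv (k f : Torus d → ℝ) (x : Torus d) : ℝ := ∫ y, f y * k (x - y)

section Convolution

variable {k k' f g : Torus d → ℝ}

lemma integrable_mul_kernel (hk : Continuous k) (hf : Integrable f) (x : Torus d) :
    Integrable fun y => f y * k (x - y) := by
  obtain ⟨C, -, hC⟩ := exists_bound_of_continuous hk
  exact hf.mul_bdd (c := C) (Continuous.aestronglyMeasurable (by fun_prop))
    (Eventually.of_forall fun y => hC _)

lemma cv_eq_integral_sub (k f : Torus d → ℝ) (x : Torus d) :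
    cv k f x = ∫ y, f (x - y) * k y := by
  rw [cv, ← integral_sub_left_eq_self (fun y => f y * k (x - y)) volume x]
  simp

lemma integrable_mul_kernel_sub (hk : Continuous k) (hf : Integrable f) (x : Torus d) :
    Integrable fun y => f (x - y) * k y := by
  simpa using (integrable_mul_kernel hk hf x).comp_sub_left x

lemma continuous_cv (hk : Continuous k) (hf : Integrable f) : Continuous (cv k f) := by
  obtain ⟨C, -, hC⟩ := exists_bound_of_continuous hk
  refine continuous_of_dominated (bound := fun y => |f y| * C)
    (fun x => (integrable_mul_kernel hk hf x).aestronglyMeasurable)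
    (fun x => Eventually.of_forall fun y => ?_) (hf.abs.mul_const C)
    (Eventually.of_forall fun y => by fun_prop)
  rw [Real.norm_eq_abs, abs_mul]
  exact mul_le_mul_of_nonneg_left (hC _) (abs_nonneg _)

lemma abs_cv_le {C : ℝ} (hC : ∀ x, |k x| ≤ C) (hf : Integrable f)
    (x : Torus d) : |cv k f x| ≤ C * ∫ y, |f y| := by
  rw [cv, ← integral_const_mul]
  refine (abs_integral_le_integral_abs).trans (integral_mono_of_nonneg
    (Eventually.of_forall fun y => abs_nonneg _) (hf.abs.const_mul C)
    (Eventually.of_forall fun y => ?_))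
  simp only [abs_mul, mul_comm C]
  exact mul_le_mul_of_nonneg_left (hC _) (abs_nonneg _)

lemma cv_add (hk : Continuous k) (hf : Integrable f) (hg : Integrable g) (x : Torus d) :
    cv k (fun y => f y + g y) x = cv k f x + cv k g x := by
  simp only [cv, add_mul]
  exact integral_add (integrable_mul_kernel hk hf x) (integrable_mul_kernel hk hg x)

lemma cv_sub (hk : Continuous k) (hf : Integrable f) (hg : Integrable g) (x : Torus d) :
    cv k (fun y => f y - g y) x = cv k f x - cv k g x := by
  simp only [cv, sub_mul]
  exact integral_sub (integrable_mul_kernel hk hf x) (integrable_mul_kernel hk hg x)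

lemma cv_const_mul (c : ℝ) (k f : Torus d → ℝ) (x : Torus d) :
    cv k (fun y => c * f y) x = c * cv k f x := by
  simp only [cv, mul_assoc]
  exact integral_const_mul _ _

/-- A convolution may be differentiated on the kernel. -/
lemma hasDirDeriv_cv {w : Fin d → ℝ} (h : HasDirDeriv w k k') (hk : Continuous k)
    (hk' : Continuous k') (hf : Integrable f) : HasDirDeriv w (cv k f) (cv k' f) := fun x => by
  obtain ⟨C, -, hC⟩ := exists_bound_of_continuous hk'
  have := hasDerivAt_integral_of_dominated_loc_of_deriv_le (μ := volume) (x₀ := (0 : ℝ))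
    (F := fun s y => f y * k (x + proj (s • w) - y))
    (F' := fun s y => f y * k' (x + proj (s • w) - y)) (bound := fun y => |f y| * C)
    univ_mem (Eventually.of_forall fun s => (integrable_mul_kernel hk hf _).aestronglyMeasurable)
    (integrable_mul_kernel hk hf _) (integrable_mul_kernel hk' hf _).aestronglyMeasurable
    (Eventually.of_forall fun y s _ => ?_) (hf.abs.mul_const C)
    (Eventually.of_forall fun y s _ => ?_)
  · simpa [cv, proj_zero] using! this.2
  · rw [Real.norm_eq_abs, abs_mul]
    exact mul_le_mul_of_nonneg_left (hC _) (abs_nonneg _)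
  · have h1 := (h.hasDerivAt_line (x - y) s).const_mul (f y)
    simpa only [sub_add_eq_add_sub] using h1

lemma integrable_prod_kernel (hk : Continuous k) (hf : Integrable f) (hg : Integrable g) :
    Integrable (fun z : Torus d × Torus d => f z.2 * k (z.1 - z.2) * g z.1)
      (volume.prod volume) := by
  obtain ⟨C, -, hC⟩ := exists_bound_of_continuous hk
  have h1 : Integrable (fun z : Torus d × Torus d => g z.1 * f z.2) (volume.prod volume) :=
    hg.mul_prod hf
  have h2 := h1.mul_bdd (g := fun z : Torus d × Torus d => k (z.1 - z.2)) (c := C)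
    (Continuous.aestronglyMeasurable (by fun_prop)) (Eventually.of_forall fun y => hC _)
  refine h2.congr (Eventually.of_forall fun z => ?_)
  ring

/-- Convolution with `k` is dual to convolution with the reflected kernel. -/
lemma integral_cv_mul (hk : Continuous k) (hk' : ∀ y, k' y = k (-y)) (hf : Integrable f)
    (hg : Integrable g) : ∫ x, cv k f x * g x = ∫ x, f x * cv k' g x := by
  have h1 : ∀ x, cv k f x * g x = ∫ y, f y * k (x - y) * g x := fun x => by
    rw [cv, integral_mul_const]
  have h2 : ∀ y, f y * cv k' g y = ∫ x, f y * k (x - y) * g x := fun y => by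
    rw [cv, ← integral_const_mul]
    congr 1
    funext x
    rw [hk', neg_sub]
    ring
  simp only [h1, h2]
  exact integral_integral_swap (integrable_prod_kernel hk hf hg)

/-- Convolutions commute. -/
lemma cv_comm (hk : Continuous k) (hk' : Continuous k') (hf : Integrable f) :
    cv k (cv k' f) = cv k' (cv k f) := by
  funext x
  have h1 : ∀ h h' : Torus d → ℝ, Continuous h → Continuous h' →
      cv h (cv h' f) x = ∫ z, f z * ∫ y, h' (y - z) * h (x - y) := fun h h' hh hh' => by
    have e1 : ∀ y, cv h' f y * h (x - y) = ∫ z, f z * h' (y - z) * h (x - y) := fun y => by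
      rw [cv, integral_mul_const]
    rw [cv]
    simp only [e1]
    rw [integral_integral_swap (integrable_prod_kernel (g := fun y => h (x - y)) hh' hf
      (integrable_of_continuous (by fun_prop)))]
    simp only [mul_assoc, integral_const_mul]
  rw [h1 k k' hk hk', h1 k' k hk' hk]
  congr 1
  funext z
  congr 1
  rw [← integral_sub_left_eq_self (fun y => k' (y - z) * k (x - y)) volume (x + z)]
  congr 1
  funext y
  rw [show x + z - y - z = x - y by abel, show x - (x + z - y) = y - z by abel, mul_comm]

end Convolution

/-! ### Mollification -/

/-- The mollifying kernel at scale `1 / (n + 1)`. -/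
def kern (n : ℕ) : Torus d → ℝ := ker ((n : ℝ) + 1)

/-- The spatial mollification at scale `1 / (n + 1)`. -/
def moll (n : ℕ) (f : Torus d → ℝ) : Torus d → ℝ := cv (kern n) f

/-- The partial derivative `∂_j` of the mollification. -/
def mollD (n : ℕ) (j : Fin d) (f : Torus d → ℝ) : Torus d → ℝ := cv (pderiv j (kern n)) f

lemma one_le_scale (n : ℕ) : (1 : ℝ) ≤ (n : ℝ) + 1 := by
  have : (0 : ℝ) ≤ n := n.cast_nonneg
  linarith

section Mollification

variable {n m : ℕ} {f g : Torus d → ℝ} {j : Fin d}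

lemma continuous_kern : Continuous (kern n : Torus d → ℝ) := continuous_ker

lemma kern_pos (x : Torus d) : 0 < kern n x := ker_pos (one_le_scale n) x

lemma kern_neg (x : Torus d) : kern n (-x) = kern n x := ker_neg x

lemma integral_kern : ∫ y : Torus d, kern n y = 1 := integral_ker (one_le_scale n)

lemma smoothSpace_kern : SmoothSpace (kern n : Torus d → ℝ) := smoothSpace_ker

lemma continuous_pderiv_kern : Continuous (pderiv j (kern n : Torus d → ℝ)) :=
  smoothSpace_kern.continuous_pderiv j

lemma abs_pderiv_kern_le (x : Torus d) :
    |pderiv j (kern n) x| ≤ 4 * Real.pi * ((n : ℝ) + 1) * kern n x :=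
  abs_pderiv_ker_le (one_le_scale n) j x

lemma pderiv_kern_neg (x : Torus d) : -pderiv j (kern n) x = pderiv j (kern n) (-x) := by
  have h := smoothSpace_kern.pderiv_comp_sub_left (ψ := (kern n : Torus d → ℝ)) j 0 (-x)
  simp only [zero_sub, neg_neg, kern_neg] at h
  exact h.symm

lemma continuous_moll (hf : Integrable f) : Continuous (moll n f) :=
  continuous_cv continuous_kern hf

lemma continuous_mollD (hf : Integrable f) : Continuous (mollD n j f) :=
  continuous_cv continuous_pderiv_kern hf

lemma hasDirDeriv_moll (hf : Integrable f) : HasDirDeriv (coordVec j) (moll n f) (mollD n j f) :=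
  hasDirDeriv_cv (smoothSpace_kern.hasDirDeriv_coord j) continuous_kern continuous_pderiv_kern hf

lemma integral_moll_mul (hf : Integrable f) (hg : Integrable g) :
    ∫ x, moll n f x * g x = ∫ x, f x * moll n g x :=
  integral_cv_mul continuous_kern (fun y => (kern_neg y).symm) hf hg

lemma integral_mollD_mul (hf : Integrable f) (hg : Integrable g) :
    ∫ x, mollD n j f x * g x = -∫ x, f x * mollD n j g x := by
  rw [mollD, integral_cv_mul (k' := fun y => pderiv j (kern n) (-y)) continuous_pderiv_kern
    (fun y => rfl) hf hg, ← integral_neg]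
  congr 1
  funext x
  rw [← mul_neg]
  congr 1
  simp only [cv, mollD, ← pderiv_kern_neg, mul_neg, integral_neg]

lemma integral_kern_sub (x : Torus d) : ∫ y, kern n (x - y) = 1 := by
  rw [integral_sub_left_eq_self (fun y => kern n y) volume x, integral_kern]

lemma moll_const (c : ℝ) (x : Torus d) : moll n (fun _ => c) x = c := by
  rw [moll, cv, integral_const_mul, integral_kern_sub, mul_one]

lemma moll_mono (hf : Integrable f) (hg : Integrable g) (h : f ≤ᵐ[volume] g) (x : Torus d) :
    moll n f x ≤ moll n g x := by
  refine integral_mono_ae (integrable_mul_kernel continuous_kern hf x)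
    (integrable_mul_kernel continuous_kern hg x) ?_
  filter_upwards [h] with y hy
  exact mul_le_mul_of_nonneg_right hy (kern_pos _).le

lemma le_moll {c : ℝ} (hf : Integrable f) (h : ∀ᵐ x, c ≤ f x) (x : Torus d) :
    c ≤ moll n f x := by
  rw [← moll_const (n := n) c x]
  exact moll_mono (integrable_const c) hf h x

lemma moll_nonneg (h : ∀ᵐ x, 0 ≤ f x) (x : Torus d) : 0 ≤ moll n f x := by
  refine integral_nonneg_of_ae ?_
  filter_upwards [h] with y hy
  exact mul_nonneg hy (kern_pos _).le

lemma integral_moll (hf : Integrable f) : ∫ x, moll n f x = ∫ x, f x := by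
  have h := integral_moll_mul (n := n) hf (integrable_const (1 : ℝ))
  simpa [moll_const] using h

/-- The probability measure with density `y ↦ kern n (x - y)`. -/
def kernMeasure (n : ℕ) (x : Torus d) : Measure (Torus d) :=
  volume.withDensity fun y => ENNReal.ofReal (kern n (x - y))

lemma measurable_kern_sub (x : Torus d) : Measurable fun y => kern n (x - y) :=
  (continuous_kern.comp (continuous_const.sub continuous_id)).measurable

instance (n : ℕ) (x : Torus d) : IsProbabilityMeasure (kernMeasure n x) := by
  refine ⟨?_⟩
  rw [kernMeasure, withDensity_apply _ MeasurableSet.univ, Measure.restrict_univ,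
    ← ofReal_integral_eq_lintegral_ofReal (f := fun y => kern n (x - y))
      (integrable_of_continuous (continuous_kern.comp (continuous_const.sub continuous_id)))
      (Eventually.of_forall fun y => (kern_pos _).le)]
  simp [integral_kern_sub]

lemma integral_kernMeasure (x : Torus d) (f : Torus d → ℝ) :
    ∫ y, f y ∂(kernMeasure n x) = moll n f x := by
  rw [kernMeasure, integral_withDensity_eq_integral_toReal_smul
    (measurable_kern_sub x).ennreal_ofReal (Eventually.of_forall fun _ => ENNReal.ofReal_lt_top)]
  simp [moll, cv, ENNReal.toReal_ofReal (kern_pos _).le, mul_comm]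

lemma integrable_kernMeasure (x : Torus d) (hf : Integrable f) :
    Integrable f (kernMeasure n x) := by
  rw [kernMeasure, integrable_withDensity_iff_integrable_smul'
    (measurable_kern_sub x).ennreal_ofReal (Eventually.of_forall fun _ => ENNReal.ofReal_lt_top)]
  refine (integrable_mul_kernel (k := kern n) continuous_kern hf x).congr
    (Eventually.of_forall fun y => ?_)
  simp [ENNReal.toReal_ofReal (kern_pos _).le, mul_comm]

lemma kernMeasure_absolutelyContinuous (x : Torus d) :
    kernMeasure n x ≪ (volume : Measure (Torus d)) :=
  withDensity_absolutelyContinuous _ _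

/-- Jensen's inequality for the mollification of a power. -/
lemma rpow_moll_le {α : ℝ} (hα : 1 ≤ α) (h0 : ∀ᵐ x, 0 ≤ f x) (hf : Integrable f)
    (hfα : Integrable fun x => f x ^ α) (x : Torus d) :
    moll n f x ^ α ≤ moll n (fun y => f y ^ α) x := by
  have := (convexOn_rpow hα).map_integral_le (μ := kernMeasure n x) (f := f)
    (Real.continuous_rpow_const (by linarith)).continuousOn isClosed_Ici
    ((kernMeasure_absolutelyContinuous x).ae_le h0) (integrable_kernMeasure x hf)
    (integrable_kernMeasure x hfα)
  simpa only [integral_kernMeasure] using this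

lemma abs_moll_le (x : Torus d) : |moll n f x| ≤ moll n (fun y => |f y|) x := by
  refine abs_integral_le_integral_abs.trans (le_of_eq ?_)
  simp [moll, cv, abs_mul, abs_of_pos (kern_pos _)]

/-- The Cauchy-Schwarz inequality for mollifications with weight `ρ`. -/
lemma sq_moll_div_le {ρ v : Torus d → ℝ} (hρ : Integrable ρ) (h0 : ∀ᵐ x, 0 ≤ ρ x)
    (hm : Integrable fun x => ρ x * v x) (hk : Integrable fun x => ρ x * v x ^ 2) (x : Torus d)
    (hpos : 0 < moll n ρ x) :
    moll n (fun y => ρ y * v y) x ^ 2 / moll n ρ x ≤ moll n (fun y => ρ y * v y ^ 2) x := by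
  set R := moll n ρ x
  set M := moll n (fun y => ρ y * v y) x with hM
  have h1 : 0 ≤ moll n (fun y => ρ y * v y ^ 2 - (2 * (M / R)) * (ρ y * v y) +
      (M / R) ^ 2 * ρ y) x := moll_nonneg (by
    filter_upwards [h0] with y hy
    have : ρ y * v y ^ 2 - (2 * (M / R)) * (ρ y * v y) + (M / R) ^ 2 * ρ y =
        ρ y * (v y - M / R) ^ 2 := by ring
    rw [this]
    positivity) x
  have hc := continuous_kern (d := d) (n := n)
  have hm' := hm.const_mul (2 * (M / R))
  rw [moll, cv_add (f := fun y => ρ y * v y ^ 2 - (2 * (M / R)) * (ρ y * v y)) hc (hk.sub hm')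
    (hρ.const_mul _), cv_sub hc hk hm', cv_const_mul, cv_const_mul] at h1
  change 0 ≤ moll n (fun y => ρ y * v y ^ 2) x - 2 * (M / R) * M + (M / R) ^ 2 * R at h1
  have h2 : 2 * (M / R) * M - (M / R) ^ 2 * R = M ^ 2 / R := by field_simp; ring
  linarith

end Mollification

/-! ### Convergence of mollifications -/

section Approximation

variable {n : ℕ} {f g : Torus d → ℝ}

lemma norm_le_dist1 (y : Torus d) : ‖y‖ ≤ dist1 y := by
  rw [pi_norm_le_iff_of_nonneg (dist1_nonneg y)]
  exact fun i => Finset.single_le_sum (f := fun j => ‖y j‖) (fun j _ => norm_nonneg _)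
    (Finset.mem_univ i)

lemma integral_dist1_kern_le :
    ∫ y : Torus d, dist1 y * kern n y ≤ d * momentConst / ((n : ℝ) + 1) :=
  integral_dist1_ker_le (one_le_scale n)

lemma integrable_dist1_kern : Integrable fun y : Torus d => dist1 y * kern n y :=
  integrable_of_continuous (continuous_dist1.mul continuous_kern)

lemma abs_moll_sub_le {A B : ℝ} (hB : 0 ≤ B) (hg : Integrable g) {x : Torus d}
    (hAB : ∀ y, |g (x - y) - g x| ≤ A + B * dist1 y) :
    |moll n g x - g x| ≤ A + B * (d * momentConst / ((n : ℝ) + 1)) := by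
  have hk := continuous_kern (d := d) (n := n)
  have e1 : moll n g x - g x = ∫ y, (g (x - y) - g x) * kern n y := by
    have h1 := integral_sub (integrable_mul_kernel_sub hk hg x)
      ((integrable_of_continuous hk).const_mul (g x))
    rw [integral_const_mul, integral_kern, mul_one, ← cv_eq_integral_sub] at h1
    rw [moll, ← h1]
    congr 1
    funext y
    ring
  rw [e1]
  calc |∫ y, (g (x - y) - g x) * kern n y| ≤ ∫ y, |(g (x - y) - g x) * kern n y| :=
        abs_integral_le_integral_abs
    _ ≤ ∫ y, (A * kern n y + B * (dist1 y * kern n y)) := by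
        refine integral_mono_of_nonneg (Eventually.of_forall fun y => abs_nonneg _)
          (((integrable_of_continuous hk).const_mul A).add (integrable_dist1_kern.const_mul B))
          (Eventually.of_forall fun y => ?_)
        have := kern_pos (n := n) y
        simp only [abs_mul, abs_of_pos this]
        calc _ ≤ (A + B * dist1 y) * kern n y := by gcongr; exact hAB y
          _ = _ := by ring
    _ = A + B * ∫ y : Torus d, dist1 y * kern n y := by
        rw [integral_add ((integrable_of_continuous hk).const_mul A)
          (integrable_dist1_kern.const_mul B), integral_const_mul, integral_const_mul,
          integral_kern, mul_one]
    _ ≤ _ := by gcongr; exact integral_dist1_kern_le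

lemma tendsto_moment_bound (B : ℝ) :
    Tendsto (fun n : ℕ => B * (d * momentConst / ((n : ℝ) + 1))) atTop (𝓝 0) := by
  have := (tendsto_one_div_add_atTop_nhds_zero_nat (𝕜 := ℝ)).const_mul (B * (d * momentConst))
  simp only [mul_zero] at this
  refine this.congr fun n => ?_
  ring

/-- Mollifications of a continuous function converge uniformly. -/
lemma eventually_abs_moll_sub_le (hg : Continuous g) {ε : ℝ} (hε : 0 < ε) :
    ∀ᶠ n : ℕ in atTop, ∀ x, |moll n g x - g x| ≤ ε := by
  obtain ⟨C, hC0, hC⟩ := exists_bound_of_continuous hg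
  obtain ⟨δ, hδ, h⟩ := Metric.uniformContinuous_iff.1
    (CompactSpace.uniformContinuous_of_continuous hg) (ε / 2) (half_pos hε)
  have hB : 0 ≤ 2 * C / δ := by positivity
  filter_upwards [(tendsto_moment_bound (d := d) (2 * C / δ)).eventually_le_const
    (half_pos hε)] with n hn x
  refine (abs_moll_sub_le (A := ε / 2) hB (integrable_of_continuous hg) fun y => ?_).trans
    (by linarith)
  have hd := dist1_nonneg y
  by_cases hy : ‖y‖ < δ
  · have := h (a := x - y) (b := x) (by simpa [dist_eq_norm] using hy)
    rw [Real.dist_eq] at this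
    have : 0 ≤ 2 * C / δ * dist1 y := by positivity
    linarith
  · have h1 : |g (x - y) - g x| ≤ 2 * C := by
      have := abs_sub (g (x - y)) (g x)
      linarith [hC (x - y), hC x]
    have h2 : 2 * C ≤ 2 * C / δ * dist1 y := by
      rw [div_mul_eq_mul_div, le_div_iff₀ hδ]
      have := norm_le_dist1 y
      gcongr
      linarith
    linarith

lemma tendsto_moll_of_continuous (hg : Continuous g) (x : Torus d) :
    Tendsto (fun n => moll n g x) atTop (𝓝 (g x)) := by
  rw [Metric.tendsto_nhds]
  intro ε hε
  filter_upwards [eventually_abs_moll_sub_le hg (half_pos hε)] with n hn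
  rw [Real.dist_eq]
  linarith [hn x]

/-- Mollification does not increase `L^p` norms. -/
lemma eLpNorm_moll_le {p : ENNReal} (hp : 1 ≤ p) (hp' : p ≠ ⊤) (hf : MemLp f p) :
    eLpNorm (moll n f) p volume ≤ eLpNorm f p volume := by
  have hp0 : p ≠ 0 := (zero_lt_one.trans_le hp).ne'
  have hfi : Integrable f := hf.integrable hp
  have hα : 1 ≤ p.toReal := by
    rw [← ENNReal.toReal_one]; exact ENNReal.toReal_mono hp' hp
  have hfp : Integrable fun x => |f x| ^ p.toReal := hf.integrable_norm_rpow hp0 hp'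
  have hm : MemLp (moll n f) p := by
    obtain ⟨C, -, hC⟩ := exists_bound_of_continuous (continuous_moll (n := n) hfi)
    exact MemLp.of_bound (continuous_moll hfi).aestronglyMeasurable C (Eventually.of_forall hC)
  rw [hm.eLpNorm_eq_integral_rpow_norm hp0 hp', hf.eLpNorm_eq_integral_rpow_norm hp0 hp']
  refine ENNReal.ofReal_le_ofReal (Real.rpow_le_rpow (integral_nonneg fun x => by positivity) ?_
    (by positivity))
  calc ∫ x, ‖moll n f x‖ ^ p.toReal ≤ ∫ x, moll n (fun y => |f y| ^ p.toReal) x := by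
        refine integral_mono (hm.integrable_norm_rpow hp0 hp')
          (integrable_of_continuous (continuous_moll hfp)) fun x => ?_
        calc ‖moll n f x‖ ^ p.toReal ≤ moll n (fun y => |f y|) x ^ p.toReal := by
              gcongr; exact abs_moll_le x
          _ ≤ _ := rpow_moll_le hα (Eventually.of_forall fun x => abs_nonneg _) hfi.abs hfp x
    _ = ∫ x, ‖f x‖ ^ p.toReal := integral_moll hfp

lemma memLp_of_continuous {p : ENNReal} (hf : Continuous f) : MemLp f p := by
  obtain ⟨C, -, hC⟩ := exists_bound_of_continuous hf
  exact MemLp.of_bound hf.aestronglyMeasurable C (Eventually.of_forall hC)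

lemma moll_sub (hf : Integrable f) (hg : Integrable g) (x : Torus d) :
    moll n (fun y => f y - g y) x = moll n f x - moll n g x :=
  cv_sub continuous_kern hf hg x

/-- Mollifications converge in `L^p`. -/
lemma tendsto_eLpNorm_moll_sub {p : ENNReal} (hp : 1 ≤ p) (hp' : p ≠ ⊤) (hf : MemLp f p) :
    Tendsto (fun n => eLpNorm (fun x => moll n f x - f x) p volume) atTop (𝓝 0) := by
  have hfi : Integrable f := hf.integrable hp
  rw [ENNReal.tendsto_nhds_zero]
  intro ε hε
  obtain ⟨δ, hδ, hδε⟩ : ∃ δ : ENNReal, δ ≠ 0 ∧ δ + δ + δ ≤ ε :=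
    ⟨ε / 3, (ENNReal.div_pos hε.ne' (by simp)).ne', (ENNReal.add_thirds ε).le⟩
  obtain ⟨g, hg, hgm⟩ := hf.exists_boundedContinuous_eLpNorm_sub_le hp' hδ
  have hgi : Integrable g := hgm.integrable hp
  obtain ⟨η, hη, hηδ⟩ : ∃ η : ℝ, 0 < η ∧ ENNReal.ofReal η ≤ δ := by
    by_cases h : δ = ⊤
    · exact ⟨1, one_pos, by simp [h]⟩
    · exact ⟨δ.toReal, ENNReal.toReal_pos hδ h, ENNReal.ofReal_toReal_le⟩
  filter_upwards [eventually_abs_moll_sub_le g.continuous hη] with n hn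
  have h1 : eLpNorm (moll n (fun x => f x - g x)) p volume ≤ δ :=
    (eLpNorm_moll_le hp hp' (hf.sub hgm)).trans hg
  have h2 : eLpNorm (fun x => moll n g x - g x) p volume ≤ δ := by
    refine (eLpNorm_le_of_ae_bound (C := η) (Eventually.of_forall hn)).trans ?_
    simpa using hηδ
  have h3 : eLpNorm (fun x => g x - f x) p volume ≤ δ := by
    rw [show (fun x => g x - f x) = ⇑g - f from rfl, eLpNorm_sub_comm]
    exact hg
  have e : (fun x => moll n f x - f x) =
      (moll n (fun x => f x - g x) + fun x => moll n g x - g x) + fun x => g x - f x := by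
    funext x
    simp only [Pi.add_apply, moll_sub hfi hgi]
    ring
  have hgc := g.continuous
  rw [e]
  refine (eLpNorm_add_le ?_ ?_ hp).trans ((add_le_add ((eLpNorm_add_le ?_ ?_ hp).trans
    (add_le_add h1 h2)) h3).trans hδε)
  · exact ((continuous_moll (hfi.sub hgi)).aestronglyMeasurable).add
      ((continuous_moll hgi).sub hgc).aestronglyMeasurable
  · exact hgc.aestronglyMeasurable.sub hf.1
  · exact (continuous_moll (hfi.sub hgi)).aestronglyMeasurable
  · exact ((continuous_moll hgi).sub hgc).aestronglyMeasurable

/-- Two integrable functions with the same mollifications agree almost everywhere. -/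
lemma ae_eq_of_moll_eq (hf : Integrable f) (hg : Integrable g)
    (h : ∀ n x, moll n f x = moll n g x) : f =ᵐ[volume] g := by
  have h1 := tendsto_eLpNorm_moll_sub (p := 1) le_rfl (by simp)
    (memLp_one_iff_integrable.2 (hf.sub hg))
  have h2 : ∀ n x, moll n (f - g) x = 0 := fun n x => by
    have := moll_sub (n := n) hf hg x
    rw [h, sub_self] at this
    exact this
  simp only [h2, zero_sub] at h1
  have h3 : eLpNorm (fun x => -(f - g) x) 1 volume = 0 :=
    tendsto_nhds_unique tendsto_const_nhds h1
  rw [eLpNorm_eq_zero_iff (by exact (hf.sub hg).1.neg) one_ne_zero] at h3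
  filter_upwards [h3] with x hx
  simp only [Pi.sub_apply, Pi.zero_apply, neg_eq_zero, sub_eq_zero] at hx
  exact hx

/-- Along a subsequence, mollifications converge almost everywhere. -/
lemma exists_subseq_moll_tendsto (hf : Integrable f) {ns : ℕ → ℕ} (hns : Tendsto ns atTop atTop) :
    ∃ ms : ℕ → ℕ, StrictMono ms ∧
      ∀ᵐ x, Tendsto (fun i => moll (ns (ms i)) f x) atTop (𝓝 (f x)) := by
  have h1 := (tendsto_eLpNorm_moll_sub (p := 1) le_rfl (by simp)
    (memLp_one_iff_integrable.2 hf)).comp hns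
  have h2 : TendstoInMeasure volume (fun i => moll (ns i) f) atTop f :=
    tendstoInMeasure_of_tendsto_eLpNorm one_ne_zero
      (fun i => (continuous_moll hf).aestronglyMeasurable) hf.1 h1
  exact h2.exists_seq_tendsto_ae

end Approximation

/-! ### Hölder's inequality in terms of reciprocal exponents -/

/-- The `L^{1/θ}` norm on the torus. In terms of `θ`, Hölder's inequality is additive. -/
def nrm {E : Type*} [NormedAddCommGroup E] (θ : ℝ) (f : Torus d → E) : ENNReal :=
  eLpNorm f (ENNReal.ofReal θ⁻¹) volume

section Norms

variable {E : Type*} [NormedAddCommGroup E] {θ θ' : ℝ} {f g : Torus d → ℝ}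

lemma nrm_mono (h0 : 0 < θ) (h : θ ≤ θ') {f : Torus d → E} (hf : AEStronglyMeasurable f volume) :
    nrm θ' f ≤ nrm θ f :=
  eLpNorm_le_eLpNorm_of_exponent_le (ENNReal.ofReal_le_ofReal (inv_anti₀ h0 h)) hf

lemma nrm_mul_le (h : 0 < θ) (h' : 0 < θ') (hf : AEStronglyMeasurable f volume)
    (hg : AEStronglyMeasurable g volume) :
    nrm (θ + θ') (fun x => f x * g x) ≤ nrm θ f * nrm θ' g := by
  have : ENNReal.HolderTriple (ENNReal.ofReal θ⁻¹) (ENNReal.ofReal θ'⁻¹)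
      (ENNReal.ofReal (θ + θ')⁻¹) := by
    refine ⟨?_⟩
    rw [← ENNReal.ofReal_inv_of_pos (by positivity), ← ENNReal.ofReal_inv_of_pos (by positivity),
      ← ENNReal.ofReal_inv_of_pos (by positivity), inv_inv, inv_inv, inv_inv,
      ENNReal.ofReal_add h.le h'.le]
  change eLpNorm (f • g) _ _ ≤ _
  exact eLpNorm_smul_le_mul_eLpNorm (p := ENNReal.ofReal θ⁻¹) (q := ENNReal.ofReal θ'⁻¹)
    (r := ENNReal.ofReal (θ + θ')⁻¹) hg hf

lemma nrm_one_eq_lintegral (f : Torus d → E) : nrm 1 f = ∫⁻ x, ‖f x‖ₑ := by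
  simp [nrm, eLpNorm_one_eq_lintegral_enorm]

lemma one_le_ofReal_inv (h0 : 0 < θ) (h1 : θ ≤ 1) : 1 ≤ ENNReal.ofReal θ⁻¹ := by
  rw [← ENNReal.ofReal_one]
  exact ENNReal.ofReal_le_ofReal ((one_le_inv₀ h0).2 h1)

lemma lintegral_enorm_le_nrm (h0 : 0 < θ) (h1 : θ ≤ 1) {f : Torus d → E}
    (hf : AEStronglyMeasurable f volume) : ∫⁻ x, ‖f x‖ₑ ≤ nrm θ f := by
  rw [← nrm_one_eq_lintegral]
  exact nrm_mono h0 h1 hf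

lemma lintegral_mul_le_nrm (h : 0 < θ) (h' : 0 < θ') (h1 : θ + θ' ≤ 1)
    (hf : AEStronglyMeasurable f volume) (hg : AEStronglyMeasurable g volume) :
    ∫⁻ x, ‖f x‖ₑ * ‖g x‖ₑ ≤ nrm θ f * nrm θ' g := by
  have := (lintegral_enorm_le_nrm (add_pos h h') h1 (hf.mul hg)).trans (nrm_mul_le h h' hf hg)
  simpa only [Pi.mul_apply, enorm_mul] using! this

lemma lintegral_mul_mul_le_nrm {θ'' : ℝ} {k : Torus d → ℝ} (h : 0 < θ) (h' : 0 < θ')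
    (h'' : 0 < θ'') (h1 : θ + θ' + θ'' ≤ 1) (hf : AEStronglyMeasurable f volume)
    (hg : AEStronglyMeasurable g volume) (hk : AEStronglyMeasurable k volume) :
    ∫⁻ x, ‖f x‖ₑ * ‖g x‖ₑ * ‖k x‖ₑ ≤ nrm θ f * nrm θ' g * nrm θ'' k := by
  have := lintegral_mul_le_nrm (add_pos h h') h'' h1 (hf.mul hg) hk
  simp only [Pi.mul_apply, enorm_mul] at this
  exact this.trans (mul_le_mul_left (nrm_mul_le h h' hf hg) _)

lemma nrm_comp_add_right (f : Torus d → E) (hf : AEStronglyMeasurable f volume) (a : Torus d) :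
    nrm θ (fun x => f (x + a)) = nrm θ f :=
  eLpNorm_comp_measurePreserving hf (measurePreserving_add_right volume a)

lemma nrm_moll_le (h0 : 0 < θ) (h1 : θ ≤ 1) (hf : AEStronglyMeasurable f volume) (n : ℕ) :
    nrm θ (moll n f) ≤ nrm θ f := by
  by_cases hfin : nrm θ f = ⊤
  · rw [hfin]; exact le_top
  · exact eLpNorm_moll_le (one_le_ofReal_inv h0 h1) ENNReal.ofReal_ne_top
      ⟨hf, lt_top_iff_ne_top.2 hfin⟩

end Norms

/-! ### The gradient of the Favre average -/

section Favre

variable {c : ℝ} {ρ u : Torus d → ℝ} {G : Fin d → Torus d → ℝ}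

/-- `G` is the gradient of `u` after mollification at every scale. -/
def IsMollGradient (u : Torus d → ℝ) (G : Fin d → Torus d → ℝ) : Prop :=
  ∀ n j x, mollD n j u x = moll n (G j) x

lemma hasDirDeriv_moll_of_isMollGradient (hu : Integrable u) (h : IsMollGradient u G) (n : ℕ)
    (w : Fin d → ℝ) :
    HasDirDeriv w (moll n u) (fun x => ∑ j, w j * moll n (G j) x) := by
  have h1 := hasDirDeriv_cv ((smoothSpace_kern (d := d) (n := n)).hasDirDeriv w) continuous_kern
    (continuous_finsetSum _ fun j _ => continuous_const.mul continuous_pderiv_kern) hu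
  convert! h1 using 1
  funext x
  simp only [← h n, mollD, cv, Finset.mul_sum]
  rw [integral_finsetSum _ fun j _ => ?_]
  · congr 1
    funext j
    rw [← integral_const_mul]
    congr 1
    funext y
    ring
  · exact integrable_mul_kernel (k := fun x => w j * pderiv j (kern n) x)
      (continuous_const.mul continuous_pderiv_kern) hu x

lemma enorm_moll_translate_le (hu : Integrable u) (hG : ∀ j, Integrable (G j))
    (h : IsMollGradient u G) (n : ℕ) (w : Fin d → ℝ) (x : Torus d) :
    ‖moll n u (x + proj w) - moll n u x‖ₑ ≤
      ∑ j, ‖w j‖ₑ * ∫⁻ s in Ioc (0 : ℝ) 1, ‖moll n (G j) (x + proj (s • w))‖ₑ := by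
  have hd := hasDirDeriv_moll_of_isMollGradient hu h n w
  have hcj : ∀ j, Continuous fun s : ℝ => moll n (G j) (x + proj (s • w)) := fun j =>
    (continuous_moll (hG j)).comp (continuous_const.add (continuous_proj.comp (by fun_prop)))
  have hc : Continuous fun s : ℝ => ∑ j, w j * moll n (G j) (x + proj (s • w)) :=
    continuous_finsetSum _ fun j _ => continuous_const.mul (hcj j)
  have h1 := intervalIntegral.integral_eq_sub_of_hasDerivAt (a := 0) (b := 1)
    (f := fun s : ℝ => moll n u (x + proj (s • w)))
    (fun s _ => hd.hasDerivAt_line x s) (hc.intervalIntegrable _ _)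
  simp only [one_smul, zero_smul, proj_zero, add_zero] at h1
  rw [← h1, intervalIntegral.integral_of_le zero_le_one]
  refine (enorm_integral_le_lintegral_enorm _).trans ?_
  calc ∫⁻ s in Ioc (0 : ℝ) 1, ‖∑ j, w j * moll n (G j) (x + proj (s • w))‖ₑ
      ≤ ∫⁻ s in Ioc (0 : ℝ) 1, ∑ j, ‖w j‖ₑ * ‖moll n (G j) (x + proj (s • w))‖ₑ := by
        refine lintegral_mono fun s => (enorm_sum_le _ _).trans (le_of_eq ?_)
        simp only [enorm_mul]
    _ = _ := by
        rw [lintegral_finsetSum _ fun j _ => by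
          have := hcj j
          exact ((this.enorm).measurable).const_mul _]
        congr 1
        funext j
        rw [lintegral_const_mul _ (hcj j).enorm.measurable]

lemma lintegral_mul_moll_translate_le {θ₁ θ₂ θ₃ : ℝ} (h1 : 0 < θ₁) (h2 : 0 < θ₂) (h3 : 0 < θ₃)
    (h123 : θ₁ + θ₂ + θ₃ ≤ 1) {F : Torus d → ℝ} (hF : AEStronglyMeasurable F volume)
    (hρ : AEStronglyMeasurable ρ volume) (hu : Integrable u) (hG : ∀ j, Integrable (G j))
    (h : IsMollGradient u G) (n : ℕ) (y : Torus d) :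
    ∫⁻ x, ‖F x‖ₑ * ‖ρ (x - y)‖ₑ * ‖moll n u (x - y) - moll n u x‖ₑ ≤
      nrm θ₁ F * nrm θ₂ ρ * ∑ j, ‖y j‖ₑ * nrm θ₃ (G j) := by
  obtain ⟨z, hz, hzy⟩ := exists_proj_eq_abs_eq_norm (-y)
  have hzj : ∀ j, ‖z j‖ₑ = ‖y j‖ₑ := fun j => by
    rw [← ofReal_norm, ← ofReal_norm, Real.norm_eq_abs, hzy j]
    simp
  have hρy : AEStronglyMeasurable (fun x => ρ (x - y)) volume :=
    hρ.comp_measurePreserving (measurePreserving_sub_right volume y)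
  have hρn : nrm θ₂ (fun x => ρ (x - y)) = nrm θ₂ ρ := by
    simpa [sub_eq_add_neg] using nrm_comp_add_right (θ := θ₂) ρ hρ (-y)
  have hmeas : ∀ j, AEMeasurable (fun p : Torus d × ℝ => ‖F p.1‖ₑ * ‖ρ (p.1 - y)‖ₑ *
      ‖moll n (G j) (p.1 + proj (p.2 • z))‖ₑ)
      (volume.prod (volume.restrict (Ioc (0 : ℝ) 1))) := fun j => by
    have e1 : Continuous fun p : Torus d × ℝ => moll n (G j) (p.1 + proj (p.2 • z)) :=
      (continuous_moll (hG j)).comp (continuous_fst.add (continuous_proj.comp (by fun_prop)))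
    exact ((hF.comp_fst).enorm.mul (hρy.comp_fst).enorm).mul e1.enorm.measurable.aemeasurable
  calc ∫⁻ x, ‖F x‖ₑ * ‖ρ (x - y)‖ₑ * ‖moll n u (x - y) - moll n u x‖ₑ
      ≤ ∫⁻ x, ∑ j, ‖y j‖ₑ * ∫⁻ s in Ioc (0 : ℝ) 1, ‖F x‖ₑ * ‖ρ (x - y)‖ₑ *
          ‖moll n (G j) (x + proj (s • z))‖ₑ := by
        refine lintegral_mono fun x => ?_
        have := enorm_moll_translate_le hu hG h n z x
        rw [hz, ← sub_eq_add_neg] at this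
        refine (mul_le_mul_right this _).trans (le_of_eq ?_)
        rw [Finset.mul_sum]
        congr 1
        funext j
        have e1 : Continuous fun s : ℝ => moll n (G j) (x + proj (s • z)) :=
          (continuous_moll (hG j)).comp (continuous_const.add (continuous_proj.comp (by fun_prop)))
        rw [lintegral_const_mul _ e1.enorm.measurable, hzj]
        ring
    _ = ∑ j, ‖y j‖ₑ * ∫⁻ x, ∫⁻ s in Ioc (0 : ℝ) 1, ‖F x‖ₑ * ‖ρ (x - y)‖ₑ *
          ‖moll n (G j) (x + proj (s • z))‖ₑ := by
        rw [lintegral_finsetSum' _ fun j _ => (hmeas j).lintegral_prod_right'.const_mul _]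
        congr 1
        funext j
        exact lintegral_const_mul'' _ (hmeas j).lintegral_prod_right'
    _ = ∑ j, ‖y j‖ₑ * ∫⁻ s in Ioc (0 : ℝ) 1, ∫⁻ x, ‖F x‖ₑ * ‖ρ (x - y)‖ₑ *
          ‖moll n (G j) (x + proj (s • z))‖ₑ := by
        congr 1
        funext j
        rw [lintegral_lintegral_swap (hmeas j)]
    _ ≤ ∑ j, ‖y j‖ₑ * ∫⁻ _s in Ioc (0 : ℝ) 1, nrm θ₁ F * nrm θ₂ ρ * nrm θ₃ (G j) := by
        gcongr with j _ s
        have hcont := continuous_moll (n := n) (hG j)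
        refine (lintegral_mul_mul_le_nrm (k := fun x => moll n (G j) (x + proj (s • z)))
          h1 h2 h3 h123 hF hρy
          (hcont.comp (continuous_id.add continuous_const)).aestronglyMeasurable).trans ?_
        rw [nrm_comp_add_right _ hcont.aestronglyMeasurable, hρn]
        gcongr
        exact nrm_moll_le h3 (by linarith) (hG j).1 n
    _ = nrm θ₁ F * nrm θ₂ ρ * ∑ j, ‖y j‖ₑ * nrm θ₃ (G j) := by
        simp only [lintegral_const, Measure.restrict_apply_univ, Real.volume_Ioc, sub_zero,
          ENNReal.ofReal_one, mul_one]
        rw [Finset.mul_sum]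
        congr 1
        funext j
        ring

/-- The weighted translation estimate for a function with gradient `G`. -/
lemma lintegral_mul_translate_le {θ₁ θ₂ θ₃ : ℝ} (h1 : 0 < θ₁) (h2 : 0 < θ₂) (h3 : 0 < θ₃)
    (h123 : θ₁ + θ₂ + θ₃ ≤ 1) {F : Torus d → ℝ} (hF : AEStronglyMeasurable F volume)
    (hρ : AEStronglyMeasurable ρ volume) (hu : Integrable u) (hG : ∀ j, Integrable (G j))
    (h : IsMollGradient u G) (y : Torus d) :
    ∫⁻ x, ‖F x‖ₑ * ‖ρ (x - y)‖ₑ * ‖u (x - y) - u x‖ₑ ≤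
      nrm θ₁ F * nrm θ₂ ρ * ∑ j, ‖y j‖ₑ * nrm θ₃ (G j) := by
  obtain ⟨ms, -, hae⟩ := exists_subseq_moll_tendsto hu tendsto_id
  have hae' := (measurePreserving_sub_right volume y).quasiMeasurePreserving.ae hae
  have hρy : AEStronglyMeasurable (fun x => ρ (x - y)) volume :=
    hρ.comp_measurePreserving (measurePreserving_sub_right volume y)
  have hcont : ∀ n, Continuous (moll n u) := fun n => continuous_moll hu
  calc ∫⁻ x, ‖F x‖ₑ * ‖ρ (x - y)‖ₑ * ‖u (x - y) - u x‖ₑ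
      ≤ ∫⁻ x, liminf (fun i => ‖F x‖ₑ * ‖ρ (x - y)‖ₑ *
          ‖moll (ms i) u (x - y) - moll (ms i) u x‖ₑ) atTop := by
        refine lintegral_mono_ae ?_
        filter_upwards [hae, hae'] with x hx hx'
        refine le_of_eq (Tendsto.liminf_eq ?_).symm
        refine ENNReal.Tendsto.const_mul (hx'.sub hx).enorm (Or.inr ?_)
        exact ENNReal.mul_ne_top enorm_ne_top enorm_ne_top
    _ ≤ liminf (fun i => ∫⁻ x, ‖F x‖ₑ * ‖ρ (x - y)‖ₑ *
          ‖moll (ms i) u (x - y) - moll (ms i) u x‖ₑ) atTop :=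
        lintegral_liminf_le' fun i => (hF.enorm.mul hρy.enorm).mul
          (((hcont _).comp (continuous_id.sub continuous_const)).sub
            (hcont _)).enorm.measurable.aemeasurable
    _ ≤ _ := by
        refine liminf_le_of_le ?_ fun b hb => ?_
        · exact ⟨0, Eventually.of_forall fun _ => by simp⟩
        · obtain ⟨i, hi⟩ := hb.exists
          exact hi.trans (lintegral_mul_moll_translate_le h1 h2 h3 h123 hF hρ hu hG h _ y)

/-- The Favre average `(ρ u)ⁿ / ρⁿ` of `u` at scale `1 / (n + 1)`. -/
def favre (n : ℕ) (ρ u : Torus d → ℝ) (x : Torus d) : ℝ :=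
  moll n (fun y => ρ y * u y) x / moll n ρ x

/-- The partial derivative `∂_j` of the Favre average. -/
def favreD (n : ℕ) (j : Fin d) (ρ u : Torus d → ℝ) (x : Torus d) : ℝ :=
  (mollD n j (fun y => ρ y * u y) x - favre n ρ u x * mollD n j ρ x) / moll n ρ x

lemma hasDirDeriv_favre (hc : 0 < c) (hρ : Integrable ρ) (hcρ : ∀ᵐ x, c ≤ ρ x)
    (hm : Integrable fun x => ρ x * u x) (n : ℕ) (j : Fin d) :
    HasDirDeriv (coordVec j) (favre n ρ u) (favreD n j ρ u) := by
  have hpos : ∀ x, 0 < moll n ρ x := fun x => hc.trans_le (le_moll hρ hcρ x)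
  convert! (hasDirDeriv_moll hm).div (hasDirDeriv_moll hρ) fun x => (hpos x).ne' using 1
  funext x
  have := (hpos x).ne'
  unfold favreD favre
  field_simp

lemma continuous_favre (hc : 0 < c) (hρ : Integrable ρ) (hcρ : ∀ᵐ x, c ≤ ρ x)
    (hm : Integrable fun x => ρ x * u x) (n : ℕ) : Continuous (favre n ρ u) :=
  (continuous_moll hm).div (continuous_moll hρ) fun x => (hc.trans_le (le_moll hρ hcρ x)).ne'

lemma continuous_favreD (hc : 0 < c) (hρ : Integrable ρ) (hcρ : ∀ᵐ x, c ≤ ρ x)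
    (hm : Integrable fun x => ρ x * u x) (n : ℕ) (j : Fin d) : Continuous (favreD n j ρ u) :=
  ((continuous_mollD hm).sub ((continuous_favre hc hρ hcρ hm n).mul (continuous_mollD hρ))).div
    (continuous_moll hρ) fun x => (hc.trans_le (le_moll hρ hcρ x)).ne'

/-- The derivative of the Favre average is controlled by a weighted difference quotient. This is
where the bound of `∇ kern` by `kern` itself enters. -/
lemma abs_favreD_le (hc : 0 < c) (hρ : Integrable ρ) (hcρ : ∀ᵐ x, c ≤ ρ x)
    (hm : Integrable fun x => ρ x * u x) (n : ℕ) (j : Fin d) (x : Torus d) :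
    |favreD n j ρ u x| ≤ 8 * Real.pi * ((n : ℝ) + 1) / c *
      ∫ y, ρ y * |u y - u x| * kern n (x - y) := by
  have hR : c ≤ moll n ρ x := le_moll hρ hcρ x
  have hRpos : 0 < moll n ρ x := hc.trans_le hR
  set V := favre n ρ u x with hV
  set Q := ∫ y, ρ y * |u y - u x| * kern n (x - y) with hQ
  have hρu : ∀ a : ℝ, Integrable fun y => ρ y * (u y - a) := fun a => by
    refine (hm.sub (hρ.const_mul a)).congr (Eventually.of_forall fun y => ?_)
    simp only [Pi.sub_apply]
    ring
  have hρabs : ∀ a : ℝ, Integrable fun y => ρ y * |u y - a| := fun a => by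
    refine (hρu a).abs.congr ?_
    filter_upwards [hcρ] with y hy
    rw [abs_mul, abs_of_pos (hc.trans_le hy)]
  have hK : 0 ≤ 4 * Real.pi * ((n : ℝ) + 1) := by positivity
  have hQint : ∀ a : ℝ, Integrable fun y => ρ y * |u y - a| * kern n (x - y) := fun a =>
    integrable_mul_kernel continuous_kern (hρabs a) x
  have hVmul : V * moll n ρ x = moll n (fun y => ρ y * u y) x := by
    rw [hV, favre]; field_simp
  -- `(u(x) - V(x)) ρⁿ(x)` is itself a weighted mean of differences of `u`
  have h1 : |V - u x| * moll n ρ x ≤ Q := by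
    have e : (V - u x) * moll n ρ x = ∫ y, ρ y * (u y - u x) * kern n (x - y) := by
      rw [sub_mul, hVmul]
      have := integral_sub (integrable_mul_kernel (k := kern n) continuous_kern hm x)
        ((integrable_mul_kernel (k := kern n) continuous_kern hρ x).const_mul (u x))
      rw [integral_const_mul] at this
      rw [moll, moll, cv, cv, ← this]
      congr 1
      funext y
      ring
    rw [← abs_of_pos hRpos, ← abs_mul, e]
    refine abs_integral_le_integral_abs.trans (integral_mono_ae ?_ (hQint _) ?_)
    · exact (integrable_mul_kernel continuous_kern (hρu _) x).abs
    · filter_upwards [hcρ] with y hy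
      rw [abs_mul, abs_mul, abs_of_pos (hc.trans_le hy), abs_of_pos (kern_pos _)]
  have h2 : ∫ y, ρ y * |u y - V| * kern n (x - y) ≤ 2 * Q := by
    calc ∫ y, ρ y * |u y - V| * kern n (x - y)
        ≤ ∫ y, (ρ y * |u y - u x| * kern n (x - y) + |V - u x| * (ρ y * kern n (x - y))) := by
          refine integral_mono_ae (hQint _) ((hQint _).add
            ((integrable_mul_kernel continuous_kern hρ x).const_mul _)) ?_
          filter_upwards [hcρ] with y hy
          have hy0 := hc.trans_le hy
          have hk := kern_pos (n := n) (x - y)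
          have : |u y - V| ≤ |u y - u x| + |V - u x| := by
            rw [abs_sub_comm V]; exact abs_sub_le _ _ _
          calc _ ≤ ρ y * (|u y - u x| + |V - u x|) * kern n (x - y) := by gcongr
            _ = _ := by ring
      _ = Q + |V - u x| * moll n ρ x := by
          rw [integral_add (hQint _) ((integrable_mul_kernel continuous_kern hρ x).const_mul _),
            integral_const_mul]
          rfl
      _ ≤ 2 * Q := by linarith
  have h3 : |mollD n j (fun y => ρ y * u y) x - V * mollD n j ρ x| ≤
      4 * Real.pi * ((n : ℝ) + 1) * (2 * Q) := by
    have hp := continuous_pderiv_kern (d := d) (n := n) (j := j)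
    have e : mollD n j (fun y => ρ y * u y) x - V * mollD n j ρ x =
        ∫ y, ρ y * (u y - V) * pderiv j (kern n) (x - y) := by
      have := integral_sub (integrable_mul_kernel hp hm x)
        ((integrable_mul_kernel hp hρ x).const_mul V)
      rw [integral_const_mul] at this
      rw [mollD, mollD, cv, cv, ← this]
      congr 1
      funext y
      ring
    rw [e]
    refine abs_integral_le_integral_abs.trans (le_trans ?_ (mul_le_mul_of_nonneg_left h2 hK))
    rw [← integral_const_mul]
    refine integral_mono_ae (integrable_mul_kernel hp (hρu _) x).abs
      ((hQint _).const_mul _) ?_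
    filter_upwards [hcρ] with y hy
    have hy0 := hc.trans_le hy
    rw [abs_mul, abs_mul, abs_of_pos hy0]
    calc _ ≤ ρ y * |u y - V| * (4 * Real.pi * ((n : ℝ) + 1) * kern n (x - y)) := by
          gcongr; exact abs_pderiv_kern_le _
      _ = _ := by ring
  have hQ0 : 0 ≤ Q := (mul_nonneg (abs_nonneg _) hRpos.le).trans h1
  rw [favreD, abs_div, abs_of_pos hRpos]
  calc _ ≤ 4 * Real.pi * ((n : ℝ) + 1) * (2 * Q) / moll n ρ x := by gcongr
    _ ≤ 4 * Real.pi * ((n : ℝ) + 1) * (2 * Q) / c := by gcongr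
    _ = _ := by ring

/-- The uniform bound for the gradients of Favre averages, in the form of a pairing with a third
function. -/
lemma lintegral_mul_favreD_le {θ₁ θ₂ θ₃ : ℝ} (h1 : 0 < θ₁) (h2 : 0 < θ₂) (h3 : 0 < θ₃)
    (h123 : θ₁ + θ₂ + θ₃ ≤ 1) (hc : 0 < c) {F : Torus d → ℝ}
    (hF : AEStronglyMeasurable F volume) (hρ : Integrable ρ) (hcρ : ∀ᵐ x, c ≤ ρ x)
    (hm : Integrable fun x => ρ x * u x) (hu : Integrable u) (hG : ∀ j, Integrable (G j))
    (h : IsMollGradient u G) (n : ℕ) (j : Fin d) :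
    ∫⁻ x, ‖F x‖ₑ * ‖favreD n j ρ u x‖ₑ ≤ ENNReal.ofReal (8 * Real.pi * d * momentConst / c) *
      (nrm θ₁ F * nrm θ₂ ρ * ∑ j, nrm θ₃ (G j)) := by
  set K : ℝ := 8 * Real.pi * ((n : ℝ) + 1) / c with hK
  have hK0 : 0 ≤ K := by positivity
  set A := nrm θ₁ F * nrm θ₂ ρ with hA
  set S := ∑ j, nrm θ₃ (G j) with hS
  have hkc := continuous_kern (d := d) (n := n)
  have hpt : ∀ x, ‖favreD n j ρ u x‖ₑ ≤ ENNReal.ofReal K *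
      ∫⁻ y, ‖ρ (x - y)‖ₑ * ‖u (x - y) - u x‖ₑ * ‖kern n y‖ₑ := fun x => by
    have h4 := abs_favreD_le hc hρ hcρ hm n j x
    rw [← Real.norm_eq_abs, ← integral_sub_left_eq_self _ volume x] at h4
    simp only [sub_sub_cancel] at h4
    rw [← ofReal_norm]
    refine (ENNReal.ofReal_le_ofReal h4).trans ?_
    rw [ENNReal.ofReal_mul hK0]
    gcongr
    refine (Real.ofReal_le_enorm _).trans ((enorm_integral_le_lintegral_enorm _).trans
      (le_of_eq ?_))
    simp only [enorm_mul, Real.enorm_abs]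
  have hq : Measure.QuasiMeasurePreserving (fun p : Torus d × Torus d => p.1 - p.2)
      (volume.prod volume) volume := quasiMeasurePreserving_sub_of_right_invariant volume volume
  have hmeas : AEMeasurable (fun p : Torus d × Torus d => ‖F p.1‖ₑ * ‖ρ (p.1 - p.2)‖ₑ *
      ‖u (p.1 - p.2) - u p.1‖ₑ * ‖kern n p.2‖ₑ) (volume.prod volume) := by
    have e1 := hF.comp_fst (ν := (volume : Measure (Torus d)))
    have e2 := hρ.1.comp_quasiMeasurePreserving hq
    have e3 := (hu.1.comp_quasiMeasurePreserving hq).sub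
      (hu.1.comp_fst (ν := (volume : Measure (Torus d))))
    exact ((e1.enorm.mul e2.enorm).mul e3.enorm).mul
      (hkc.comp continuous_snd).enorm.measurable.aemeasurable
  calc ∫⁻ x, ‖F x‖ₑ * ‖favreD n j ρ u x‖ₑ
      ≤ ∫⁻ x, ENNReal.ofReal K * ∫⁻ y, ‖F x‖ₑ * ‖ρ (x - y)‖ₑ * ‖u (x - y) - u x‖ₑ *
          ‖kern n y‖ₑ := by
        refine lintegral_mono fun x => (mul_le_mul_right (hpt x) _).trans (le_of_eq ?_)
        rw [mul_left_comm, ← lintegral_const_mul' _ _ enorm_ne_top]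
        simp only [mul_assoc]
    _ = ENNReal.ofReal K * ∫⁻ y, ∫⁻ x, ‖F x‖ₑ * ‖ρ (x - y)‖ₑ * ‖u (x - y) - u x‖ₑ *
          ‖kern n y‖ₑ := by
        rw [lintegral_const_mul' _ _ ENNReal.ofReal_ne_top, lintegral_lintegral_swap hmeas]
    _ ≤ ENNReal.ofReal K * ∫⁻ y : Torus d, A * S * ENNReal.ofReal (dist1 y * kern n y) := by
        gcongr with y
        rw [lintegral_mul_const' _ _ enorm_ne_top]
        have h5 := lintegral_mul_translate_le h1 h2 h3 h123 hF hρ.1 hu hG h y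
        have h6 : ∑ j, ‖y j‖ₑ * nrm θ₃ (G j) ≤ ENNReal.ofReal (dist1 y) * S := by
          rw [hS, Finset.mul_sum]
          gcongr with j _
          rw [← ofReal_norm]
          exact ENNReal.ofReal_le_ofReal (Finset.single_le_sum (f := fun j => ‖y j‖)
            (fun j _ => norm_nonneg _) (Finset.mem_univ j))
        calc _ ≤ A * (ENNReal.ofReal (dist1 y) * S) * ‖kern n y‖ₑ := by
              gcongr
              exact h5.trans (by gcongr)
          _ = _ := by
              rw [← ofReal_norm, Real.norm_of_nonneg (kern_pos y).le,
                ENNReal.ofReal_mul (dist1_nonneg y)]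
              ring
    _ ≤ ENNReal.ofReal K * (A * S * ENNReal.ofReal (d * momentConst / ((n : ℝ) + 1))) := by
        rw [lintegral_const_mul _ (by
          exact (continuous_dist1.mul hkc).measurable.ennreal_ofReal),
          ← ofReal_integral_eq_lintegral_ofReal integrable_dist1_kern
            (Eventually.of_forall fun y => mul_nonneg (dist1_nonneg y) (kern_pos y).le)]
        gcongr
        exact integral_dist1_kern_le
    _ = ENNReal.ofReal (8 * Real.pi * d * momentConst / c) * (A * S) := by
        have : 8 * Real.pi * d * momentConst / c =
            K * (d * momentConst / ((n : ℝ) + 1)) := by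
          rw [hK]; field_simp
        rw [this, ENNReal.ofReal_mul hK0]
        ring

end Favre

/-! ### Limits at a fixed time -/

section NormCalculus

variable {θ : ℝ} {f g : Torus d → ℝ}

lemma memLp_of_nrm_lt (hf : AEStronglyMeasurable f volume) (h : nrm θ f < ⊤) :
    MemLp f (ENNReal.ofReal θ⁻¹) := ⟨hf, h⟩

lemma integrable_of_nrm_lt (h0 : 0 < θ) (h1 : θ ≤ 1) (hf : AEStronglyMeasurable f volume)
    (h : nrm θ f < ⊤) : Integrable f :=
  (memLp_of_nrm_lt hf h).integrable (one_le_ofReal_inv h0 h1)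

lemma tendsto_nrm_moll_sub (h0 : 0 < θ) (h1 : θ ≤ 1) (hf : AEStronglyMeasurable f volume)
    (h : nrm θ f < ⊤) : Tendsto (fun n => nrm θ (fun x => moll n f x - f x)) atTop (𝓝 0) :=
  tendsto_eLpNorm_moll_sub (one_le_ofReal_inv h0 h1) ENNReal.ofReal_ne_top (memLp_of_nrm_lt hf h)

lemma nrm_add_le (h0 : 0 < θ) (h1 : θ ≤ 1) (hf : AEStronglyMeasurable f volume)
    (hg : AEStronglyMeasurable g volume) :
    nrm θ (fun x => f x + g x) ≤ nrm θ f + nrm θ g :=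
  eLpNorm_add_le hf hg (one_le_ofReal_inv h0 h1)

lemma nrm_sub_le (h0 : 0 < θ) (h1 : θ ≤ 1) (hf : AEStronglyMeasurable f volume)
    (hg : AEStronglyMeasurable g volume) :
    nrm θ (fun x => f x - g x) ≤ nrm θ f + nrm θ g :=
  eLpNorm_sub_le hf hg (one_le_ofReal_inv h0 h1)

lemma nrm_mono_ae_of_le_mul {K : ℝ} (h : ∀ᵐ x, |f x| ≤ K * |g x|) :
    nrm θ f ≤ ENNReal.ofReal K * nrm θ g :=
  eLpNorm_le_mul_eLpNorm_of_ae_le_mul h _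

lemma nrm_rpow {a : ℝ} (ha : 0 < a) (h0 : ∀ᵐ x, 0 ≤ f x) :
    nrm (a * θ) (fun x => f x ^ a) = nrm θ f ^ a := by
  have h1 := eLpNorm_norm_rpow (μ := volume) (p := ENNReal.ofReal (a * θ)⁻¹) f ha
  have h2 : ENNReal.ofReal (a * θ)⁻¹ * ENNReal.ofReal a = ENNReal.ofReal θ⁻¹ := by
    rw [← ENNReal.ofReal_mul' ha.le]
    congr 1
    rw [mul_inv]
    field_simp
  rw [h2] at h1
  rw [nrm, nrm, ← h1]
  refine eLpNorm_congr_ae ?_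
  filter_upwards [h0] with x hx
  rw [Real.norm_of_nonneg hx]

end NormCalculus

lemma abs_rpow_sub_rpow_le {a b α : ℝ} (ha : 0 < a) (hb : 0 < b) (hα : 1 ≤ α) :
    |a ^ α - b ^ α| ≤ α * (|a - b| * (a + b) ^ (α - 1)) := by
  wlog h : b ≤ a generalizing a b
  · rw [abs_sub_comm, abs_sub_comm a, add_comm a]
    exact this hb ha (le_of_not_ge h)
  have h1 : b ^ α ≤ a ^ α := Real.rpow_le_rpow hb.le h (by linarith)
  rw [abs_of_nonneg (sub_nonneg.2 h1), abs_of_nonneg (sub_nonneg.2 h)]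
  have h2 := one_add_mul_self_le_rpow_one_add (s := b / a - 1) (by
    have := div_pos hb ha
    linarith) hα
  have h3 : a ^ α = a ^ (α - 1) * a := by
    rw [← Real.rpow_add_one ha.ne']; simp
  rw [add_sub_cancel, Real.div_rpow hb.le ha.le, le_div_iff₀ (Real.rpow_pos_of_pos ha _)] at h2
  have h4 : a ^ α - b ^ α ≤ α * ((a - b) * a ^ (α - 1)) := by
    have : (1 + α * (b / a - 1)) * a ^ α = a ^ α - α * ((a - b) * a ^ (α - 1)) := by
      rw [h3]; field_simp; ring
    linarith
  refine h4.trans ?_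
  have h5 : a ^ (α - 1) ≤ (a + b) ^ (α - 1) :=
    Real.rpow_le_rpow ha.le (by linarith) (by linarith)
  have := sub_nonneg.2 h
  gcongr

/-- The relations between the reciprocal exponents `r` of the density, `s` of the velocity and `g`
of the velocity gradient. They make the convective, pressure and viscous work integrable with one
additional power of the density. -/
structure ExpRel (γ r s g : ℝ) : Prop where
  one_lt : 1 < γ
  r_pos : 0 < r
  s_pos : 0 < s
  g_pos : 0 < g
  convective : 3 * r + 2 * s + g ≤ 1
  pressure : (γ + 1) * r + g ≤ 1
  viscous : r + 2 * g ≤ 1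

/-- A density bounded below by `c`, a velocity component `u` and its gradient `G`, in the Lebesgue
spaces with reciprocal exponents `r`, `s` and `g`. -/
structure Slice (c r s g : ℝ) (ρ u : Torus d → ℝ) (G : Fin d → Torus d → ℝ) : Prop where
  rho_meas : AEStronglyMeasurable ρ volume
  u_meas : AEStronglyMeasurable u volume
  G_meas : ∀ j, AEStronglyMeasurable (G j) volume
  lower : ∀ᵐ x, c ≤ ρ x
  rho_lt : nrm r ρ < ⊤
  u_lt : nrm s u < ⊤
  G_lt : ∀ j, nrm g (G j) < ⊤
  grad : IsMollGradient u G

/-- The constant in the uniform bound for the gradients of Favre averages. -/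
def favreConst (d : ℕ) (c : ℝ) : ENNReal := ENNReal.ofReal (8 * Real.pi * d * momentConst / c)

lemma favreConst_ne_top {c : ℝ} : favreConst d c ≠ ⊤ := ENNReal.ofReal_ne_top

namespace Slice

variable {γ c r s g : ℝ} {ρ u w : Torus d → ℝ} {G H : Fin d → Torus d → ℝ}

lemma integrable_rho (e : ExpRel γ r s g) (h : Slice c r s g ρ u G) : Integrable ρ :=
  integrable_of_nrm_lt e.r_pos (by linarith [e.convective, e.r_pos, e.s_pos, e.g_pos])
    h.rho_meas h.rho_lt

lemma integrable_u (e : ExpRel γ r s g) (h : Slice c r s g ρ u G) : Integrable u :=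
  integrable_of_nrm_lt e.s_pos (by linarith [e.convective, e.r_pos, e.s_pos, e.g_pos])
    h.u_meas h.u_lt

lemma integrable_G (e : ExpRel γ r s g) (h : Slice c r s g ρ u G) (j : Fin d) :
    Integrable (G j) :=
  integrable_of_nrm_lt e.g_pos (by linarith [e.convective, e.r_pos, e.s_pos, e.g_pos])
    (h.G_meas j) (h.G_lt j)

lemma nrm_momentum_le (e : ExpRel γ r s g) (h : Slice c r s g ρ u G) :
    nrm (r + s) (fun x => ρ x * u x) ≤ nrm r ρ * nrm s u :=
  nrm_mul_le e.r_pos e.s_pos h.rho_meas h.u_meas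

lemma nrm_momentum_lt (e : ExpRel γ r s g) (h : Slice c r s g ρ u G) :
    nrm (r + s) (fun x => ρ x * u x) < ⊤ :=
  (h.nrm_momentum_le e).trans_lt (ENNReal.mul_lt_top h.rho_lt h.u_lt)

lemma integrable_momentum (e : ExpRel γ r s g) (h : Slice c r s g ρ u G) :
    Integrable fun x => ρ x * u x :=
  integrable_of_nrm_lt (add_pos e.r_pos e.s_pos)
    (by linarith [e.convective, e.r_pos, e.s_pos, e.g_pos]) (h.rho_meas.mul h.u_meas)
    (h.nrm_momentum_lt e)

lemma nrm_flux_le (e : ExpRel γ r s g) (h : Slice c r s g ρ u G) (h' : Slice c r s g ρ w H) :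
    nrm (r + 2 * s) (fun x => ρ x * u x * w x) ≤ nrm r ρ * nrm s u * nrm s w := by
  rw [show r + 2 * s = r + s + s by ring]
  refine (nrm_mul_le (add_pos e.r_pos e.s_pos) e.s_pos (h.rho_meas.mul h.u_meas) h'.u_meas).trans ?_
  gcongr
  exact h.nrm_momentum_le e

lemma nrm_flux_lt (e : ExpRel γ r s g) (h : Slice c r s g ρ u G) (h' : Slice c r s g ρ w H) :
    nrm (r + 2 * s) (fun x => ρ x * u x * w x) < ⊤ :=
  (h.nrm_flux_le e h').trans_lt (ENNReal.mul_lt_top (ENNReal.mul_lt_top h.rho_lt h.u_lt) h'.u_lt)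

lemma integrable_flux (e : ExpRel γ r s g) (h : Slice c r s g ρ u G) (h' : Slice c r s g ρ w H) :
    Integrable fun x => ρ x * u x * w x :=
  integrable_of_nrm_lt (by linarith [e.r_pos, e.s_pos])
    (by linarith [e.convective, e.r_pos, e.s_pos, e.g_pos])
    ((h.rho_meas.mul h.u_meas).mul h'.u_meas) (h.nrm_flux_lt e h')

lemma integrable_rpow (e : ExpRel γ r s g) (hc : 0 < c) (h : Slice c r s g ρ u G) :
    Integrable fun x => ρ x ^ γ := by
  have h0 : ∀ᵐ x, 0 ≤ ρ x := by filter_upwards [h.lower] with x hx using hc.le.trans hx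
  refine integrable_of_nrm_lt (θ := γ * r) (mul_pos (by linarith [e.one_lt]) e.r_pos)
    (by linarith [e.pressure, e.r_pos, e.g_pos])
    (h.rho_meas.aemeasurable.pow_const γ).aestronglyMeasurable ?_
  rw [nrm_rpow (by linarith [e.one_lt]) h0]
  exact ENNReal.rpow_lt_top_of_nonneg (by linarith [e.one_lt]) h.rho_lt.ne

lemma le_moll_rho (e : ExpRel γ r s g) (h : Slice c r s g ρ u G) (n : ℕ) (x : Torus d) :
    c ≤ moll n ρ x := le_moll (h.integrable_rho e) h.lower x

lemma continuous_favre (e : ExpRel γ r s g) (hc : 0 < c) (h : Slice c r s g ρ u G) (n : ℕ) :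
    Continuous (favre n ρ u) :=
  CompressibleNS.continuous_favre hc (h.integrable_rho e) h.lower (h.integrable_momentum e) n

lemma continuous_favreD (e : ExpRel γ r s g) (hc : 0 < c) (h : Slice c r s g ρ u G) (n : ℕ)
    (j : Fin d) : Continuous (favreD n j ρ u) :=
  CompressibleNS.continuous_favreD hc (h.integrable_rho e) h.lower (h.integrable_momentum e) n j

lemma hasDirDeriv_favre (e : ExpRel γ r s g) (hc : 0 < c) (h : Slice c r s g ρ u G) (n : ℕ)
    (j : Fin d) : HasDirDeriv (coordVec j) (favre n ρ u) (favreD n j ρ u) :=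
  CompressibleNS.hasDirDeriv_favre hc (h.integrable_rho e) h.lower (h.integrable_momentum e) n j

lemma nrm_favre_le (e : ExpRel γ r s g) (hc : 0 < c) (h : Slice c r s g ρ u G) (n : ℕ) :
    nrm (r + s) (favre n ρ u) ≤ ENNReal.ofReal c⁻¹ * (nrm r ρ * nrm s u) := by
  refine (nrm_mono_ae_of_le_mul (g := moll n fun x => ρ x * u x) (K := c⁻¹)
    (Eventually.of_forall fun x => ?_)).trans ?_
  · have h1 := h.le_moll_rho e n x
    rw [favre, abs_div, abs_of_pos (hc.trans_le h1), inv_mul_eq_div]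
    gcongr
  · gcongr
    exact (nrm_moll_le (add_pos e.r_pos e.s_pos)
      (by linarith [e.convective, e.r_pos, e.s_pos, e.g_pos]) (h.rho_meas.mul h.u_meas) n).trans
      (h.nrm_momentum_le e)

/-- Favre averages converge to the velocity. -/
lemma tendsto_nrm_favre_sub (e : ExpRel γ r s g) (hc : 0 < c) (h : Slice c r s g ρ u G) :
    Tendsto (fun n => nrm (r + s) (fun x => favre n ρ u x - u x)) atTop (𝓝 0) := by
  have hr1 : r ≤ 1 := by linarith [e.convective, e.r_pos, e.s_pos, e.g_pos]
  have hrs1 : r + s ≤ 1 := by linarith [e.convective, e.r_pos, e.s_pos, e.g_pos]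
  have hrs0 := add_pos e.r_pos e.s_pos
  have hρi := h.integrable_rho e
  have hmi := h.integrable_momentum e
  have hle : ∀ n, nrm (r + s) (fun x => favre n ρ u x - u x) ≤ ENNReal.ofReal c⁻¹ *
      (nrm (r + s) (fun x => moll n (fun y => ρ y * u y) x - ρ x * u x) +
        nrm r (fun x => moll n ρ x - ρ x) * nrm s u) := fun n => by
    have hcm := (CompressibleNS.continuous_moll (n := n) hmi).aestronglyMeasurable
      (μ := (volume : Measure (Torus d)))
    have hcρ := (CompressibleNS.continuous_moll (n := n) hρi).aestronglyMeasurable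
      (μ := (volume : Measure (Torus d)))
    refine (nrm_mono_ae_of_le_mul (K := c⁻¹) (g := fun x =>
      (moll n (fun y => ρ y * u y) x - ρ x * u x) - (moll n ρ x - ρ x) * u x)
      (Eventually.of_forall fun x => ?_)).trans ?_
    · have h1 := h.le_moll_rho e n x
      have h2 := hc.trans_le h1
      have : favre n ρ u x - u x = ((moll n (fun y => ρ y * u y) x - ρ x * u x) -
          (moll n ρ x - ρ x) * u x) / moll n ρ x := by
        rw [favre]; field_simp; ring
      rw [this, abs_div, abs_of_pos h2, inv_mul_eq_div]
      gcongr
    · gcongr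
      refine (nrm_sub_le (f := fun x => moll n (fun y => ρ y * u y) x - ρ x * u x)
        (g := fun x => (moll n ρ x - ρ x) * u x) hrs0 hrs1 (hcm.sub (h.rho_meas.mul h.u_meas))
        ((hcρ.sub h.rho_meas).mul h.u_meas)).trans ?_
      refine add_le_add le_rfl ?_
      exact nrm_mul_le (f := fun x => moll n ρ x - ρ x) e.r_pos e.s_pos (hcρ.sub h.rho_meas)
        h.u_meas
  have h1 := tendsto_nrm_moll_sub hrs0 hrs1 (h.rho_meas.mul h.u_meas) (h.nrm_momentum_lt e)
  have h2 := tendsto_nrm_moll_sub e.r_pos hr1 h.rho_meas h.rho_lt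
  have h3 := ENNReal.Tendsto.const_mul (a := ENNReal.ofReal c⁻¹)
    (h1.add (ENNReal.Tendsto.mul_const h2 (Or.inr h.u_lt.ne))) (Or.inr ENNReal.ofReal_ne_top)
  simp only [zero_mul, add_zero, mul_zero] at h3
  exact tendsto_of_tendsto_of_tendsto_of_le_of_le tendsto_const_nhds h3 (fun _ => by simp) hle

/-- The commutator between mollification and the convective flux. -/
def convComm (n : ℕ) (ρ u w : Torus d → ℝ) (x : Torus d) : ℝ :=
  moll n (fun y => ρ y * u y * w y) x - moll n (fun y => ρ y * w y) x * favre n ρ u x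

lemma continuous_convComm (e : ExpRel γ r s g) (hc : 0 < c) (h : Slice c r s g ρ u G)
    (h' : Slice c r s g ρ w H) (n : ℕ) : Continuous (convComm n ρ u w) :=
  (CompressibleNS.continuous_moll (h.integrable_flux e h')).sub
    ((CompressibleNS.continuous_moll (h'.integrable_momentum e)).mul (h.continuous_favre e hc n))

lemma nrm_convComm_le (e : ExpRel γ r s g) (hc : 0 < c) (h : Slice c r s g ρ u G)
    (h' : Slice c r s g ρ w H) (n : ℕ) :
    nrm (2 * r + 2 * s) (convComm n ρ u w) ≤ nrm r ρ * nrm s u * nrm s w +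
      nrm r ρ * nrm s w * (ENNReal.ofReal c⁻¹ * (nrm r ρ * nrm s u)) := by
  have h0 : 0 < r + 2 * s := by linarith [e.r_pos, e.s_pos]
  have h1 : 2 * r + 2 * s ≤ 1 := by linarith [e.convective, e.r_pos, e.s_pos, e.g_pos]
  have hrs0 := add_pos e.r_pos e.s_pos
  have hmi := h'.integrable_momentum e
  have hfi := h.integrable_flux e h'
  have hf := ((h.rho_meas.mul h.u_meas).mul h'.u_meas)
  have c1 := (CompressibleNS.continuous_moll (n := n) hfi).aestronglyMeasurable
      (μ := (volume : Measure (Torus d)))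
  have c2 := (CompressibleNS.continuous_moll (n := n) hmi).aestronglyMeasurable
      (μ := (volume : Measure (Torus d)))
  have c3 := (h.continuous_favre e hc n).aestronglyMeasurable (μ := (volume : Measure (Torus d)))
  refine (nrm_sub_le (by linarith [e.r_pos, e.s_pos]) h1 c1 (c2.mul c3)).trans (add_le_add ?_ ?_)
  · refine (nrm_mono h0 (by linarith [e.r_pos]) c1).trans ((nrm_moll_le h0 (by
      linarith [e.r_pos]) hf n).trans ?_)
    exact h.nrm_flux_le e h'
  · rw [show 2 * r + 2 * s = (r + s) + (r + s) by ring]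
    refine (nrm_mul_le hrs0 hrs0 c2 c3).trans (mul_le_mul' ?_ (h.nrm_favre_le e hc n))
    exact (nrm_moll_le hrs0 (by linarith [e.r_pos, e.s_pos]) (h'.rho_meas.mul h'.u_meas) n).trans
      (h'.nrm_momentum_le e)

lemma tendsto_nrm_convComm (e : ExpRel γ r s g) (hc : 0 < c) (h : Slice c r s g ρ u G)
    (h' : Slice c r s g ρ w H) :
    Tendsto (fun n => nrm (2 * r + 2 * s) (convComm n ρ u w)) atTop (𝓝 0) := by
  have h0 : 0 < r + 2 * s := by linarith [e.r_pos, e.s_pos]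
  have h1 : 2 * r + 2 * s ≤ 1 := by linarith [e.convective, e.r_pos, e.s_pos, e.g_pos]
  have h2 : 0 < 2 * r + 2 * s := by linarith [e.r_pos, e.s_pos]
  have hrs0 := add_pos e.r_pos e.s_pos
  have hrs1 : r + s ≤ 1 := by linarith [e.r_pos, e.s_pos]
  have hmi := h'.integrable_momentum e
  have hfi := h.integrable_flux e h'
  have hf := ((h.rho_meas.mul h.u_meas).mul h'.u_meas)
  have hw := (h'.rho_meas.mul h'.u_meas)
  have hle : ∀ n, nrm (2 * r + 2 * s) (convComm n ρ u w) ≤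
      nrm (r + 2 * s) (fun x => moll n (fun y => ρ y * u y * w y) x - ρ x * u x * w x) +
      (nrm (r + s) (fun x => ρ x * w x) * nrm (r + s) (fun x => favre n ρ u x - u x) +
        nrm (r + s) (fun x => moll n (fun y => ρ y * w y) x - ρ x * w x) *
          (ENNReal.ofReal c⁻¹ * (nrm r ρ * nrm s u))) := fun n => by
    have c1 := (CompressibleNS.continuous_moll (n := n) hfi).aestronglyMeasurable
      (μ := (volume : Measure (Torus d)))
    have c2 := (CompressibleNS.continuous_moll (n := n) hmi).aestronglyMeasurable
      (μ := (volume : Measure (Torus d)))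
    have c3 := (h.continuous_favre e hc n).aestronglyMeasurable (μ := (volume : Measure (Torus d)))
    have e1 : convComm n ρ u w = fun x =>
        (moll n (fun y => ρ y * u y * w y) x - ρ x * u x * w x) -
        (ρ x * w x * (favre n ρ u x - u x) +
          (moll n (fun y => ρ y * w y) x - ρ x * w x) * favre n ρ u x) := by
      funext x
      rw [convComm]
      ring
    rw [e1]
    refine (nrm_sub_le h2 h1 (c1.sub hf) ((hw.mul (c3.sub h.u_meas)).add
      ((c2.sub hw).mul c3))).trans (add_le_add (nrm_mono h0 (by linarith [e.r_pos]) (c1.sub hf)) ?_)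
    refine (nrm_add_le h2 h1 (hw.mul (c3.sub h.u_meas)) ((c2.sub hw).mul c3)).trans ?_
    rw [show 2 * r + 2 * s = (r + s) + (r + s) by ring]
    refine add_le_add (nrm_mul_le hrs0 hrs0 hw (c3.sub h.u_meas)) ?_
    exact (nrm_mul_le hrs0 hrs0 (c2.sub hw) c3).trans (mul_le_mul_right (h.nrm_favre_le e hc n) _)
  have t1 := tendsto_nrm_moll_sub h0 (by linarith [e.r_pos]) hf (h.nrm_flux_lt e h')
  have t2 := ENNReal.Tendsto.const_mul (a := nrm (r + s) (fun x => ρ x * w x))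
    (h.tendsto_nrm_favre_sub e hc) (Or.inr (h'.nrm_momentum_lt e).ne)
  have t3 := ENNReal.Tendsto.mul_const (b := ENNReal.ofReal c⁻¹ * (nrm r ρ * nrm s u))
    (tendsto_nrm_moll_sub hrs0 hrs1 hw (h'.nrm_momentum_lt e))
    (Or.inr (ENNReal.mul_ne_top ENNReal.ofReal_ne_top
      (ENNReal.mul_ne_top h.rho_lt.ne h.u_lt.ne)))
  have t := t1.add (t2.add t3)
  simp only [zero_mul, add_zero, mul_zero] at t
  exact tendsto_of_tendsto_of_tendsto_of_le_of_le tendsto_const_nhds t (fun _ => by simp) hle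

/-- The defect between the mollified pressure and the pressure of the mollified density. -/
def pressDefect (n : ℕ) (γ : ℝ) (ρ : Torus d → ℝ) (x : Torus d) : ℝ :=
  moll n (fun y => ρ y ^ γ) x - moll n ρ x ^ γ

lemma continuous_rpow_moll (e : ExpRel γ r s g) (hc : 0 < c) (h : Slice c r s g ρ u G) (n : ℕ)
    (a : ℝ) : Continuous fun x => moll n ρ x ^ a :=
  (CompressibleNS.continuous_moll (h.integrable_rho e)).rpow_const fun x =>
    Or.inl (hc.trans_le (h.le_moll_rho e n x)).ne'

lemma continuous_pressDefect (e : ExpRel γ r s g) (hc : 0 < c) (h : Slice c r s g ρ u G) (n : ℕ) :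
    Continuous (pressDefect n γ ρ) :=
  (CompressibleNS.continuous_moll (h.integrable_rpow e hc)).sub (h.continuous_rpow_moll e hc n γ)

lemma nrm_pressDefect_le (e : ExpRel γ r s g) (hc : 0 < c) (h : Slice c r s g ρ u G) (n : ℕ) :
    nrm (γ * r) (pressDefect n γ ρ) ≤ 2 * nrm r ρ ^ γ := by
  have hγ0 : 0 < γ := by linarith [e.one_lt]
  have h0 : 0 < γ * r := mul_pos hγ0 e.r_pos
  have h1 : γ * r ≤ 1 := by linarith [e.pressure, e.r_pos, e.g_pos]
  have hpos : ∀ᵐ x, 0 ≤ ρ x := by filter_upwards [h.lower] with x hx using hc.le.trans hx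
  have hpi := h.integrable_rpow e hc
  refine (nrm_sub_le h0 h1 (CompressibleNS.continuous_moll hpi).aestronglyMeasurable
    (h.continuous_rpow_moll e hc n γ).aestronglyMeasurable).trans ?_
  rw [two_mul]
  refine add_le_add ((nrm_moll_le h0 h1 hpi.1 n).trans (nrm_rpow hγ0 hpos).le) ?_
  rw [nrm_rpow hγ0 (Eventually.of_forall fun x => hc.le.trans (h.le_moll_rho e n x))]
  gcongr
  exact nrm_moll_le e.r_pos (by linarith [e.convective, e.r_pos, e.s_pos, e.g_pos]) h.rho_meas n

lemma tendsto_nrm_pressDefect (e : ExpRel γ r s g) (hc : 0 < c) (h : Slice c r s g ρ u G) :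
    Tendsto (fun n => nrm (γ * r) (pressDefect n γ ρ)) atTop (𝓝 0) := by
  have hγ1 : 0 < γ - 1 := by linarith [e.one_lt]
  have hγ0 : 0 < γ := by linarith [e.one_lt]
  have h0 : 0 < γ * r := mul_pos hγ0 e.r_pos
  have h1 : γ * r ≤ 1 := by linarith [e.pressure, e.r_pos, e.g_pos]
  have hr1 : r ≤ 1 := by linarith [e.convective, e.r_pos, e.s_pos, e.g_pos]
  have hpos : ∀ᵐ x, 0 ≤ ρ x := by filter_upwards [h.lower] with x hx using hc.le.trans hx
  have hpi := h.integrable_rpow e hc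
  have hplt : nrm (γ * r) (fun x => ρ x ^ γ) < ⊤ := by
    rw [nrm_rpow hγ0 hpos]
    exact ENNReal.rpow_lt_top_of_nonneg hγ0.le h.rho_lt.ne
  have hle : ∀ n, nrm (γ * r) (pressDefect n γ ρ) ≤
      nrm (γ * r) (fun x => moll n (fun y => ρ y ^ γ) x - ρ x ^ γ) +
        ENNReal.ofReal γ * (nrm r (fun x => moll n ρ x - ρ x) *
          (nrm r ρ + nrm r ρ) ^ (γ - 1)) := fun n => by
    have c1 := (CompressibleNS.continuous_moll (n := n) hpi).aestronglyMeasurable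
      (μ := (volume : Measure (Torus d)))
    have c2 := (CompressibleNS.continuous_moll (n := n) (h.integrable_rho e)).aestronglyMeasurable
      (μ := (volume : Measure (Torus d)))
    have c3 := (h.continuous_rpow_moll e hc n γ).aestronglyMeasurable
      (μ := (volume : Measure (Torus d)))
    have e1 : pressDefect n γ ρ = fun x =>
        (moll n (fun y => ρ y ^ γ) x - ρ x ^ γ) - (moll n ρ x ^ γ - ρ x ^ γ) := by
      funext x
      rw [pressDefect]
      ring
    rw [e1]
    refine (nrm_sub_le h0 h1 (c1.sub hpi.1) (c3.sub hpi.1)).trans (add_le_add le_rfl ?_)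
    refine (nrm_mono_ae_of_le_mul (K := γ) (g := fun x => (moll n ρ x - ρ x) *
      (moll n ρ x + ρ x) ^ (γ - 1)) ?_).trans ?_
    · filter_upwards [h.lower] with x hx
      have hx1 := hc.trans_le (h.le_moll_rho e n x)
      have hx2 := hc.trans_le hx
      rw [abs_mul, abs_of_pos (Real.rpow_pos_of_pos (add_pos hx1 hx2) _)]
      exact abs_rpow_sub_rpow_le hx1 hx2 e.one_lt.le
    · gcongr
      rw [show γ * r = r + (γ - 1) * r by ring]
      refine (nrm_mul_le (f := fun x => moll n ρ x - ρ x)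
        (g := fun x => (moll n ρ x + ρ x) ^ (γ - 1)) e.r_pos (mul_pos hγ1 e.r_pos)
        (c2.sub h.rho_meas)
        ((c2.add h.rho_meas).aemeasurable.pow_const _).aestronglyMeasurable).trans ?_
      refine mul_le_mul_right ?_ _
      rw [nrm_rpow (f := fun x => moll n ρ x + ρ x) hγ1]
      · gcongr
        refine (nrm_add_le e.r_pos hr1 c2 h.rho_meas).trans ?_
        gcongr
        exact nrm_moll_le e.r_pos hr1 h.rho_meas n
      · filter_upwards [h.lower] with x hx
        exact (add_pos (hc.trans_le (h.le_moll_rho e n x)) (hc.trans_le hx)).le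
  have t1 := tendsto_nrm_moll_sub h0 h1 hpi.1 hplt
  have t2 := tendsto_nrm_moll_sub e.r_pos hr1 h.rho_meas h.rho_lt
  have hfin : (nrm r ρ + nrm r ρ) ^ (γ - 1) ≠ ⊤ :=
    (ENNReal.rpow_lt_top_of_nonneg hγ1.le
      (ENNReal.add_lt_top.2 ⟨h.rho_lt, h.rho_lt⟩).ne).ne
  have t := t1.add (ENNReal.Tendsto.const_mul (a := ENNReal.ofReal γ)
    (ENNReal.Tendsto.mul_const t2 (Or.inr hfin)) (Or.inr ENNReal.ofReal_ne_top))
  simp only [zero_mul, add_zero, mul_zero] at t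
  exact tendsto_of_tendsto_of_tendsto_of_le_of_le tendsto_const_nhds t (fun _ => by simp) hle

/-- The pairing bound for the gradient of the Favre average. -/
lemma lintegral_mul_favreD_le (e : ExpRel γ r s g) (hc : 0 < c) (h : Slice c r s g ρ u G)
    {θ : ℝ} (hθ : 0 < θ) (hθ1 : θ + r + g ≤ 1) {F : Torus d → ℝ}
    (hF : AEStronglyMeasurable F volume) (n : ℕ) (j : Fin d) :
    ∫⁻ x, ‖F x * favreD n j ρ u x‖ₑ ≤
      favreConst d c * (nrm θ F * nrm r ρ * ∑ j, nrm g (G j)) := by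
  simp only [enorm_mul]
  exact CompressibleNS.lintegral_mul_favreD_le hθ e.r_pos e.g_pos hθ1 hc hF (h.integrable_rho e)
    h.lower (h.integrable_momentum e) (h.integrable_u e) (h.integrable_G e) h.grad n j

lemma enorm_integral_mul_favreD_le (e : ExpRel γ r s g) (hc : 0 < c) (h : Slice c r s g ρ u G)
    {θ : ℝ} (hθ : 0 < θ) (hθ1 : θ + r + g ≤ 1) {F : Torus d → ℝ}
    (hF : AEStronglyMeasurable F volume) (n : ℕ) (j : Fin d) :
    ‖∫ x, F x * favreD n j ρ u x‖ₑ ≤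
      favreConst d c * (nrm θ F * nrm r ρ * ∑ j, nrm g (G j)) :=
  (enorm_integral_le_lintegral_enorm _).trans (h.lintegral_mul_favreD_le e hc hθ hθ1 hF n j)

lemma sum_nrm_lt (h : Slice c r s g ρ u G) : ∑ j, nrm g (G j) < ⊤ :=
  ENNReal.sum_lt_top.2 fun j _ => h.G_lt j

lemma tendsto_integral_mul_favreD (e : ExpRel γ r s g) (hc : 0 < c) (h : Slice c r s g ρ u G)
    {θ : ℝ} (hθ : 0 < θ) (hθ1 : θ + r + g ≤ 1) {F : ℕ → Torus d → ℝ}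
    (hF : ∀ n, AEStronglyMeasurable (F n) volume)
    (hF0 : Tendsto (fun n => nrm θ (F n)) atTop (𝓝 0)) (j : Fin d) :
    Tendsto (fun n => ∫ x, F n x * favreD n j ρ u x) atTop (𝓝 0) := by
  rw [tendsto_zero_iff_enorm_tendsto_zero]
  have t := ENNReal.Tendsto.const_mul (a := favreConst d c)
    (ENNReal.Tendsto.mul_const (ENNReal.Tendsto.mul_const hF0 (Or.inr h.rho_lt.ne))
      (Or.inr h.sum_nrm_lt.ne)) (Or.inr favreConst_ne_top)
  simp only [zero_mul, mul_zero] at t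
  exact tendsto_of_tendsto_of_tendsto_of_le_of_le tendsto_const_nhds t (fun _ => by simp)
    fun n => h.enorm_integral_mul_favreD_le e hc hθ hθ1 (hF n) n j

/-- Weak convergence of the gradients of Favre averages, tested against a fixed mollification. -/
lemma tendsto_integral_moll_mul_favreD (e : ExpRel γ r s g) (hc : 0 < c)
    (h : Slice c r s g ρ u G) {S : Torus d → ℝ} (hS : Integrable S) (m : ℕ) (j : Fin d) :
    Tendsto (fun n => ∫ x, moll m S x * favreD n j ρ u x) atTop
      (𝓝 (∫ x, moll m S x * G j x)) := by
  have hSc := CompressibleNS.continuous_moll (n := m) hS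
  have hSDc := CompressibleNS.continuous_mollD (n := m) (j := j) hS
  have hui := h.integrable_u e
  have e1 : ∀ n, ∫ x, moll m S x * favreD n j ρ u x = -∫ x, mollD m j S x * favre n ρ u x :=
    fun n => by
      have := (hasDirDeriv_moll (n := m) (j := j) hS).integral_mul_eq_neg
        (h.hasDirDeriv_favre e hc n j) hSc (h.continuous_favre e hc n) hSDc
        (h.continuous_favreD e hc n j)
      linarith
  have e2 : ∫ x, moll m S x * G j x = -∫ x, mollD m j S x * u x := by
    rw [integral_mollD_mul hS hui, neg_neg, integral_moll_mul hS (h.integrable_G e j)]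
    simp only [h.grad m j]
  rw [e2]
  simp only [e1]
  refine Tendsto.neg ?_
  obtain ⟨C, hC0, hC⟩ := exists_bound_of_continuous hSDc
  refine tendsto_integral_of_L1 _ ?_ (Eventually.of_forall fun n => ?_) ?_
  · exact hSDc.aestronglyMeasurable.mul hui.1
  · exact integrable_of_continuous (hSDc.mul (h.continuous_favre e hc n))
  · have t := ENNReal.Tendsto.const_mul (a := ENNReal.ofReal C) (h.tendsto_nrm_favre_sub e hc)
      (Or.inr ENNReal.ofReal_ne_top)
    rw [mul_zero] at t
    refine tendsto_of_tendsto_of_tendsto_of_le_of_le tendsto_const_nhds t (fun _ => by simp)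
      fun n => ?_
    have hmeas : AEStronglyMeasurable (fun x => favre n ρ u x - u x) volume :=
      (h.continuous_favre e hc n).aestronglyMeasurable.sub h.u_meas
    calc ∫⁻ x, ‖mollD m j S x * favre n ρ u x - mollD m j S x * u x‖ₑ
        ≤ ∫⁻ x, ENNReal.ofReal C * ‖favre n ρ u x - u x‖ₑ := by
          refine lintegral_mono fun x => ?_
          rw [← mul_sub, enorm_mul, ← ofReal_norm (mollD m j S x)]
          gcongr
          exact hC x
      _ = ENNReal.ofReal C * ∫⁻ x, ‖favre n ρ u x - u x‖ₑ :=
          lintegral_const_mul' _ _ ENNReal.ofReal_ne_top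
      _ ≤ _ := by
          gcongr
          exact lintegral_enorm_le_nrm (add_pos e.r_pos e.s_pos)
            (by linarith [e.convective, e.r_pos, e.s_pos, e.g_pos]) hmeas

/-- The viscous work of the mollified stress converges. -/
lemma tendsto_integral_stress (e : ExpRel γ r s g) (hc : 0 < c)
    (h : Slice c r s g ρ u G) {S : Torus d → ℝ} (hS : AEStronglyMeasurable S volume)
    (hSlt : nrm g S < ⊤) (j : Fin d) :
    Tendsto (fun n => ∫ x, moll n S x * favreD n j ρ u x) atTop (𝓝 (∫ x, S x * G j x)) := by
  have hg1 : g ≤ 1 := by linarith [e.convective, e.r_pos, e.s_pos, e.g_pos]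
  have hv : g + r + g ≤ 1 := by linarith [e.viscous]
  have hSi := integrable_of_nrm_lt e.g_pos hg1 hS hSlt
  have hSc : ∀ n, Continuous (moll n S) := fun n => CompressibleNS.continuous_moll hSi
  have t0 := tendsto_nrm_moll_sub e.g_pos hg1 hS hSlt
  have hdiff : ∀ n, AEStronglyMeasurable (fun x => moll n S x - S x) volume := fun n =>
    (hSc n).aestronglyMeasurable.sub hS
  -- `∫ (Sⁿ - S) ∂_j Vⁿ → 0`; it remains to treat `∫ S ∂_j Vⁿ`, with `S` close to a fixed `Sᵐ`
  have t1 := h.tendsto_integral_mul_favreD e hc e.g_pos hv hdiff t0 j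
  have hint1 : ∀ n m, Integrable fun x => (moll m S x - S x) * favreD n j ρ u x := fun n m => by
    obtain ⟨C, -, hC⟩ := exists_bound_of_continuous (h.continuous_favreD e hc n j)
    exact ((integrable_of_continuous (hSc m)).sub hSi).mul_bdd (c := C)
      (h.continuous_favreD e hc n j).aestronglyMeasurable (Eventually.of_forall hC)
  have hint2 : ∀ n m, Integrable fun x => moll m S x * favreD n j ρ u x := fun n m =>
    integrable_of_continuous ((hSc m).mul (h.continuous_favreD e hc n j))
  have hGle : ∀ m, ‖∫ x, (moll m S x - S x) * G j x‖ₑ ≤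
      nrm g (fun x => moll m S x - S x) * nrm g (G j) := fun m => by
    refine (enorm_integral_le_lintegral_enorm _).trans ?_
    simp only [enorm_mul]
    exact lintegral_mul_le_nrm e.g_pos e.g_pos (by linarith [e.r_pos]) (hdiff m) (h.G_meas j)
  have hintG : ∀ m, Integrable fun x => (moll m S x - S x) * G j x := fun m => by
    refine ⟨(hdiff m).mul (h.G_meas j), ?_⟩
    have h1 := lintegral_mul_le_nrm e.g_pos e.g_pos (by linarith [e.r_pos]) (hdiff m) (h.G_meas j)
    simp only [HasFiniteIntegral, enorm_mul]
    refine h1.trans_lt (ENNReal.mul_lt_top ?_ (h.G_lt j))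
    refine (nrm_sub_le e.g_pos hg1 (hSc m).aestronglyMeasurable hS).trans_lt
      (ENNReal.add_lt_top.2 ⟨(nrm_moll_le e.g_pos hg1 hS m).trans_lt hSlt, hSlt⟩)
  have hintG2 : ∀ m, Integrable fun x => moll m S x * G j x := fun m => by
    obtain ⟨C, -, hC⟩ := exists_bound_of_continuous (hSc m)
    exact (h.integrable_G e j).bdd_mul (c := C) (hSc m).aestronglyMeasurable
      (Eventually.of_forall hC)
  have hb : Tendsto (fun m => favreConst d c * (nrm g (fun x => moll m S x - S x) * nrm r ρ *
      ∑ j, nrm g (G j))) atTop (𝓝 0) := by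
    have t := ENNReal.Tendsto.const_mul (a := favreConst d c)
      (ENNReal.Tendsto.mul_const (ENNReal.Tendsto.mul_const t0 (Or.inr h.rho_lt.ne))
        (Or.inr h.sum_nrm_lt.ne)) (Or.inr favreConst_ne_top)
    simpa only [zero_mul, mul_zero] using t
  have hb2 : Tendsto (fun m => nrm g (fun x => moll m S x - S x) * nrm g (G j)) atTop (𝓝 0) := by
    have t := ENNReal.Tendsto.mul_const t0 (Or.inr (h.G_lt j).ne)
    simpa only [zero_mul] using t
  rw [Metric.tendsto_nhds]
  intro ε hε
  have hε' : (0 : ENNReal) < ENNReal.ofReal (ε / 4) := by simpa using hε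
  obtain ⟨m, hm1, hm2⟩ := ((hb.eventually (gt_mem_nhds hε')).and
    (hb2.eventually (gt_mem_nhds hε'))).exists
  have hlt : ∀ a : ℝ, ‖a‖ₑ < ENNReal.ofReal (ε / 4) → |a| < ε / 4 := fun a ha => by
    rw [← ofReal_norm, ENNReal.ofReal_lt_ofReal_iff (by linarith)] at ha
    exact ha
  have t2 := h.tendsto_integral_moll_mul_favreD e hc hSi m j
  filter_upwards [Metric.tendsto_nhds.1 t1 (ε / 4) (by linarith),
    Metric.tendsto_nhds.1 t2 (ε / 4) (by linarith)] with n hn1 hn2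
  have a1 := hlt _ ((h.enorm_integral_mul_favreD_le e hc e.g_pos hv (hdiff m) n j).trans_lt hm1)
  have a2 := hlt _ ((hGle m).trans_lt hm2)
  rw [Real.dist_eq, sub_zero] at hn1
  rw [Real.dist_eq] at hn2 ⊢
  have e1 : ∫ x, moll n S x * favreD n j ρ u x = (∫ x, (moll n S x - S x) * favreD n j ρ u x) -
      (∫ x, (moll m S x - S x) * favreD n j ρ u x) + ∫ x, moll m S x * favreD n j ρ u x := by
    rw [← integral_sub (hint1 n n) (hint1 n m), ← integral_add
      (f := fun x => (moll n S x - S x) * favreD n j ρ u x -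
        (moll m S x - S x) * favreD n j ρ u x) ((hint1 n n).sub (hint1 n m)) (hint2 n m)]
    congr 1
    funext x
    ring
  have e2 : ∫ x, S x * G j x = (∫ x, moll m S x * G j x) - ∫ x, (moll m S x - S x) * G j x := by
    rw [← integral_sub (hintG2 m) (hintG m)]
    congr 1
    funext x
    ring
  rw [e1, e2]
  rw [abs_lt] at *
  constructor <;> linarith [hn1.1, hn1.2, hn2.1, hn2.2, a1.1, a1.2, a2.1, a2.2]

end Slice

/-! ### Functions of time -/

/-- The primitive on `(0, T)` that vanishes at `0`, extended by constants. -/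
def prim (T : ℝ) (g : ℝ → ℝ) (t : ℝ) : ℝ := ∫ s in (0 : ℝ)..t, (Ioo 0 T).indicator g s

section Time

variable {T : ℝ} {f g : ℝ → ℝ}

lemma integrable_indicator_Ioo (hg : IntegrableOn g (Ioo 0 T)) :
    Integrable ((Ioo 0 T).indicator g) :=
  (integrable_indicator_iff measurableSet_Ioo).2 hg

lemma prim_zero : prim T g 0 = 0 := by simp [prim]

lemma continuous_prim (hg : IntegrableOn g (Ioo 0 T)) : Continuous (prim T g) :=
  intervalIntegral.continuous_primitive
    (fun _ _ => (integrable_indicator_Ioo hg).intervalIntegrable) 0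

lemma absolutelyContinuous_prim (hg : IntegrableOn g (Ioo 0 T)) :
    AbsolutelyContinuousOnInterval (prim T g) 0 T :=
  (integrable_indicator_Ioo hg).intervalIntegrable.absolutelyContinuousOnInterval_intervalIntegral
    (by simp)

lemma ae_hasDerivAt_prim (hg : IntegrableOn g (Ioo 0 T)) :
    ∀ᵐ t ∂(volume.restrict (Ioo 0 T)), HasDerivAt (prim T g) (g t) t := by
  rw [ae_restrict_iff' measurableSet_Ioo]
  filter_upwards [LocallyIntegrable.ae_hasDerivAt_integral
    (integrable_indicator_Ioo hg).locallyIntegrable]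
    with t ht hmem
  have := ht 0
  rwa [indicator_of_mem hmem] at this

/-- The composition of a continuously differentiable function with an absolutely continuous one is
absolutely continuous. -/
lemma absolutelyContinuous_comp {φ : ℝ → ℝ} {a b A B : ℝ} (hφ : ContDiffOn ℝ 1 φ (Icc A B))
    (hf : AbsolutelyContinuousOnInterval f a b) (hm : ∀ t ∈ uIcc a b, f t ∈ Icc A B) :
    AbsolutelyContinuousOnInterval (fun t => φ (f t)) a b := by
  obtain ⟨K, hK⟩ := hφ.exists_lipschitzOnWith one_ne_zero (convex_Icc A B) isCompact_Icc
  rw [absolutelyContinuousOnInterval_iff] at hf ⊢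
  intro ε hε
  obtain ⟨δ, hδ, h⟩ := hf (ε / (K + 1)) (by positivity)
  refine ⟨δ, hδ, fun E hE hlt => ?_⟩
  calc ∑ i ∈ Finset.range E.1, dist (φ (f (E.2 i).1)) (φ (f (E.2 i).2))
      ≤ ∑ i ∈ Finset.range E.1, (K + 1) * dist (f (E.2 i).1) (f (E.2 i).2) := by
        refine Finset.sum_le_sum fun i hi => ?_
        refine (hK.dist_le_mul _ (hm _ (hE.1 i hi).1) _ (hm _ (hE.1 i hi).2)).trans ?_
        gcongr
        linarith
    _ = (K + 1) * ∑ i ∈ Finset.range E.1, dist (f (E.2 i).1) (f (E.2 i).2) := by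
        rw [Finset.mul_sum]
    _ < (K + 1) * (ε / (K + 1)) := by
        have := h E hE hlt
        gcongr
    _ = ε := by field_simp

/-- The fundamental theorem of calculus with a prescribed almost everywhere derivative. -/
lemma integral_eq_sub_of_ae_hasDerivAt {F F' : ℝ → ℝ} {t : ℝ} (ht : t ∈ Icc 0 T)
    (hF : AbsolutelyContinuousOnInterval F 0 T)
    (h : ∀ᵐ s ∂(volume.restrict (Ioo 0 T)), HasDerivAt F (F' s) s) :
    ∫ s in Ioo 0 t, F' s = F t - F 0 := by
  have hsub : uIcc 0 t ⊆ uIcc 0 T := by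
    rw [uIcc_of_le ht.1, uIcc_of_le (ht.1.trans ht.2)]
    exact Icc_subset_Icc_right ht.2
  rw [← (hF.mono hsub).integral_deriv_eq_sub, intervalIntegral.integral_of_le ht.1,
    integral_Ioc_eq_integral_Ioo]
  refine integral_congr_ae ?_
  filter_upwards [ae_restrict_of_ae_restrict_of_subset (Ioo_subset_Ioo_right ht.2) h] with s hs
  exact hs.deriv.symm

/-- Test functions of time that need not vanish at time `0`. -/
def IsTimeTest (T : ℝ) (χ : ℝ → ℝ) : Prop :=
  ContDiff ℝ ∞ χ ∧ ∃ b < T, ∀ t, b ≤ t → χ t = 0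

/-- The lemma of du Bois-Reymond, with initial value. -/
lemma ae_eq_add_prim (hT : 0 < T) (hf : IntegrableOn f (Ioo 0 T)) (hg : IntegrableOn g (Ioo 0 T))
    {f0 : ℝ} (h : ∀ χ, IsTimeTest T χ →
      (∫ t in Ioo 0 T, (f t * deriv χ t + g t * χ t)) + f0 * χ 0 = 0) :
    ∀ᵐ t ∂(volume.restrict (Ioo 0 T)), f t = f0 + prim T g t := by
  set P := prim T g with hP
  have hPc := continuous_prim hg
  have hPi : IntegrableOn P (Ioo 0 T) :=
    (hPc.continuousOn.integrableOn_Icc (a := 0) (b := T)).mono_set Ioo_subset_Icc_self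
  have hci : IntegrableOn (fun _ : ℝ => f0) (Ioo 0 T) := by simp
  have hdi : IntegrableOn (fun t => f t - (f0 + P t)) (Ioo 0 T) := hf.sub (hci.add hPi)
  have key := isOpen_Ioo.ae_eq_zero_of_integral_contDiff_smul_eq_zero (μ := volume)
    hdi.locallyIntegrableOn fun ψ hψ hψc hψs => ?_
  · rw [ae_restrict_iff' measurableSet_Ioo]
    filter_upwards [key] with t ht hmem
    linarith [ht hmem]
  -- the primitive `χ` of `ψ` that vanishes near `T` is an admissible test function
  obtain ⟨b, hbT, hb⟩ : ∃ b < T, ∀ t, b ≤ t → t < T → ψ t = 0 := by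
    rcases (tsupport ψ).eq_empty_or_nonempty with he | hne
    · exact ⟨0, hT, fun t _ _ => image_eq_zero_of_notMem_tsupport (by simp [he])⟩
    · obtain ⟨m, hm, hmax⟩ := hψc.isCompact.exists_isMaxOn hne continuous_id.continuousOn
      refine ⟨(m + T) / 2, by linarith [(hψs hm).2], fun t ht _ => ?_⟩
      refine image_eq_zero_of_notMem_tsupport fun hmem => ?_
      have h1 : t ≤ m := hmax hmem
      linarith [(hψs hm).2]
  have hout : ∀ t, t ∉ Ioo 0 T → ψ t = 0 := fun t ht =>
    image_eq_zero_of_notMem_tsupport fun hmem => ht (hψs hmem)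
  have hψcont := hψ.continuous
  set χ : ℝ → ℝ := fun t => ∫ s in T..t, ψ s with hχ
  have hd : ∀ t, HasDerivAt χ (ψ t) t := fun t =>
    intervalIntegral.integral_hasDerivAt_right (hψcont.intervalIntegrable _ _)
      (hψcont.stronglyMeasurableAtFilter _ _) hψcont.continuousAt
  have hderiv : deriv χ = ψ := funext fun t => (hd t).deriv
  have hχd : Differentiable ℝ χ := fun t => (hd t).differentiableAt
  have hχs : ContDiff ℝ ∞ χ := contDiff_infty_iff_deriv.2 ⟨hχd, by rw [hderiv]; exact hψ⟩
  have hχ0 : ∀ t, b ≤ t → χ t = 0 := fun t ht => by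
    rw [hχ]
    refine intervalIntegral.integral_zero_ae (Eventually.of_forall fun s hs => ?_)
    by_cases hsT : s < T
    · refine hb s ?_ hsT
      rcases mem_uIoc.1 hs with h1 | h1
      · linarith [h1.1]
      · linarith [h1.1]
    · exact hout s fun hmem => hsT hmem.2
  have hχc := hχd.continuous
  have h1 := h χ ⟨hχs, b, hbT, hχ0⟩
  have hbdd : ∀ φ : ℝ → ℝ, Continuous φ → ∀ k : ℝ → ℝ, IntegrableOn k (Ioo 0 T) →
      IntegrableOn (fun t => k t * φ t) (Ioo 0 T) := fun φ hφ k hk => by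
    obtain ⟨C, hC⟩ := (isCompact_Icc (a := (0 : ℝ)) (b := T)).exists_bound_of_continuousOn
      hφ.continuousOn
    refine hk.mul_bdd (c := C) hφ.aestronglyMeasurable ?_
    exact (ae_restrict_iff' measurableSet_Ioo).2 (Eventually.of_forall fun t ht =>
      hC t (Ioo_subset_Icc_self ht))
  rw [hderiv, integral_add (hbdd ψ hψcont f hf) (hbdd χ hχc g hg)] at h1
  -- integration by parts for the absolutely continuous function `P χ`
  have hAC : AbsolutelyContinuousOnInterval (fun t => P t * χ t) 0 T :=
    (absolutelyContinuous_prim hg).fun_mul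
      ((hχs.of_le (by simp)).contDiffOn.absolutelyContinuousOnInterval)
  have h2 := integral_eq_sub_of_ae_hasDerivAt (T := T) (F' := fun t => g t * χ t + P t * ψ t)
    (right_mem_Icc.2 hT.le) hAC (by
      filter_upwards [ae_hasDerivAt_prim hg] with t ht
      exact ht.mul (hd t))
  have hT0 : χ T = 0 := by simp [hχ]
  rw [integral_add (hbdd χ hχc g hg) (hbdd ψ hψcont P hPi), hT0, hP, prim_zero] at h2
  have h3 : ∫ t in Ioo 0 T, ψ t = -χ 0 := by
    have := intervalIntegral.integral_eq_sub_of_hasDerivAt (a := 0) (b := T) (fun t _ => hd t)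
      (hψcont.intervalIntegrable _ _)
    rw [hT0, zero_sub, intervalIntegral.integral_of_le hT.le, integral_Ioc_eq_integral_Ioo] at this
    exact this
  have h4 : ∫ t, ψ t • (f t - (f0 + P t)) =
      (∫ t in Ioo 0 T, f t * ψ t) - f0 * (∫ t in Ioo 0 T, ψ t) - ∫ t in Ioo 0 T, P t * ψ t := by
    have hψi : IntegrableOn ψ (Ioo 0 T) := by
      simpa using hbdd ψ hψcont (fun _ => 1) (by simp)
    rw [← integral_const_mul, ← integral_sub (hbdd ψ hψcont f hf) (hψi.const_mul f0),
      ← integral_sub (f := fun t => f t * ψ t - f0 * ψ t)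
        ((hbdd ψ hψcont f hf).sub (hψi.const_mul f0)) (hbdd ψ hψcont P hPi),
      ← setIntegral_eq_integral_of_forall_compl_eq_zero (s := Ioo 0 T)]
    · congr 1
      funext t
      simp only [smul_eq_mul]
      ring
    · intro t ht
      simp [hout t ht]
  rw [h4, h3]
  linarith

/-- A closed condition that holds at almost every time in `(0, T)` holds on `[0, T]`. -/
lemma forall_mem_Icc_of_ae {p : ℝ → Prop} (hT : 0 < T) (hp : IsClosed {t | p t})
    (h : ∀ᵐ t ∂(volume.restrict (Ioo 0 T)), p t) : ∀ t ∈ Icc 0 T, p t := by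
  have h1 : Ioo 0 T ⊆ {t | p t} := fun t ht => by
    by_contra hc
    have hopen : IsOpen (Ioo 0 T ∩ {t | p t}ᶜ) := isOpen_Ioo.inter hp.isOpen_compl
    have hpos := hopen.measure_pos volume ⟨t, ht, hc⟩
    rw [ae_restrict_iff' measurableSet_Ioo, ae_iff] at h
    refine hpos.ne' (le_antisymm (le_trans (measure_mono fun s hs => ?_) h.le) (by simp))
    simpa [and_assoc] using hs
  rw [← closure_Ioo hT.ne]
  exact closure_minimal h1 hp

end Time

/-! ### Mollified balance laws -/

/-- The balance law `∂_t f + div F = 0` on `(0,T) × 𝕋^d` with initial value `f0`, in the weak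
form. -/
structure BalanceLaw (T : ℝ) (f : ℝ → Torus d → ℝ) (f0 : Torus d → ℝ)
    (F : Fin d → ℝ → Torus d → ℝ) : Prop where
  int : Integrable (fun z : ℝ × Torus d => f z.1 z.2) (cylinder d T)
  int_flux : ∀ j, Integrable (fun z : ℝ × Torus d => F j z.1 z.2) (cylinder d T)
  int_init : Integrable f0
  weak : ∀ φ : ℝ → Torus d → ℝ, IsTestInitial T φ →
    (∫ t in Ioo 0 T, ∫ x, (f t x * deriv (fun s => φ s x) t + ∑ j, F j t x * pderiv j (φ t) x))
      + ∫ x, f0 x * φ 0 x = 0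

/-- The time derivative of the mollification of a quantity with flux `F`. -/
def smoothRate (n : ℕ) (F : Fin d → ℝ → Torus d → ℝ) (t : ℝ) (x : Torus d) : ℝ :=
  -∑ j, mollD n j (F j t) x

/-- The mollification of a quantity with initial value `f0` and flux `F`, in the representative
that is continuous in time. -/
def smoothVal (T : ℝ) (n : ℕ) (f0 : Torus d → ℝ) (F : Fin d → ℝ → Torus d → ℝ) (t : ℝ)
    (x : Torus d) : ℝ :=
  moll n f0 x + prim T (fun s => smoothRate n F s x) t

section Cylinder

variable {T : ℝ} {f : ℝ → Torus d → ℝ} {k : Torus d → ℝ}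

instance : IsFiniteMeasure (volume.restrict (Ioo (0 : ℝ) T)) :=
  ⟨by simp⟩

instance : IsFiniteMeasure (cylinder d T) := by
  unfold cylinder
  infer_instance

lemma ae_cylinder_of_ae {p : ℝ → Prop} (h : ∀ᵐ t ∂(volume.restrict (Ioo 0 T)), p t) :
    ∀ᵐ z ∂(cylinder d T), p z.1 :=
  Measure.quasiMeasurePreserving_fst.ae h

lemma ae_ae_of_ae_cylinder {p : ℝ × Torus d → Prop} (h : ∀ᵐ z ∂(cylinder d T), p z) :
    ∀ᵐ t ∂(volume.restrict (Ioo 0 T)), ∀ᵐ x, p (t, x) :=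
  Measure.ae_ae_of_ae_prod h

lemma ae_integrable_slice (hf : Integrable (fun z : ℝ × Torus d => f z.1 z.2) (cylinder d T)) :
    ∀ᵐ t ∂(volume.restrict (Ioo 0 T)), Integrable (f t) :=
  hf.prod_right_ae

lemma aestronglyMeasurable_cv
    (hf : AEStronglyMeasurable (fun z : ℝ × Torus d => f z.1 z.2) (cylinder d T))
    (hk : Continuous k) :
    AEStronglyMeasurable (fun z : ℝ × Torus d => cv k (f z.1) z.2) (cylinder d T) := by
  have hq : Measure.QuasiMeasurePreserving (Prod.map Prod.fst id : (ℝ × Torus d) × Torus d → _)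
      ((cylinder d T).prod volume) ((volume.restrict (Ioo 0 T)).prod volume) :=
    MeasureTheory.QuasiMeasurePreserving.prodMap Measure.quasiMeasurePreserving_fst
      (Measure.QuasiMeasurePreserving.id _)
  have h1 : AEStronglyMeasurable (fun q : (ℝ × Torus d) × Torus d =>
      f q.1.1 q.2 * k (q.1.2 - q.2)) ((cylinder d T).prod volume) :=
    (hf.comp_quasiMeasurePreserving hq).mul (Continuous.aestronglyMeasurable (by fun_prop))
  exact h1.integral_prod_right'

lemma integrable_cv_cylinder
    (hf : Integrable (fun z : ℝ × Torus d => f z.1 z.2) (cylinder d T)) (hk : Continuous k) :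
    Integrable (fun z : ℝ × Torus d => cv k (f z.1) z.2) (cylinder d T) := by
  obtain ⟨C, -, hC⟩ := exists_bound_of_continuous hk
  have h1 : Integrable (fun z : ℝ × Torus d => C * ∫ y, |f z.1 y|) (cylinder d T) :=
    ((hf.abs.integral_prod_left).const_mul C).comp_fst _
  refine h1.mono' (aestronglyMeasurable_cv hf.1 hk) ?_
  filter_upwards [ae_cylinder_of_ae (ae_integrable_slice hf)] with z hz
  exact abs_cv_le hC hz _

lemma integrable_cv_time
    (hf : Integrable (fun z : ℝ × Torus d => f z.1 z.2) (cylinder d T)) (hk : Continuous k)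
    (x : Torus d) : IntegrableOn (fun s => cv k (f s) x) (Ioo 0 T) := by
  obtain ⟨C, -, hC⟩ := exists_bound_of_continuous hk
  have h1 : AEStronglyMeasurable (fun z : ℝ × Torus d => f z.1 z.2 * k (x - z.2))
      (cylinder d T) := hf.1.mul (Continuous.aestronglyMeasurable (by fun_prop))
  refine ((hf.abs.integral_prod_left).const_mul C).mono' h1.integral_prod_right' ?_
  filter_upwards [ae_integrable_slice hf] with z hz
  exact abs_cv_le hC hz _

/-- A function with continuous slices whose absolute values are dominated by an integrable function
of time has a jointly continuous primitive in time. -/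
lemma continuous_prim_uncurry {g : ℝ → Torus d → ℝ} {h : ℝ → ℝ}
    (hg : ∀ x, IntegrableOn (fun s => g s x) (Ioo 0 T)) (hh : IntegrableOn h (Ioo 0 T))
    (hle : ∀ᵐ s ∂(volume.restrict (Ioo 0 T)), ∀ x, |g s x| ≤ h s)
    (hc : ∀ᵐ s ∂(volume.restrict (Ioo 0 T)), Continuous (g s)) :
    Continuous fun z : Torus d × ℝ => prim T (fun s => g s z.1) z.2 := by
  rw [continuous_iff_continuousAt]
  rintro ⟨x, t⟩
  have hres : ∀ {p : ℝ → Prop}, (∀ᵐ s ∂(volume.restrict (Ioo 0 T)), p s) →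
      ∀ᵐ s ∂(volume : Measure ℝ), s ∈ Ioo 0 T → p s := fun {p} hp =>
    (ae_restrict_iff' measurableSet_Ioo).1 hp
  refine intervalIntegral.continuousAt_parametric_primitive_of_dominated
    (F := fun x s => (Ioo 0 T).indicator (fun s => g s x) s)
    ((Ioo 0 T).indicator h) (-|t| - 1) (|t| + 1)
    (fun x => (integrable_indicator_Ioo (hg x)).1.restrict) ?_
    (integrable_indicator_Ioo hh).intervalIntegrable ?_ ?_ ?_ (by simp)
  · refine Eventually.of_forall fun y => ae_restrict_of_ae ?_
    filter_upwards [hres hle] with s hs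
    by_cases hmem : s ∈ Ioo 0 T
    · simpa [indicator_of_mem hmem] using hs hmem y
    · simp [indicator_of_notMem hmem]
  · refine ae_restrict_of_ae ?_
    filter_upwards [hres hc] with s hs
    by_cases hmem : s ∈ Ioo 0 T
    · simpa [indicator_of_mem hmem] using (hs hmem).continuousAt
    · simpa [indicator_of_notMem hmem] using continuousAt_const
  · constructor <;> linarith [abs_nonneg t]
  · constructor
    · linarith [neg_abs_le t]
    · linarith [le_abs_self t]

end Cylinder

namespace BalanceLaw

variable {T : ℝ} {f : ℝ → Torus d → ℝ} {f0 : Torus d → ℝ} {F : Fin d → ℝ → Torus d → ℝ}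

/-- The balance law integrated in time against a fixed function of space. -/
lemma ae_integral_eq (hT : 0 < T) (h : BalanceLaw T f f0 F) {ψ : Torus d → ℝ}
    (hψ : SmoothSpace ψ) : ∀ᵐ t ∂(volume.restrict (Ioo 0 T)),
      ∫ x, f t x * ψ x =
        (∫ x, f0 x * ψ x) + prim T (fun s => ∑ j, ∫ x, F j s x * pderiv j ψ x) t := by
  have hψc := hψ.continuous
  have hpc := hψ.continuous_pderiv
  have hbdd : ∀ φ : Torus d → ℝ, Continuous φ → ∀ k : ℝ → Torus d → ℝ,
      Integrable (fun z : ℝ × Torus d => k z.1 z.2) (cylinder d T) →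
      Integrable (fun z : ℝ × Torus d => k z.1 z.2 * φ z.2) (cylinder d T) := fun φ hφ k hk => by
    obtain ⟨C, -, hC⟩ := exists_bound_of_continuous hφ
    exact hk.mul_bdd (c := C) (Continuous.aestronglyMeasurable (by fun_prop))
      (Eventually.of_forall fun z => hC _)
  have hf1 := hbdd ψ hψc f h.int
  have hF1 := fun j => hbdd (pderiv j ψ) (hpc j) (F j) (h.int_flux j)
  refine ae_eq_add_prim hT hf1.integral_prod_left
    (integrable_finsetSum _ fun j _ => (hF1 j).integral_prod_left) fun χ hχ => ?_
  obtain ⟨hχs, b, hb, hχ0⟩ := hχ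
  have hχd : Differentiable ℝ χ := hχs.differentiable (by simp)
  have htest : IsTestInitial T (fun t (x : Torus d) => χ t * ψ x) := by
    refine ⟨?_, b, hb, fun t ht x => by simp [hχ0 t ht]⟩
    exact ContDiff.mul (hχs.comp contDiff_fst)
      (ContDiff.comp (g := fun y : Fin d → ℝ => ψ (proj y)) hψ contDiff_snd)
  have h1 := h.weak _ htest
  refine Eq.trans ?_ h1
  congr 1
  · refine integral_congr_ae ?_
    filter_upwards [hf1.prod_right_ae, ae_all_iff.2 fun j => (hF1 j).prod_right_ae] with t ht1 ht2
    have e1 : ∀ x, deriv (fun s => χ s * ψ x) t = deriv χ t * ψ x := fun x =>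
      deriv_mul_const (hχd t) _
    have e2 : ∀ j x, pderiv j (fun x => χ t * ψ x) x = χ t * pderiv j ψ x := fun j x =>
      deriv_const_mul_field _
    simp only [e1, e2]
    have e3 : ∀ x, f t x * (deriv χ t * ψ x) + ∑ j, F j t x * (χ t * pderiv j ψ x) =
        deriv χ t * (f t x * ψ x) + χ t * ∑ j, F j t x * pderiv j ψ x := fun x => by
      rw [Finset.mul_sum]
      congr 1
      · ring
      · exact Finset.sum_congr rfl fun j _ => by ring
    simp only [e3]
    rw [integral_add (ht1.const_mul _) ((integrable_finsetSum _ fun j _ => ht2 j).const_mul _),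
      integral_const_mul, integral_const_mul, integral_finsetSum _ fun j _ => ht2 j]
    ring
  · rw [← integral_mul_const]
    congr 1
    funext x
    ring

lemma integrable_smoothRate_time (h : BalanceLaw T f f0 F) (n : ℕ) (x : Torus d) :
    IntegrableOn (fun s => smoothRate n F s x) (Ioo 0 T) :=
  (integrable_finsetSum _ fun j _ =>
    integrable_cv_time (h.int_flux j) continuous_pderiv_kern x).neg

lemma integrable_smoothRate (h : BalanceLaw T f f0 F) (n : ℕ) :
    Integrable (fun z : ℝ × Torus d => smoothRate n F z.1 z.2) (cylinder d T) :=
  (integrable_finsetSum _ fun j _ =>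
    integrable_cv_cylinder (h.int_flux j) continuous_pderiv_kern).neg

/-- The mollified quantity is continuous in time and space. -/
lemma continuous_smoothVal (h : BalanceLaw T f f0 F) (n : ℕ) :
    Continuous fun z : Torus d × ℝ => smoothVal T n f0 F z.2 z.1 := by
  refine ((continuous_moll h.int_init).comp continuous_fst).add ?_
  choose C hC0 hC using fun j => exists_bound_of_continuous
    (continuous_pderiv_kern (d := d) (n := n) (j := j))
  have hall : ∀ᵐ s ∂(volume.restrict (Ioo 0 T)), ∀ j, Integrable (F j s) :=
    ae_all_iff.2 fun j => ae_integrable_slice (h.int_flux j)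
  refine continuous_prim_uncurry (h := fun s => ∑ j, C j * ∫ y, |F j s y|)
    (h.integrable_smoothRate_time n)
    (integrable_finsetSum _ fun j _ => ((h.int_flux j).abs.integral_prod_left).const_mul _) ?_ ?_
  · filter_upwards [hall] with s hs x
    rw [smoothRate, abs_neg]
    exact (Finset.abs_sum_le_sum_abs _ _).trans (Finset.sum_le_sum fun j _ =>
      abs_cv_le (hC j) (hs j) x)
  · filter_upwards [hall] with s hs
    exact (continuous_finsetSum _ fun j _ => continuous_mollD (hs j)).neg

lemma smoothVal_zero (n : ℕ) (x : Torus d) : smoothVal T n f0 F 0 x = moll n f0 x := by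
  simp [smoothVal, prim_zero]

/-- At almost every time, the continuous representative is the mollification of the slice. -/
lemma ae_smoothVal_eq (hT : 0 < T) (h : BalanceLaw T f f0 F) (n : ℕ) :
    ∀ᵐ t ∂(volume.restrict (Ioo 0 T)), ∀ x, smoothVal T n f0 F t x = moll n (f t) x := by
  have h1 : ∀ x, ∀ᵐ t ∂(volume.restrict (Ioo 0 T)),
      moll n (f t) x = smoothVal T n f0 F t x := fun x => by
    have := h.ae_integral_eq hT (smoothSpace_kern.comp_sub_left (ψ := (kern n : Torus d → ℝ)) x)
    simp only [smoothSpace_kern.pderiv_comp_sub_left, mul_neg, integral_neg,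
      Finset.sum_neg_distrib] at this
    exact this
  have h2 : ∀ᵐ t ∂(volume.restrict (Ioo 0 T)), ∀ i : ℕ,
      moll n (f t) (TopologicalSpace.denseSeq (Torus d) i) =
        smoothVal T n f0 F t (TopologicalSpace.denseSeq (Torus d) i) :=
    ae_all_iff.2 fun i => h1 _
  filter_upwards [h2, ae_integrable_slice h.int] with t ht hti x
  have hc1 : Continuous fun x => smoothVal T n f0 F t x :=
    (h.continuous_smoothVal n).comp (continuous_id.prodMk continuous_const)
  have := Continuous.ext_on (TopologicalSpace.denseRange_denseSeq (Torus d)) hc1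
    (continuous_moll hti) (by rintro _ ⟨i, rfl⟩; exact (ht i).symm)
  exact congrFun this x

lemma le_smoothVal (hT : 0 < T) (h : BalanceLaw T f f0 F) {c : ℝ}
    (hc : ∀ᵐ t ∂(volume.restrict (Ioo 0 T)), ∀ᵐ x, c ≤ f t x) (n : ℕ) (t : ℝ)
    (ht : t ∈ Icc 0 T) (x : Torus d) : c ≤ smoothVal T n f0 F t x := by
  refine forall_mem_Icc_of_ae hT (p := fun t => c ≤ smoothVal T n f0 F t x) ?_ ?_ t ht
  · exact isClosed_le continuous_const
      ((h.continuous_smoothVal n).comp (continuous_const.prodMk continuous_id))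
  · filter_upwards [hc, h.ae_smoothVal_eq hT n, ae_integrable_slice h.int] with s hs1 hs2 hs3
    rw [hs2]
    exact le_moll hs3 hs1 x

/-- Mollifying twice: the order of the two scales is irrelevant. -/
lemma moll_smoothVal_comm (hT : 0 < T) (h : BalanceLaw T f f0 F) (n m : ℕ) (t : ℝ)
    (ht : t ∈ Icc 0 T) (x : Torus d) :
    moll m (smoothVal T n f0 F t) x = moll n (smoothVal T m f0 F t) x := by
  have hcont : ∀ n m, Continuous fun t => moll m (smoothVal T n f0 F t) x := fun n m => by
    have hk := continuous_kern (d := d) (n := m)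
    have hc := h.continuous_smoothVal n
    refine continuous_parametric_integral_of_continuous (s := univ) (μ := volume)
      (f := fun t y => smoothVal T n f0 F t y * kern m (x - y)) ?_ isCompact_univ |>.congr
      fun t => by simp [moll, cv]
    exact (hc.comp (continuous_snd.prodMk continuous_fst)).mul (by fun_prop)
  refine forall_mem_Icc_of_ae hT
    (p := fun t => moll m (smoothVal T n f0 F t) x = moll n (smoothVal T m f0 F t) x)
    (isClosed_eq (hcont n m) (hcont m n)) ?_ t ht
  filter_upwards [h.ae_smoothVal_eq hT n, h.ae_smoothVal_eq hT m, ae_integrable_slice h.int]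
    with s hs1 hs2 hs3
  rw [show smoothVal T n f0 F s = moll n (f s) from funext hs1,
    show smoothVal T m f0 F s = moll m (f s) from funext hs2]
  exact congrFun (cv_comm continuous_kern continuous_kern hs3) x

end BalanceLaw

/-! ### The mollified energy balance at a fixed time -/

/-- The entry `(i, j)` of the viscous stress tensor `μ ∇v + (μ + lam) (div v) I`. -/
def stress (μ lam : ℝ) (A : Grad d) (i j : Fin d) : ℝ :=
  μ * A (i, j) + if i = j then (μ + lam) * divergence A else 0

/-- The entry `(i, j)` of the momentum flux `ϱ v ⊗ v + ϱ^γ I - S`. -/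
def momFlux (γ μ lam ρ : ℝ) (w : Vec d) (A : Grad d) (i j : Fin d) : ℝ :=
  ρ * w i * w j + (if i = j then ρ ^ γ else 0) - stress μ lam A i j

/-- The contraction of stress and gradient is the dissipation density. -/
lemma sum_stress_mul (μ lam : ℝ) (A : Grad d) :
    ∑ i, ∑ j, stress μ lam A i j * A (i, j) =
      μ * ‖A‖ ^ 2 + (μ + lam) * divergence A ^ 2 := by
  have h1 : ‖A‖ ^ 2 = ∑ i, ∑ j, A (i, j) ^ 2 := by
    rw [EuclideanSpace.norm_sq_eq, ← Finset.univ_product_univ, Finset.sum_product]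
    simp
  have h2 : ∀ i j, stress μ lam A i j * A (i, j) =
      μ * A (i, j) ^ 2 + if i = j then (μ + lam) * divergence A * A (i, j) else 0 := fun i j => by
    unfold stress
    split_ifs <;> ring
  simp only [h1, h2, Finset.sum_add_distrib, Finset.sum_ite_eq, Finset.mem_univ, if_true,
    ← Finset.mul_sum]
  congr 1
  rw [← divergence]
  ring

section FixedTime

variable {γ c r s g μ lam : ℝ} {ρ : Torus d → ℝ} {v : Torus d → Vec d} {G : Torus d → Grad d}

/-- The slices of density, velocity and velocity gradient lie in the Lebesgue spaces with
reciprocal exponents `r`, `s` and `g`. -/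
def IsSlice (c r s g : ℝ) (ρ : Torus d → ℝ) (v : Torus d → Vec d) (G : Torus d → Grad d) : Prop :=
  ∀ i, Slice c r s g ρ (fun x => v x i) (fun j x => G x (i, j))

/-- The sum of the norms of the velocity components. -/
def velNrm (s : ℝ) (v : Torus d → Vec d) : ENNReal := ∑ i, nrm s (fun x => v x i)

/-- The sum of the norms of the entries of the gradient. -/
def gradNrm (g : ℝ) (G : Torus d → Grad d) : ENNReal := ∑ i, ∑ j, nrm g (fun x => G x (i, j))

lemma nrm_le_velNrm (i : Fin d) : nrm s (fun x => v x i) ≤ velNrm s v :=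
  Finset.single_le_sum (f := fun i => nrm s (fun x => v x i)) (fun _ _ => by simp)
    (Finset.mem_univ i)

lemma sum_nrm_le_gradNrm (i : Fin d) : ∑ j, nrm g (fun x => G x (i, j)) ≤ gradNrm g G :=
  Finset.single_le_sum (f := fun i => ∑ j, nrm g (fun x => G x (i, j))) (fun _ _ => by simp)
    (Finset.mem_univ i)

lemma nrm_const_mul (a : ℝ) (f : Torus d → ℝ) : nrm g (fun x => a * f x) ≤ ‖a‖ₑ * nrm g f :=
  eLpNorm_const_smul_le (c := a) (f := f)

lemma aestronglyMeasurable_stress (h : IsSlice c r s g ρ v G) (i j : Fin d) :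
    AEStronglyMeasurable (fun x => stress μ lam (G x) i j) volume := by
  unfold stress divergence
  refine (((h i).G_meas j).const_mul μ).add ?_
  split_ifs
  · exact (Finset.aestronglyMeasurable_fun_sum _ fun k _ => (h k).G_meas k).const_mul _
  · exact aestronglyMeasurable_const

lemma nrm_stress_le (e : ExpRel γ r s g) (h : IsSlice c r s g ρ v G) (i j : Fin d) :
    nrm g (fun x => stress μ lam (G x) i j) ≤ (‖μ‖ₑ + ‖μ + lam‖ₑ) * gradNrm g G := by
  have hg1 : g ≤ 1 := by linarith [e.convective, e.r_pos, e.s_pos, e.g_pos]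
  have hdm : AEStronglyMeasurable (fun x => divergence (G x)) volume := by
    unfold divergence
    exact Finset.aestronglyMeasurable_fun_sum _ fun k _ => (h k).G_meas k
  have hij : ∀ i j, nrm g (fun x => G x (i, j)) ≤ gradNrm g G := fun i j =>
    (Finset.single_le_sum (f := fun j => nrm g (fun x => G x (i, j))) (fun _ _ => by simp)
      (Finset.mem_univ j)).trans (sum_nrm_le_gradNrm i)
  have hdiv : nrm g (fun x => divergence (G x)) ≤ gradNrm g G := by
    have h1 : nrm g (fun x => divergence (G x)) ≤ ∑ k, nrm g (fun x => G x (k, k)) := by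
      have := eLpNorm_sum_le (μ := volume) (s := Finset.univ) (f := fun k x => G x (k, k))
        (fun k _ => (h k).G_meas k) (one_le_ofReal_inv e.g_pos hg1)
      refine le_trans (le_of_eq ?_) this
      unfold nrm
      congr 1
      funext x
      simp [divergence]
    refine h1.trans (Finset.sum_le_sum fun k _ => ?_)
    exact Finset.single_le_sum (f := fun j => nrm g (fun x => G x (k, j))) (fun _ _ => by simp)
      (Finset.mem_univ k)
  rw [add_mul]
  unfold stress
  split_ifs with hijeq
  · refine (nrm_add_le e.g_pos hg1 (((h i).G_meas j).const_mul μ) (hdm.const_mul _)).trans ?_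
    exact add_le_add ((nrm_const_mul _ _).trans (by gcongr; exact hij i j))
      ((nrm_const_mul _ _).trans (by gcongr))
  · simp only [add_zero]
    exact (nrm_const_mul _ _).trans (le_trans (by gcongr; exact hij i j) le_self_add)

lemma gradNrm_lt (h : IsSlice c r s g ρ v G) : gradNrm g G < ⊤ :=
  ENNReal.sum_lt_top.2 fun i _ => (h i).sum_nrm_lt

lemma nrm_stress_lt (e : ExpRel γ r s g) (h : IsSlice c r s g ρ v G) (i j : Fin d) :
    nrm g (fun x => stress μ lam (G x) i j) < ⊤ :=
  (nrm_stress_le e h i j).trans_lt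
    (ENNReal.mul_lt_top (ENNReal.add_lt_top.2 ⟨enorm_lt_top, enorm_lt_top⟩) (gradNrm_lt h))

lemma integrable_stress (e : ExpRel γ r s g) (h : IsSlice c r s g ρ v G) (i j : Fin d) :
    Integrable fun x => stress μ lam (G x) i j :=
  integrable_of_nrm_lt e.g_pos (by linarith [e.convective, e.r_pos, e.s_pos, e.g_pos])
    (aestronglyMeasurable_stress h i j) (nrm_stress_lt e h i j)

/-- The rate of change of the total energy of the mollified state: the work of the convective
commutator and of the pressure defect, minus the work of the mollified viscous stress. -/
def energyRate (n : ℕ) (γ μ lam : ℝ) (ρ : Torus d → ℝ) (v : Torus d → Vec d)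
    (G : Torus d → Grad d) : ℝ :=
  (∑ i, ∑ j, ∫ x, Slice.convComm n ρ (fun y => v y i) (fun y => v y j) x *
      favreD n j ρ (fun y => v y i) x) +
    (∑ i, ∫ x, Slice.pressDefect n γ ρ x * favreD n i ρ (fun y => v y i) x) -
    ∑ i, ∑ j, ∫ x, moll n (fun y => stress μ lam (G y) i j) x * favreD n j ρ (fun y => v y i) x

/-- As the scale tends to `0`, only the viscous dissipation remains. -/
lemma tendsto_energyRate (e : ExpRel γ r s g) (hc : 0 < c) (h : IsSlice c r s g ρ v G) :
    Tendsto (fun n => energyRate n γ μ lam ρ v G) atTop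
      (𝓝 (-∫ x, (μ * ‖G x‖ ^ 2 + (μ + lam) * divergence (G x) ^ 2))) := by
  have hθ : 0 < 2 * r + 2 * s := by linarith [e.r_pos, e.s_pos]
  have h1 : Tendsto (fun n => ∑ i, ∑ j, ∫ x, Slice.convComm n ρ (fun y => v y i)
      (fun y => v y j) x * favreD n j ρ (fun y => v y i) x) atTop (𝓝 0) := by
    rw [show (0 : ℝ) = ∑ _i : Fin d, ∑ _j : Fin d, (0 : ℝ) by simp]
    refine tendsto_finsetSum _ fun i _ => tendsto_finsetSum _ fun j _ => ?_
    exact (h i).tendsto_integral_mul_favreD e hc hθ (by linarith [e.convective])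
      (fun n => ((h i).continuous_convComm e hc (h j) n).aestronglyMeasurable)
      ((h i).tendsto_nrm_convComm e hc (h j)) j
  have h2 : Tendsto (fun n => ∑ i, ∫ x, Slice.pressDefect n γ ρ x *
      favreD n i ρ (fun y => v y i) x) atTop (𝓝 0) := by
    rw [show (0 : ℝ) = ∑ _i : Fin d, (0 : ℝ) by simp]
    refine tendsto_finsetSum _ fun i _ => ?_
    exact (h i).tendsto_integral_mul_favreD e hc (mul_pos (by linarith [e.one_lt]) e.r_pos)
      (by linarith [e.pressure])
      (fun n => ((h i).continuous_pressDefect e hc n).aestronglyMeasurable)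
      ((h i).tendsto_nrm_pressDefect e hc) i
  have h3 : Tendsto (fun n => ∑ i, ∑ j, ∫ x, moll n (fun y => stress μ lam (G y) i j) x *
      favreD n j ρ (fun y => v y i) x) atTop
      (𝓝 (∑ i, ∑ j, ∫ x, stress μ lam (G x) i j * G x (i, j))) :=
    tendsto_finsetSum _ fun i _ => tendsto_finsetSum _ fun j _ =>
      (h i).tendsto_integral_stress e hc (aestronglyMeasurable_stress h i j)
        (nrm_stress_lt e h i j) j
  have h4 : ∑ i, ∑ j, ∫ x, stress μ lam (G x) i j * G x (i, j) =
      ∫ x, (μ * ‖G x‖ ^ 2 + (μ + lam) * divergence (G x) ^ 2) := by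
    have hint : ∀ i j, Integrable fun x => stress μ lam (G x) i j * G x (i, j) := fun i j => by
      refine ⟨(aestronglyMeasurable_stress h i j).mul ((h i).G_meas j), ?_⟩
      simp only [HasFiniteIntegral, enorm_mul]
      exact (lintegral_mul_le_nrm e.g_pos e.g_pos (by linarith [e.viscous, e.r_pos])
        (aestronglyMeasurable_stress h i j) ((h i).G_meas j)).trans_lt
        (ENNReal.mul_lt_top (nrm_stress_lt e h i j) ((h i).G_lt j))
    simp only [← sum_stress_mul]
    rw [integral_finsetSum _ fun i _ => integrable_finsetSum _ fun j _ => hint i j]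
    congr 1
    funext i
    rw [integral_finsetSum _ fun j _ => hint i j]
  rw [← h4]
  have := (h1.add h2).sub h3
  rw [add_zero, zero_sub] at this
  exact this

/-- The mollified energy rate is controlled by a function of the norms alone. -/
lemma enorm_energyRate_le (e : ExpRel γ r s g) (hc : 0 < c) (h : IsSlice c r s g ρ v G)
    {H : ENNReal} (h1 : nrm r ρ ^ 2 * velNrm s v ^ 2 * gradNrm g G ≤ H)
    (h2 : nrm r ρ ^ 3 * velNrm s v ^ 2 * gradNrm g G ≤ H)
    (h3 : nrm r ρ ^ γ * nrm r ρ * gradNrm g G ≤ H) (h4 : nrm r ρ * gradNrm g G ^ 2 ≤ H) (n : ℕ) :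
    ‖energyRate n γ μ lam ρ v G‖ₑ ≤ favreConst d c * ((d : ENNReal) * d *
      (1 + ENNReal.ofReal c⁻¹) + d * 2 + d * d * (‖μ‖ₑ + ‖μ + lam‖ₑ)) * H := by
  set X := nrm r ρ
  set Y := velNrm s v
  set Z := gradNrm g G
  have hθ : 0 < 2 * r + 2 * s := by linarith [e.r_pos, e.s_pos]
  have b1 : ∀ i j, ‖∫ x, Slice.convComm n ρ (fun y => v y i) (fun y => v y j) x *
      favreD n j ρ (fun y => v y i) x‖ₑ ≤ favreConst d c * (1 + ENNReal.ofReal c⁻¹) * H :=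
    fun i j => by
      refine ((h i).enorm_integral_mul_favreD_le e hc hθ (by linarith [e.convective])
        ((h i).continuous_convComm e hc (h j) n).aestronglyMeasurable n j).trans ?_
      rw [mul_assoc (favreConst d c) (_ + _)]
      refine mul_le_mul_right ?_ _
      calc _ ≤ (X * Y * Y + X * Y * (ENNReal.ofReal c⁻¹ * (X * Y))) * X * Z := by
            have hi := nrm_le_velNrm (s := s) (v := v) i
            have hj := nrm_le_velNrm (s := s) (v := v) j
            have hX : nrm (2 * r + 2 * s) (Slice.convComm n ρ (fun y => v y i)
                (fun y => v y j)) ≤ X * Y * Y + X * Y * (ENNReal.ofReal c⁻¹ * (X * Y)) := by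
              refine ((h i).nrm_convComm_le e hc (h j) n).trans ?_
              gcongr
            have hZ : _ ≤ Z := sum_nrm_le_gradNrm (g := g) (G := G) i
            gcongr
        _ = X ^ 2 * Y ^ 2 * Z + ENNReal.ofReal c⁻¹ * (X ^ 3 * Y ^ 2 * Z) := by ring
        _ ≤ H + ENNReal.ofReal c⁻¹ * H := by gcongr
        _ = _ := by ring
  have b2 : ∀ i, ‖∫ x, Slice.pressDefect n γ ρ x * favreD n i ρ (fun y => v y i) x‖ₑ ≤
      favreConst d c * 2 * H := fun i => by
    refine ((h i).enorm_integral_mul_favreD_le (θ := γ * r) e hc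
      (mul_pos (by linarith [e.one_lt]) e.r_pos)
      (by linarith [e.pressure]) ((h i).continuous_pressDefect e hc n).aestronglyMeasurable
      n i).trans ?_
    rw [mul_assoc (favreConst d c) 2]
    refine mul_le_mul_right ?_ _
    calc _ ≤ 2 * X ^ γ * X * Z := by
          have hX := (h i).nrm_pressDefect_le e hc n
          have hZ : _ ≤ Z := sum_nrm_le_gradNrm (g := g) (G := G) i
          gcongr
      _ = 2 * (X ^ γ * X * Z) := by ring
      _ ≤ 2 * H := by gcongr
  have b3 : ∀ i j, ‖∫ x, moll n (fun y => stress μ lam (G y) i j) x *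
      favreD n j ρ (fun y => v y i) x‖ₑ ≤ favreConst d c * (‖μ‖ₑ + ‖μ + lam‖ₑ) * H :=
    fun i j => by
      refine ((h i).enorm_integral_mul_favreD_le (θ := g) e hc e.g_pos (by linarith [e.viscous])
        (continuous_moll (integrable_stress e h i j)).aestronglyMeasurable n j).trans ?_
      rw [mul_assoc (favreConst d c) (_ + _)]
      refine mul_le_mul_right ?_ _
      calc _ ≤ (‖μ‖ₑ + ‖μ + lam‖ₑ) * Z * X * Z := by
            have hX := (nrm_moll_le e.g_pos (by linarith [e.viscous, e.r_pos, e.g_pos])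
              (aestronglyMeasurable_stress (μ := μ) (lam := lam) h i j) n).trans
              (nrm_stress_le e h i j)
            have hZ : _ ≤ Z := sum_nrm_le_gradNrm (g := g) (G := G) i
            gcongr
        _ = (‖μ‖ₑ + ‖μ + lam‖ₑ) * (X * Z ^ 2) := by ring
        _ ≤ _ := by gcongr
  have hsum : ∀ (a : Fin d → ℝ) (B : ENNReal), (∀ i, ‖a i‖ₑ ≤ B) → ‖∑ i, a i‖ₑ ≤ d * B :=
    fun a B hB => (enorm_sum_le _ _).trans
      ((Finset.sum_le_sum fun i _ => hB i).trans (by simp))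
  unfold energyRate
  refine (enorm_sub_le).trans ((add_le_add ((enorm_add_le _ _).trans
    (add_le_add (hsum _ _ fun i => hsum _ _ (b1 i)) (hsum _ _ b2)))
    (hsum _ _ fun i => hsum _ _ (b3 i))).trans (le_of_eq ?_))
  ring

lemma moll_eq_mul_favre (e : ExpRel γ r s g) (hc : 0 < c) (h : IsSlice c r s g ρ v G) (n : ℕ)
    (i : Fin d) (x : Torus d) :
    moll n (fun y => ρ y * v y i) x = moll n ρ x * favre n ρ (fun y => v y i) x := by
  have := hc.trans_le ((h i).le_moll_rho e n x)
  rw [favre]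
  field_simp

/-- The exact renormalized continuity equation for the mollified density, transported by the Favre
average of the velocity. -/
lemma integral_rpow_mul_mollD (e : ExpRel γ r s g) (hc : 0 < c) (h : IsSlice c r s g ρ v G)
    (n : ℕ) (α : ℝ) (j : Fin d) :
    ∫ x, α * moll n ρ x ^ (α - 1) * mollD n j (fun y => ρ y * v y j) x =
      (α - 1) * ∫ x, moll n ρ x ^ α * favreD n j ρ (fun y => v y j) x := by
  have hj := h j
  have hρ := hj.integrable_rho e
  have hm := hj.integrable_momentum e
  have hpos : ∀ x, 0 < moll n ρ x := fun x => hc.trans_le (hj.le_moll_rho e n x)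
  have hR := hasDirDeriv_moll (n := n) (j := j) hρ
  have hRc := continuous_moll (n := n) hρ
  have hRDc := continuous_mollD (n := n) (j := j) hρ
  have hpc := hj.continuous_rpow_moll e hc n
  have i1 := ((hR.rpow hpos (α - 1)).const_mul α).integral_mul_eq_neg
    (hasDirDeriv_moll (n := n) (j := j) hm)
    (continuous_const.mul (hpc _)) (continuous_moll hm)
    (continuous_const.mul ((continuous_const.mul (hpc _)).mul hRDc)) (continuous_mollD hm)
  have i2 := (hR.rpow hpos α).integral_mul_eq_neg (hj.hasDirDeriv_favre e hc n j)
    (hpc _) (hj.continuous_favre e hc n) ((continuous_const.mul (hpc _)).mul hRDc)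
    (hj.continuous_favreD e hc n j)
  have e1 : ∫ x, α * ((α - 1) * moll n ρ x ^ (α - 1 - 1) * mollD n j ρ x) *
      moll n (fun y => ρ y * v y j) x = (α - 1) * ∫ x, α * moll n ρ x ^ (α - 1) * mollD n j ρ x *
        favre n ρ (fun y => v y j) x := by
    rw [← integral_const_mul]
    congr 1
    funext x
    rw [moll_eq_mul_favre e hc h]
    have : moll n ρ x ^ (α - 1) = moll n ρ x ^ (α - 1 - 1) * moll n ρ x := by
      rw [← Real.rpow_add_one (hpos x).ne']; simp
    rw [this]
    ring
  rw [e1, i2] at i1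
  linarith

/-- The mollified momentum balance tested with the Favre average of the velocity. -/
lemma integral_kinetic_rate (e : ExpRel γ r s g) (hc : 0 < c) (h : IsSlice c r s g ρ v G) (n : ℕ)
    (i j : Fin d) :
    ∫ x, (favre n ρ (fun y => v y i) x *
          (-mollD n j (fun y => momFlux γ μ lam (ρ y) (v y) (G y) i j) x) +
        1 / 2 * favre n ρ (fun y => v y i) x ^ 2 * mollD n j (fun y => ρ y * v y j) x) =
      (∫ x, Slice.convComm n ρ (fun y => v y i) (fun y => v y j) x *
          favreD n j ρ (fun y => v y i) x) +
        (if i = j then ∫ x, moll n (fun y => ρ y ^ γ) x * favreD n j ρ (fun y => v y i) x else 0) -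
        ∫ x, moll n (fun y => stress μ lam (G y) i j) x * favreD n j ρ (fun y => v y i) x := by
  have hi := h i
  have hV := hi.hasDirDeriv_favre e hc n j
  have hVc := hi.continuous_favre e hc n
  have hVDc := hi.continuous_favreD e hc n j
  have hm := (h j).integrable_momentum e
  have hfl := hi.integrable_flux e (h j)
  have hp := hi.integrable_rpow e hc
  have hS : Integrable fun x => stress μ lam (G x) i j := integrable_stress e h i j
  have hp' : Integrable fun x => if i = j then ρ x ^ γ else 0 := by
    split_ifs
    · exact hp
    · simp
  have hF : Integrable fun x => momFlux γ μ lam (ρ x) (v x) (G x) i j := (hfl.add hp').sub hS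
  have hsplit : ∀ x, moll n (fun y => momFlux γ μ lam (ρ y) (v y) (G y) i j) x =
      moll n (fun y => ρ y * v y i * v y j) x + (if i = j then moll n (fun y => ρ y ^ γ) x else 0) -
        moll n (fun y => stress μ lam (G y) i j) x := fun x => by
    have hk := continuous_kern (d := d) (n := n)
    unfold momFlux moll
    rw [cv_sub (f := fun y => ρ y * v y i * v y j + if i = j then ρ y ^ γ else 0)
      hk (hfl.add hp') hS, cv_add hk hfl hp']
    congr 2
    split_ifs
    · rfl
    · simp [cv]
  have i1 := hV.integral_mul_eq_neg (hasDirDeriv_moll (n := n) (j := j) hF) hVc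
    (continuous_moll hF) hVDc (continuous_mollD hF)
  have i2 := (hV.mul hV).integral_mul_eq_neg (hasDirDeriv_moll (n := n) (j := j) hm)
    (hVc.mul hVc) (continuous_moll hm) ((hVDc.mul hVc).add (hVc.mul hVDc)) (continuous_mollD hm)
  have c1 := integrable_of_continuous (hVc.mul (continuous_mollD (n := n) (j := j) hF).neg)
  have c2 := integrable_of_continuous ((continuous_const (y := (1 / 2 : ℝ))).mul (hVc.pow 2) |>.mul
    (continuous_mollD (n := n) (j := j) hm))
  have c3 := integrable_of_continuous ((continuous_moll (n := n) hfl).mul hVDc)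
  have c4 := integrable_of_continuous ((continuous_moll (n := n) hp).mul hVDc)
  have c5 := integrable_of_continuous ((continuous_moll (n := n) hS).mul hVDc)
  have c6 := integrable_of_continuous (((continuous_moll (n := n) hm).mul hVc).mul hVDc)
  have e0 := integral_add c1 c2
  have e1 : ∫ x, favre n ρ (fun y => v y i) x *
      (-mollD n j (fun y => momFlux γ μ lam (ρ y) (v y) (G y) i j) x) =
      ∫ x, favreD n j ρ (fun y => v y i) x *
        moll n (fun y => momFlux γ μ lam (ρ y) (v y) (G y) i j) x := by
    simp only [mul_neg, integral_neg]
    linarith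
  have e2 : ∫ x, 1 / 2 * favre n ρ (fun y => v y i) x ^ 2 * mollD n j (fun y => ρ y * v y j) x =
      -∫ x, moll n (fun y => ρ y * v y j) x * favre n ρ (fun y => v y i) x *
        favreD n j ρ (fun y => v y i) x := by
    have a1 : ∫ x, 1 / 2 * favre n ρ (fun y => v y i) x ^ 2 *
        mollD n j (fun y => ρ y * v y j) x = 1 / 2 * ∫ x, favre n ρ (fun y => v y i) x *
          favre n ρ (fun y => v y i) x * mollD n j (fun y => ρ y * v y j) x := by
      rw [← integral_const_mul]
      congr 1
      funext x
      ring
    have a2 : ∫ x, (favreD n j ρ (fun y => v y i) x * favre n ρ (fun y => v y i) x +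
        favre n ρ (fun y => v y i) x * favreD n j ρ (fun y => v y i) x) *
          moll n (fun y => ρ y * v y j) x = 2 * ∫ x, moll n (fun y => ρ y * v y j) x *
        favre n ρ (fun y => v y i) x * favreD n j ρ (fun y => v y i) x := by
      rw [← integral_const_mul]
      congr 1
      funext x
      ring
    rw [a1]
    linarith
  refine e0.trans ((congrArg₂ (· + ·) e1 e2).trans ?_)
  have e3 : (∫ x, Slice.convComm n ρ (fun y => v y i) (fun y => v y j) x *
      favreD n j ρ (fun y => v y i) x) = (∫ x, moll n (fun y => ρ y * v y i * v y j) x *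
        favreD n j ρ (fun y => v y i) x) - ∫ x, moll n (fun y => ρ y * v y j) x *
        favre n ρ (fun y => v y i) x * favreD n j ρ (fun y => v y i) x := by
    refine Eq.trans ?_ (integral_sub c3 c6)
    congr 1
    funext x
    rw [Slice.convComm]
    ring
  have e4 : ∫ x, favreD n j ρ (fun y => v y i) x *
        moll n (fun y => momFlux γ μ lam (ρ y) (v y) (G y) i j) x =
      (∫ x, moll n (fun y => ρ y * v y i * v y j) x * favreD n j ρ (fun y => v y i) x) +
        (if i = j then ∫ x, moll n (fun y => ρ y ^ γ) x * favreD n j ρ (fun y => v y i) x else 0) -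
        ∫ x, moll n (fun y => stress μ lam (G y) i j) x * favreD n j ρ (fun y => v y i) x := by
    simp only [hsplit]
    by_cases hij : i = j
    · simp only [hij, if_true] at c3 c4 c5 ⊢
      refine Eq.trans ?_ ((integral_sub (c3.add c4) c5).trans
        (congrArg (· - _) (integral_add c3 c4)))
      congr 1
      funext x
      simp only [Pi.add_apply, Pi.mul_apply]
      ring
    · simp only [hij, if_false, add_zero]
      refine Eq.trans ?_ (integral_sub c3 c5)
      congr 1
      funext x
      ring
  rw [e3, e4]
  ring

end FixedTime

/-! ### The energy identity for the mollified state -/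

section Chain

variable {T : ℝ}

lemma cylinder_eq_restrict : cylinder d T =
    ((volume : Measure ℝ).prod (volume : Measure (Torus d))).restrict (Ioo 0 T ×ˢ univ) := by
  rw [cylinder, ← Measure.prod_restrict, Measure.restrict_univ]

lemma integrable_continuousOn_mul {a f : ℝ → Torus d → ℝ}
    (ha : ContinuousOn (fun z : ℝ × Torus d => a z.1 z.2) (Icc 0 T ×ˢ univ))
    (hf : Integrable (fun z : ℝ × Torus d => f z.1 z.2) (cylinder d T)) :
    Integrable (fun z : ℝ × Torus d => a z.1 z.2 * f z.1 z.2) (cylinder d T) := by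
  obtain ⟨C, hC⟩ := (isCompact_Icc.prod isCompact_univ).exists_bound_of_continuousOn ha
  have hsub : Ioo 0 T ×ˢ (univ : Set (Torus d)) ⊆ Icc 0 T ×ˢ univ :=
    prod_mono Ioo_subset_Icc_self subset_rfl
  have hms : MeasurableSet (Ioo 0 T ×ˢ (univ : Set (Torus d))) :=
    measurableSet_Ioo.prod MeasurableSet.univ
  refine hf.bdd_mul (c := C) ?_ ?_
  · rw [cylinder_eq_restrict]
    exact (ha.mono hsub).aestronglyMeasurable hms
  · rw [cylinder_eq_restrict]
    filter_upwards [ae_restrict_mem hms] with z hz using hC z (hsub hz)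

/-- The fundamental theorem of calculus in time, integrated over the torus. -/
lemma integral_sub_eq_integral_deriv {φ φ' : ℝ → Torus d → ℝ}
    (hc : ∀ t ∈ Icc 0 T, Integrable (φ t))
    (hac : ∀ x, AbsolutelyContinuousOnInterval (fun s => φ s x) 0 T)
    (hd : ∀ x, ∀ᵐ s ∂(volume.restrict (Ioo 0 T)), HasDerivAt (fun s => φ s x) (φ' s x) s)
    (hi : Integrable (fun z : ℝ × Torus d => φ' z.1 z.2) (cylinder d T)) {t : ℝ}
    (ht : t ∈ Icc 0 T) : (∫ x, φ t x) - ∫ x, φ 0 x = ∫ s in Ioo 0 t, ∫ x, φ' s x := by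
  have h0 : (0 : ℝ) ∈ Icc 0 T := ⟨le_rfl, ht.1.trans ht.2⟩
  have hit : Integrable (fun z : ℝ × Torus d => φ' z.1 z.2) (cylinder d t) := by
    refine hi.mono_measure ?_
    rw [cylinder_eq_restrict, cylinder_eq_restrict]
    exact Measure.restrict_mono (prod_mono (Ioo_subset_Ioo_right ht.2) subset_rfl) le_rfl
  rw [← integral_sub (hc t ht) (hc 0 h0), integral_integral_swap hit]
  congr 1
  funext x
  exact (integral_eq_sub_of_ae_hasDerivAt ht (hac x) (hd x)).symm

end Chain

/-- A solution for which the work of convection, pressure and viscous stress in the mollified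
energy balance can be dominated: the balance laws, slices in Lebesgue spaces with reciprocal
exponents `r`, `s`, `g`, and an integrable bound in time of the relevant products of norms. -/
structure RegularFlow (γ μ lam T c r s g : ℝ) (rho0 : Torus d → ℝ) (v0 : Torus d → Vec d)
    (rho : ℝ → Torus d → ℝ) (v : ℝ → Torus d → Vec d) (G : ℝ → Torus d → Grad d) : Prop where
  dim_pos : 0 < d
  time_pos : 0 < T
  lower_pos : 0 < c
  exps : ExpRel γ r s g
  mass : BalanceLaw T rho rho0 (fun j t x => rho t x * v t x j)
  momentum : ∀ i, BalanceLaw T (fun t x => rho t x * v t x i) (fun x => rho0 x * v0 x i)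
    (fun j t x => momFlux γ μ lam (rho t x) (v t x) (G t x) i j)
  slice : ∀ᵐ t ∂(volume.restrict (Ioo 0 T)), IsSlice c r s g (rho t) (v t) (G t)
  bound : ∃ h : ℝ → ℝ, IntegrableOn h (Ioo 0 T) ∧ (∀ t, 0 ≤ h t) ∧
    ∀ᵐ t ∂(volume.restrict (Ioo 0 T)),
      nrm r (rho t) ^ 2 * velNrm s (v t) ^ 2 * gradNrm g (G t) ≤ ENNReal.ofReal (h t) ∧
      nrm r (rho t) ^ 3 * velNrm s (v t) ^ 2 * gradNrm g (G t) ≤ ENNReal.ofReal (h t) ∧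
      nrm r (rho t) ^ γ * nrm r (rho t) * gradNrm g (G t) ≤ ENNReal.ofReal (h t) ∧
      nrm r (rho t) * gradNrm g (G t) ^ 2 ≤ ENNReal.ofReal (h t) ∧
      nrm r (rho t) ^ 3 * gradNrm g (G t) ≤ ENNReal.ofReal (h t)
  pressure0 : Integrable fun x => rho0 x ^ γ
  kinetic0 : Integrable fun x => rho0 x * ‖v0 x‖ ^ 2

/-- The total energy of density `R` and momentum `M`. -/
def momEnergy (γ : ℝ) (R : Torus d → ℝ) (M : Fin d → Torus d → ℝ) : ℝ :=
  (∑ i, ∫ x, 1 / 2 * (M i x ^ 2 / R x)) + 1 / (γ - 1) * ∫ x, R x ^ γ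

/-- The balance laws turn the time derivative of the energy into `energyRate`. -/
lemma sum_rate_eq_energyRate {γ c r s g μ lam : ℝ} {ρ : Torus d → ℝ} {v : Torus d → Vec d}
    {G : Torus d → Grad d} (e : ExpRel γ r s g) (hc : 0 < c) (h : IsSlice c r s g ρ v G) (n : ℕ) :
    (∑ i, ∫ x, (favre n ρ (fun y => v y i) x *
        (-∑ j, mollD n j (fun y => momFlux γ μ lam (ρ y) (v y) (G y) i j) x) -
        1 / 2 * favre n ρ (fun y => v y i) x ^ 2 * (-∑ j, mollD n j (fun y => ρ y * v y j) x))) +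
      1 / (γ - 1) * ∫ x, γ * moll n ρ x ^ (γ - 1) * (-∑ j, mollD n j (fun y => ρ y * v y j) x) =
      energyRate n γ μ lam ρ v G := by
  have hγ : γ - 1 ≠ 0 := by linarith [e.one_lt]
  have hV := fun i => (h i).continuous_favre e hc n
  have hVD := fun i j => (h i).continuous_favreD e hc n j
  have hm := fun j => continuous_mollD (n := n) (j := j) ((h j).integrable_momentum e)
  have hF : ∀ i j, Continuous (mollD n j fun y => momFlux γ μ lam (ρ y) (v y) (G y) i j) :=
    fun i j => by
      refine continuous_mollD ?_
      refine Integrable.sub (f := fun y => ρ y * v y i * v y j + if i = j then ρ y ^ γ else 0)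
        (((h i).integrable_flux e (h j)).add ?_) (integrable_stress e h i j)
      split_ifs
      · exact (h i).integrable_rpow e hc
      · simp
  have k1 : ∀ i, ∫ x, (favre n ρ (fun y => v y i) x *
        (-∑ j, mollD n j (fun y => momFlux γ μ lam (ρ y) (v y) (G y) i j) x) -
        1 / 2 * favre n ρ (fun y => v y i) x ^ 2 * (-∑ j, mollD n j (fun y => ρ y * v y j) x)) =
      ∑ j, ((∫ x, Slice.convComm n ρ (fun y => v y i) (fun y => v y j) x *
          favreD n j ρ (fun y => v y i) x) +
        (if i = j then ∫ x, moll n (fun y => ρ y ^ γ) x * favreD n j ρ (fun y => v y i) x else 0) -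
        ∫ x, moll n (fun y => stress μ lam (G y) i j) x * favreD n j ρ (fun y => v y i) x) :=
    fun i => by
      simp only [← integral_kinetic_rate e hc h]
      refine Eq.trans ?_ (integral_finsetSum _ fun j _ => integrable_of_continuous
        (((hV i).mul (hF i j).neg).add
          (((continuous_const (y := (1 / 2 : ℝ))).mul ((hV i).pow 2)).mul (hm j))))
      congr 1
      funext x
      rw [Finset.sum_add_distrib, ← Finset.mul_sum, ← Finset.mul_sum, Finset.sum_neg_distrib]
      ring
  have k2 : 1 / (γ - 1) * ∫ x, γ * moll n ρ x ^ (γ - 1) *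
      (-∑ j, mollD n j (fun y => ρ y * v y j) x) =
      -∑ j, ∫ x, moll n ρ x ^ γ * favreD n j ρ (fun y => v y j) x := by
    have : ∀ j, ∫ x, moll n ρ x ^ γ * favreD n j ρ (fun y => v y j) x = 1 / (γ - 1) *
        ∫ x, γ * moll n ρ x ^ (γ - 1) * mollD n j (fun y => ρ y * v y j) x := fun j => by
      rw [integral_rpow_mul_mollD e hc h]
      field_simp
    simp only [this]
    have hs := integral_finsetSum Finset.univ fun j _ => integrable_of_continuous
      (((continuous_const (y := γ)).mul ((h j).continuous_rpow_moll e hc n (γ - 1))).mul (hm j))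
    simp only [Pi.mul_apply] at hs
    rw [← Finset.mul_sum, ← mul_neg, ← hs, ← integral_neg]
    congr 2
    funext x
    rw [← Finset.mul_sum]
    ring
  have k3 : ∀ i, ∫ x, Slice.pressDefect n γ ρ x * favreD n i ρ (fun y => v y i) x =
      (∫ x, moll n (fun y => ρ y ^ γ) x * favreD n i ρ (fun y => v y i) x) -
        ∫ x, moll n ρ x ^ γ * favreD n i ρ (fun y => v y i) x := fun i => by
    rw [← integral_sub (f := fun x => moll n (fun y => ρ y ^ γ) x * favreD n i ρ (fun y => v y i) x)
      (g := fun x => moll n ρ x ^ γ * favreD n i ρ (fun y => v y i) x)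
      (integrable_of_continuous ((continuous_moll ((h i).integrable_rpow e hc)).mul (hVD i i)))
      (integrable_of_continuous (((h i).continuous_rpow_moll e hc n _).mul (hVD i i)))]
    congr 1
    funext x
    rw [Slice.pressDefect]
    ring
  rw [k2]
  simp only [k1, energyRate, k3, Finset.sum_sub_distrib, Finset.sum_add_distrib,
    Finset.sum_ite_eq, Finset.mem_univ, if_true]
  ring

namespace RegularFlow

variable {γ μ lam T c r s g : ℝ} {rho0 : Torus d → ℝ} {v0 : Torus d → Vec d}
  {rho : ℝ → Torus d → ℝ} {v : ℝ → Torus d → Vec d} {G : ℝ → Torus d → Grad d}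

/-- The mollified density at every time. -/
def dens (T : ℝ) (rho0 : Torus d → ℝ) (rho : ℝ → Torus d → ℝ) (v : ℝ → Torus d → Vec d) (n : ℕ)
    (t : ℝ) (x : Torus d) : ℝ :=
  smoothVal T n rho0 (fun j t x => rho t x * v t x j) t x

/-- The mollified momentum at every time. -/
def mom (γ μ lam T : ℝ) (rho0 : Torus d → ℝ) (v0 : Torus d → Vec d) (rho : ℝ → Torus d → ℝ)
    (v : ℝ → Torus d → Vec d) (G : ℝ → Torus d → Grad d) (n : ℕ) (i : Fin d) (t : ℝ)
    (x : Torus d) : ℝ :=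
  smoothVal T n (fun x => rho0 x * v0 x i)
    (fun j t x => momFlux γ μ lam (rho t x) (v t x) (G t x) i j) t x

lemma ae_lower (H : RegularFlow γ μ lam T c r s g rho0 v0 rho v G) :
    ∀ᵐ t ∂(volume.restrict (Ioo 0 T)), ∀ᵐ x, c ≤ rho t x := by
  filter_upwards [H.slice] with t ht using (ht ⟨0, H.dim_pos⟩).lower

lemma le_dens (H : RegularFlow γ μ lam T c r s g rho0 v0 rho v G) (n : ℕ) {t : ℝ}
    (ht : t ∈ Icc 0 T) (x : Torus d) : c ≤ dens T rho0 rho v n t x :=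
  H.mass.le_smoothVal H.time_pos H.ae_lower n t ht x

lemma dens_pos (H : RegularFlow γ μ lam T c r s g rho0 v0 rho v G) (n : ℕ) {t : ℝ}
    (ht : t ∈ Icc 0 T) (x : Torus d) : 0 < dens T rho0 rho v n t x :=
  H.lower_pos.trans_le (H.le_dens n ht x)

lemma continuous_dens (H : RegularFlow γ μ lam T c r s g rho0 v0 rho v G) (n : ℕ) :
    Continuous fun z : ℝ × Torus d => dens T rho0 rho v n z.1 z.2 :=
  (H.mass.continuous_smoothVal n).comp continuous_swap

lemma continuous_mom (H : RegularFlow γ μ lam T c r s g rho0 v0 rho v G) (n : ℕ) (i : Fin d) :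
    Continuous fun z : ℝ × Torus d => mom γ μ lam T rho0 v0 rho v G n i z.1 z.2 :=
  ((H.momentum i).continuous_smoothVal n).comp continuous_swap

lemma continuous_dens_slice (H : RegularFlow γ μ lam T c r s g rho0 v0 rho v G) (n : ℕ) (t : ℝ) :
    Continuous (dens T rho0 rho v n t) :=
  (H.continuous_dens n).comp (continuous_const.prodMk continuous_id)

lemma continuous_mom_slice (H : RegularFlow γ μ lam T c r s g rho0 v0 rho v G) (n : ℕ) (i : Fin d)
    (t : ℝ) : Continuous (mom γ μ lam T rho0 v0 rho v G n i t) :=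
  (H.continuous_mom n i).comp (continuous_const.prodMk continuous_id)

lemma continuousOn_dens_rpow (H : RegularFlow γ μ lam T c r s g rho0 v0 rho v G) (n : ℕ)
    (a : ℝ) : ContinuousOn (fun z : ℝ × Torus d => dens T rho0 rho v n z.1 z.2 ^ a)
      (Icc 0 T ×ˢ univ) :=
  (H.continuous_dens n).continuousOn.rpow_const fun z hz => Or.inl (H.dens_pos n hz.1 z.2).ne'

lemma continuous_dens_rpow_slice (H : RegularFlow γ μ lam T c r s g rho0 v0 rho v G) (n : ℕ)
    (a : ℝ) {t : ℝ} (ht : t ∈ Icc 0 T) : Continuous fun x => dens T rho0 rho v n t x ^ a :=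
  (H.continuous_dens_slice n t).rpow_const fun x => Or.inl (H.dens_pos n ht x).ne'

lemma continuousOn_mom_div (H : RegularFlow γ μ lam T c r s g rho0 v0 rho v G) (n : ℕ)
    (i : Fin d) : ContinuousOn (fun z : ℝ × Torus d => mom γ μ lam T rho0 v0 rho v G n i z.1 z.2 /
      dens T rho0 rho v n z.1 z.2) (Icc 0 T ×ˢ univ) :=
  (H.continuous_mom n i).continuousOn.div (H.continuous_dens n).continuousOn
    fun z hz => (H.dens_pos n hz.1 z.2).ne'

lemma continuous_mom_div_slice (H : RegularFlow γ μ lam T c r s g rho0 v0 rho v G) (n : ℕ)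
    (i : Fin d) {t : ℝ} (ht : t ∈ Icc 0 T) : Continuous fun x =>
      mom γ μ lam T rho0 v0 rho v G n i t x / dens T rho0 rho v n t x :=
  (H.continuous_mom_slice n i t).div (H.continuous_dens_slice n t)
    fun x => (H.dens_pos n ht x).ne'

lemma absolutelyContinuous_smoothVal {f : ℝ → Torus d → ℝ} {f0 : Torus d → ℝ}
    {F : Fin d → ℝ → Torus d → ℝ} (h : BalanceLaw T f f0 F) (n : ℕ) (x : Torus d) :
    AbsolutelyContinuousOnInterval (fun s => smoothVal T n f0 F s x) 0 T := by
  have h1 := absolutelyContinuous_prim (h.integrable_smoothRate_time n x)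
  have h2 : AbsolutelyContinuousOnInterval (fun _ : ℝ => moll n f0 x) 0 T :=
    (contDiff_const (n := 1)).contDiffOn.absolutelyContinuousOnInterval
  exact h2.add h1

lemma ae_hasDerivAt_smoothVal {f : ℝ → Torus d → ℝ} {f0 : Torus d → ℝ}
    {F : Fin d → ℝ → Torus d → ℝ} (h : BalanceLaw T f f0 F) (n : ℕ) (x : Torus d) :
    ∀ᵐ s ∂(volume.restrict (Ioo 0 T)),
      HasDerivAt (fun s => smoothVal T n f0 F s x) (smoothRate n F s x) s := by
  filter_upwards [ae_hasDerivAt_prim (h.integrable_smoothRate_time n x)] with s hs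
  exact hs.const_add _

lemma absolutelyContinuous_dens_rpow (H : RegularFlow γ μ lam T c r s g rho0 v0 rho v G) (n : ℕ)
    (a : ℝ) (x : Torus d) :
    AbsolutelyContinuousOnInterval (fun s => dens T rho0 rho v n s x ^ a) 0 T := by
  obtain ⟨B, hB⟩ := (isCompact_Icc (a := (0 : ℝ)) (b := T)).exists_bound_of_continuousOn
    ((H.continuous_dens n).comp (continuous_id.prodMk (continuous_const (y := x)))).continuousOn
  refine absolutelyContinuous_comp (φ := fun y => y ^ a) (A := c) (B := B) ?_
    (absolutelyContinuous_smoothVal H.mass n x) ?_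
  · intro y hy
    exact (Real.contDiffAt_rpow_const (Or.inl (H.lower_pos.trans_le hy.1).ne')).contDiffWithinAt
  · intro t ht
    rw [uIcc_of_le H.time_pos.le] at ht
    exact ⟨H.le_dens n ht x, (le_abs_self _).trans (hB t ht)⟩

/-- The evolution of the integral of a power of the mollified density. -/
lemma integral_dens_rpow_sub (H : RegularFlow γ μ lam T c r s g rho0 v0 rho v G) (n : ℕ) (a : ℝ) :
    Integrable (fun z : ℝ × Torus d => a * dens T rho0 rho v n z.1 z.2 ^ (a - 1) *
        smoothRate n (fun j t x => rho t x * v t x j) z.1 z.2) (cylinder d T) ∧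
    ∀ t ∈ Icc 0 T, (∫ x, dens T rho0 rho v n t x ^ a) - ∫ x, dens T rho0 rho v n 0 x ^ a =
      ∫ s in Ioo 0 t, ∫ x, a * dens T rho0 rho v n s x ^ (a - 1) *
        smoothRate n (fun j t x => rho t x * v t x j) s x := by
  have hi : Integrable (fun z : ℝ × Torus d => a * dens T rho0 rho v n z.1 z.2 ^ (a - 1) *
      smoothRate n (fun j t x => rho t x * v t x j) z.1 z.2) (cylinder d T) :=
    integrable_continuousOn_mul (a := fun t x => a * dens T rho0 rho v n t x ^ (a - 1))
      (continuousOn_const.mul (H.continuousOn_dens_rpow n _)) (H.mass.integrable_smoothRate n)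
  refine ⟨hi, fun t ht => integral_sub_eq_integral_deriv
    (φ := fun t x => dens T rho0 rho v n t x ^ a)
    (φ' := fun s x => a * dens T rho0 rho v n s x ^ (a - 1) *
        smoothRate n (fun j t x => rho t x * v t x j) s x)
    (fun t ht => integrable_of_continuous (H.continuous_dens_rpow_slice n a ht))
    (H.absolutelyContinuous_dens_rpow n a) (fun x => ?_) hi ht⟩
  filter_upwards [ae_hasDerivAt_smoothVal H.mass n x,
    ae_restrict_mem measurableSet_Ioo] with s hs hm
  have := hs.rpow_const (p := a) (Or.inl (H.dens_pos n (Ioo_subset_Icc_self hm) x).ne')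
  convert! this using 1
  rw [dens]
  ring

/-- The evolution of the kinetic energy of a component of the mollified momentum. -/
lemma integral_kinetic_sub (H : RegularFlow γ μ lam T c r s g rho0 v0 rho v G) (n : ℕ)
    (i : Fin d) :
    Integrable (fun z : ℝ × Torus d => mom γ μ lam T rho0 v0 rho v G n i z.1 z.2 /
        dens T rho0 rho v n z.1 z.2 * smoothRate n
          (fun j t x => momFlux γ μ lam (rho t x) (v t x) (G t x) i j) z.1 z.2 -
        1 / 2 * (mom γ μ lam T rho0 v0 rho v G n i z.1 z.2 / dens T rho0 rho v n z.1 z.2) ^ 2 *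
          smoothRate n (fun j t x => rho t x * v t x j) z.1 z.2) (cylinder d T) ∧
    ∀ t ∈ Icc 0 T, (∫ x, 1 / 2 * (mom γ μ lam T rho0 v0 rho v G n i t x ^ 2 /
        dens T rho0 rho v n t x)) -
        ∫ x, 1 / 2 * (mom γ μ lam T rho0 v0 rho v G n i 0 x ^ 2 / dens T rho0 rho v n 0 x) =
      ∫ s in Ioo 0 t, ∫ x, (mom γ μ lam T rho0 v0 rho v G n i s x /
        dens T rho0 rho v n s x * smoothRate n
          (fun j t x => momFlux γ μ lam (rho t x) (v t x) (G t x) i j) s x -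
        1 / 2 * (mom γ μ lam T rho0 v0 rho v G n i s x / dens T rho0 rho v n s x) ^ 2 *
          smoothRate n (fun j t x => rho t x * v t x j) s x) := by
  set R := dens T rho0 rho v n with hR
  set M := mom γ μ lam T rho0 v0 rho v G n i with hM
  have hc := H.continuousOn_mom_div n i
  have hi : Integrable (fun z : ℝ × Torus d => M z.1 z.2 / R z.1 z.2 * smoothRate n
          (fun j t x => momFlux γ μ lam (rho t x) (v t x) (G t x) i j) z.1 z.2 -
        1 / 2 * (M z.1 z.2 / R z.1 z.2) ^ 2 *
          smoothRate n (fun j t x => rho t x * v t x j) z.1 z.2) (cylinder d T) :=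
    (integrable_continuousOn_mul (a := fun t x => M t x / R t x) hc
      ((H.momentum i).integrable_smoothRate n)).sub
    (integrable_continuousOn_mul (a := fun t x => 1 / 2 * (M t x / R t x) ^ 2)
      (continuousOn_const.mul (hc.pow 2)) (H.mass.integrable_smoothRate n))
  refine ⟨hi, fun t ht => integral_sub_eq_integral_deriv
    (φ := fun t x => 1 / 2 * (M t x ^ 2 / R t x))
    (φ' := fun s x => M s x / R s x * smoothRate n
          (fun j t x => momFlux γ μ lam (rho t x) (v t x) (G t x) i j) s x -
        1 / 2 * (M s x / R s x) ^ 2 * smoothRate n (fun j t x => rho t x * v t x j) s x)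
    (fun t ht => integrable_of_continuous (continuous_const.mul
      (((H.continuous_mom_slice n i t).pow 2).div (H.continuous_dens_slice n t)
        fun x => (H.dens_pos n ht x).ne'))) (fun x => ?_) (fun x => ?_) hi ht⟩
  · have hm := absolutelyContinuous_smoothVal (H.momentum i) n x
    have h1 := (hm.fun_mul hm).fun_mul (H.absolutelyContinuous_dens_rpow n (-1) x)
    refine Eq.mp ?_ (h1.const_mul (1 / 2))
    congr 1
    funext s
    rw [Real.rpow_neg_one, hM, hR, mom, sq]
    ring
  · filter_upwards [ae_hasDerivAt_smoothVal H.mass n x,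
      ae_hasDerivAt_smoothVal (H.momentum i) n x,
      ae_restrict_mem measurableSet_Ioo] with s hs hs' hm
    have hpos := (H.dens_pos n (Ioo_subset_Icc_self hm) x).ne'
    have := ((hs'.pow 2).div hs hpos).const_mul (1 / 2)
    convert! this using 1
    change M s x / R s x * _ - _ = 1 / 2 * (((2 : ℕ) * M s x ^ (2 - 1) * _ * R s x -
      M s x ^ 2 * _) / R s x ^ 2)
    change R s x ≠ 0 at hpos
    field_simp
    push_cast
    ring

/-- The energy identity for the mollified state. -/
lemma momEnergy_sub (H : RegularFlow γ μ lam T c r s g rho0 v0 rho v G) (n : ℕ) :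
    IntegrableOn (fun s => energyRate n γ μ lam (rho s) (v s) (G s)) (Ioo 0 T) ∧
    ∀ t ∈ Icc 0 T, momEnergy γ (dens T rho0 rho v n t)
        (fun i => mom γ μ lam T rho0 v0 rho v G n i t) -
      momEnergy γ (dens T rho0 rho v n 0) (fun i => mom γ μ lam T rho0 v0 rho v G n i 0) =
      ∫ s in Ioo 0 t, energyRate n γ μ lam (rho s) (v s) (G s) := by
  obtain ⟨i1, e1⟩ := H.integral_dens_rpow_sub n γ
  have i2 := fun i => (H.integral_kinetic_sub n i).1
  have e2 := fun i => (H.integral_kinetic_sub n i).2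
  set R := dens T rho0 rho v n with hR
  set M := mom γ μ lam T rho0 v0 rho v G n with hM
  have hae : ∀ᵐ s ∂(volume.restrict (Ioo 0 T)),
      (∑ i, ∫ x, (M i s x / R s x * smoothRate n
          (fun j t x => momFlux γ μ lam (rho t x) (v t x) (G t x) i j) s x -
        1 / 2 * (M i s x / R s x) ^ 2 * smoothRate n (fun j t x => rho t x * v t x j) s x)) +
      1 / (γ - 1) * ∫ x, γ * R s x ^ (γ - 1) * smoothRate n (fun j t x => rho t x * v t x j) s x =
      energyRate n γ μ lam (rho s) (v s) (G s) := by
    filter_upwards [H.slice, H.mass.ae_smoothVal_eq H.time_pos n,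
      ae_all_iff.2 fun i => (H.momentum i).ae_smoothVal_eq H.time_pos n] with s hs hs1 hs2
    have a1 : ∀ x, R s x = moll n (rho s) x := hs1
    have a2 : ∀ i x, M i s x = moll n (fun y => rho s y * v s y i) x := hs2
    rw [← sum_rate_eq_energyRate H.exps H.lower_pos hs n]
    simp only [a1, a2, favre, smoothRate]
  have hint := (integrable_finsetSum Finset.univ fun i _ => (i2 i).integral_prod_left).add
    (i1.integral_prod_left.const_mul (1 / (γ - 1)))
  refine ⟨hint.congr hae, fun t ht => ?_⟩
  have hsub : Ioo 0 t ⊆ Ioo 0 T := Ioo_subset_Ioo_right ht.2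
  have hmono : (volume : Measure ℝ).restrict (Ioo 0 t) ≤ volume.restrict (Ioo 0 T) :=
    Measure.restrict_mono hsub le_rfl
  rw [← integral_congr_ae (ae_mono hmono hae), integral_add
    (integrable_finsetSum Finset.univ fun i _ => (i2 i).integral_prod_left.mono_measure hmono)
    ((i1.integral_prod_left.const_mul (1 / (γ - 1))).mono_measure hmono),
    integral_finsetSum _ fun i _ => (i2 i).integral_prod_left.mono_measure hmono,
    integral_const_mul, ← e1 t ht]
  simp only [← e2 _ t ht, momEnergy, Finset.sum_sub_distrib]
  ring

/-- The constant in the bound of the energy rates. -/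
def rateConst (d : ℕ) (μ lam c : ℝ) : ENNReal :=
  favreConst d c * ((d : ENNReal) * d *
      (1 + ENNReal.ofReal c⁻¹) + d * 2 + d * d * (‖μ‖ₑ + ‖μ + lam‖ₑ))

lemma rateConst_ne_top : rateConst d μ lam c ≠ ⊤ := by
  unfold rateConst
  refine ENNReal.mul_ne_top favreConst_ne_top ?_
  simp [ENNReal.mul_eq_top, ENNReal.add_eq_top]

/-- The energy rates have an integrable bound that is uniform in the scale. -/
lemma exists_norm_energyRate_le (H : RegularFlow γ μ lam T c r s g rho0 v0 rho v G) :
    ∃ h : ℝ → ℝ, IntegrableOn h (Ioo 0 T) ∧ (∀ t, 0 ≤ h t) ∧ ∀ n,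
      ∀ᵐ s ∂(volume.restrict (Ioo 0 T)), ‖energyRate n γ μ lam (rho s) (v s) (G s)‖ ≤ h s := by
  obtain ⟨h, hh, hh0, hb⟩ := H.bound
  refine ⟨fun s => (rateConst d μ lam c).toReal * h s, hh.const_mul _,
    fun t => mul_nonneg ENNReal.toReal_nonneg (hh0 t), fun n => ?_⟩
  filter_upwards [hb, H.slice] with s hs hsl
  obtain ⟨h1, h2, h3, h4, -⟩ := hs
  have := enorm_energyRate_le (μ := μ) (lam := lam) H.exps H.lower_pos hsl h1 h2 h3 h4 n
  have h5 := ENNReal.toReal_mono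
    (ENNReal.mul_ne_top rateConst_ne_top ENNReal.ofReal_ne_top) this
  rwa [toReal_enorm, ENNReal.toReal_mul, ENNReal.toReal_ofReal (hh0 s)] at h5

/-- The energies of the mollified states are related, in the limit, by the viscous dissipation. -/
lemma tendsto_momEnergy_sub (H : RegularFlow γ μ lam T c r s g rho0 v0 rho v G) {t : ℝ}
    (ht : t ∈ Icc 0 T) : Tendsto (fun n => momEnergy γ (dens T rho0 rho v n t)
        (fun i => mom γ μ lam T rho0 v0 rho v G n i t) -
      momEnergy γ (dens T rho0 rho v n 0) (fun i => mom γ μ lam T rho0 v0 rho v G n i 0)) atTop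
      (𝓝 (-dissipation μ lam G t)) := by
  obtain ⟨h, hh, -, hb⟩ := H.exists_norm_energyRate_le
  have hmono : (volume : Measure ℝ).restrict (Ioo 0 t) ≤ volume.restrict (Ioo 0 T) :=
    Measure.restrict_mono (Ioo_subset_Ioo_right ht.2) le_rfl
  simp only [(H.momEnergy_sub _).2 t ht]
  rw [dissipation, ← integral_neg]
  refine tendsto_integral_of_dominated_convergence h
    (fun n => (Integrable.mono_measure (H.momEnergy_sub n).1 hmono).1)
    (Integrable.mono_measure hh hmono) (fun n => ae_mono hmono (hb n)) (ae_mono hmono ?_)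
  filter_upwards [H.slice] with s hs
  exact tendsto_energyRate H.exps H.lower_pos hs

/-- The energies at time `t` exceed the initial ones by a bounded amount. -/
lemma exists_momEnergy_sub_le (H : RegularFlow γ μ lam T c r s g rho0 v0 rho v G) :
    ∃ C, ∀ n, ∀ t ∈ Icc 0 T, momEnergy γ (dens T rho0 rho v n t)
        (fun i => mom γ μ lam T rho0 v0 rho v G n i t) ≤
      momEnergy γ (dens T rho0 rho v n 0) (fun i => mom γ μ lam T rho0 v0 rho v G n i 0) + C := by
  obtain ⟨h, hh, hh0, hb⟩ := H.exists_norm_energyRate_le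
  refine ⟨∫ s in Ioo 0 T, h s, fun n t ht => ?_⟩
  have hmono : (volume : Measure ℝ).restrict (Ioo 0 t) ≤ volume.restrict (Ioo 0 T) :=
    Measure.restrict_mono (Ioo_subset_Ioo_right ht.2) le_rfl
  have h1 := (norm_integral_le_of_norm_le (Integrable.mono_measure hh hmono)
    (ae_mono hmono (hb n))).trans (integral_mono_measure hmono (Eventually.of_forall hh0) hh)
  rw [← (H.momEnergy_sub n).2 t ht] at h1
  linarith [le_abs_self (momEnergy γ (dens T rho0 rho v n t)
    (fun i => mom γ μ lam T rho0 v0 rho v G n i t) -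
      momEnergy γ (dens T rho0 rho v n 0) (fun i => mom γ μ lam T rho0 v0 rho v G n i 0)),
      Real.norm_eq_abs (momEnergy γ (dens T rho0 rho v n t)
    (fun i => mom γ μ lam T rho0 v0 rho v G n i t) -
      momEnergy γ (dens T rho0 rho v n 0) (fun i => mom γ μ lam T rho0 v0 rho v G n i 0))]

/-- The mollified densities are bounded in `L²`, uniformly in scale and time. The initial density is
not assumed to be in `L²`, so the bound starts from a time at which the density is; the evolution of
`∫ (ϱⁿ)²` then carries it to all other times. -/
lemma exists_integral_dens_sq_le (H : RegularFlow γ μ lam T c r s g rho0 v0 rho v G) :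
    ∃ C, ∀ n, ∀ t ∈ Icc 0 T, ∫ x, dens T rho0 rho v n t x ^ (2 : ℝ) ≤ C := by
  obtain ⟨h, hh, hh0, hb⟩ := H.bound
  have e := H.exps
  have hr2 : 2 * r + r + g ≤ 1 := by linarith [e.convective, e.s_pos]
  have : NeZero (volume.restrict (Ioo 0 T)) :=
    ⟨by simpa [Measure.restrict_eq_zero] using H.time_pos⟩
  obtain ⟨t₀, ht₀, hsl₀, heq₀⟩ := ((ae_restrict_mem measurableSet_Ioo).and
    (H.slice.and (ae_all_iff.2 fun n => H.mass.ae_smoothVal_eq H.time_pos n))).exists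
  set K := ((d : ENNReal) * favreConst d c).toReal with hK
  set I := fun n t => ∫ x, dens T rho0 rho v n t x ^ (2 : ℝ)
  set f := fun n s => ∫ x, 2 * dens T rho0 rho v n s x ^ ((2 : ℝ) - 1) *
    smoothRate n (fun j t x => rho t x * v t x j) s x with hf
  have hfb : ∀ n, ∀ᵐ s ∂(volume.restrict (Ioo 0 T)), ‖f n s‖ ≤ K * h s := fun n => by
    filter_upwards [hb, H.slice, H.mass.ae_smoothVal_eq H.time_pos n] with s hs hsl heq
    have hR : ∀ x, dens T rho0 rho v n s x = moll n (rho s) x := heq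
    have hsl0 := hsl ⟨0, H.dim_pos⟩
    have hRpos : ∀ x, 0 < moll n (rho s) x := fun x =>
      H.lower_pos.trans_le (hsl0.le_moll_rho e n x)
    have e1 : f n s = -∑ j, ∫ x, moll n (rho s) x ^ (2 : ℝ) *
        favreD n j (rho s) (fun y => v s y j) x := by
      have e2 : ∀ j, ∫ x, moll n (rho s) x ^ (2 : ℝ) * favreD n j (rho s) (fun y => v s y j) x =
          ∫ x, 2 * moll n (rho s) x ^ ((2 : ℝ) - 1) *
            mollD n j (fun y => rho s y * v s y j) x := fun j => by
        rw [integral_rpow_mul_mollD e H.lower_pos hsl]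
        norm_num
      have hi := integral_finsetSum Finset.univ fun j _ => integrable_of_continuous
        (((continuous_const (y := (2 : ℝ))).mul
          (hsl0.continuous_rpow_moll e H.lower_pos n ((2 : ℝ) - 1))).mul
          (continuous_mollD (n := n) (j := j) ((hsl j).integrable_momentum e)))
      simp only [Pi.mul_apply] at hi
      simp only [e2]
      rw [← hi, ← integral_neg]
      simp only [hf, hR, smoothRate, ← Finset.mul_sum, mul_neg]
    have e3 : ∀ j, ‖∫ x, moll n (rho s) x ^ (2 : ℝ) * favreD n j (rho s) (fun y => v s y j) x‖ₑ ≤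
        favreConst d c * ENNReal.ofReal (h s) := fun j => by
      refine ((hsl j).enorm_integral_mul_favreD_le (θ := 2 * r) e H.lower_pos
        (by linarith [e.r_pos]) hr2
        (hsl0.continuous_rpow_moll e H.lower_pos n 2).aestronglyMeasurable n j).trans ?_
      refine mul_le_mul_right ((le_trans ?_ hs.2.2.2.2)) _
      rw [nrm_rpow two_pos (Eventually.of_forall fun x => (hRpos x).le)]
      have h1 := nrm_moll_le e.r_pos (by linarith [e.r_pos, e.g_pos]) hsl0.rho_meas n
      have h2 : _ ≤ gradNrm g (G s) := sum_nrm_le_gradNrm j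
      calc _ ≤ nrm r (rho s) ^ (2 : ℝ) * nrm r (rho s) * gradNrm g (G s) := by gcongr
        _ = _ := by
          rw [ENNReal.rpow_two]
          ring
    have e4 : ‖f n s‖ₑ ≤ d * favreConst d c * ENNReal.ofReal (h s) := by
      rw [e1, enorm_neg, mul_assoc]
      exact (enorm_sum_le _ _).trans ((Finset.sum_le_sum fun j _ => e3 j).trans (by simp))
    have e5 := ENNReal.toReal_mono (ENNReal.mul_ne_top
      (ENNReal.mul_ne_top (by simp) favreConst_ne_top) ENNReal.ofReal_ne_top) e4
    rwa [toReal_enorm, ENNReal.toReal_mul, ENNReal.toReal_ofReal (hh0 s)] at e5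
  have hdiff : ∀ n, ∀ t ∈ Icc 0 T, |I n t - I n 0| ≤ K * ∫ s in Ioo 0 T, h s := fun n t ht => by
    have hmono : (volume : Measure ℝ).restrict (Ioo 0 t) ≤ volume.restrict (Ioo 0 T) :=
      Measure.restrict_mono (Ioo_subset_Ioo_right ht.2) le_rfl
    rw [(H.integral_dens_rpow_sub n 2).2 t ht, ← integral_const_mul]
    refine (norm_integral_le_of_norm_le (Integrable.const_mul (Integrable.mono_measure hh hmono) K)
      (ae_mono hmono (hfb n))).trans ?_
    exact integral_mono_measure hmono
      (Eventually.of_forall fun s => mul_nonneg ENNReal.toReal_nonneg (hh0 s)) (hh.const_mul K)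
  have hsl0 := hsl₀ ⟨0, H.dim_pos⟩
  have hρ2 : Integrable fun x => rho t₀ x ^ (2 : ℝ) := by
    have h0 : ∀ᵐ x, 0 ≤ rho t₀ x := by
      filter_upwards [hsl0.lower] with x hx using H.lower_pos.le.trans hx
    refine integrable_of_nrm_lt (θ := 2 * r) (by linarith [e.r_pos])
      (by linarith [e.r_pos, e.g_pos])
      (hsl0.rho_meas.aemeasurable.pow_const 2).aestronglyMeasurable ?_
    rw [nrm_rpow two_pos h0]
    exact ENNReal.rpow_lt_top_of_nonneg two_pos.le hsl0.rho_lt.ne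
  refine ⟨(∫ x, rho t₀ x ^ (2 : ℝ)) + 2 * (K * ∫ s in Ioo 0 T, h s), fun n t ht => ?_⟩
  have h1 := abs_le.1 (hdiff n t ht)
  have h2 := abs_le.1 (hdiff n t₀ (Ioo_subset_Icc_self ht₀))
  have h3 : I n t₀ ≤ ∫ x, rho t₀ x ^ (2 : ℝ) := by
    have h0 : ∀ᵐ x, 0 ≤ rho t₀ x := by
      filter_upwards [hsl0.lower] with x hx using H.lower_pos.le.trans hx
    rw [← integral_moll (n := n) hρ2]
    refine integral_mono (integrable_of_continuous (H.continuous_dens_rpow_slice n 2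
      (Ioo_subset_Icc_self ht₀))) (integrable_of_continuous (continuous_moll hρ2)) fun x => ?_
    have := rpow_moll_le (n := n) one_le_two h0 (hsl0.integrable_rho e) hρ2 x
    rwa [← heq₀ n x] at this
  change I n t ≤ _
  linarith [h1.1, h1.2, h2.1, h2.2]

end RegularFlow

/-! ### Convergence of the energy of mollified states -/

/-- The mollified momenta of a state. -/
def mollMom (n : ℕ) (ρ : Torus d → ℝ) (v : Torus d → Vec d) (i : Fin d) (x : Torus d) : ℝ :=
  moll n (fun y => ρ y * v y i) x

section State

variable {γ c : ℝ} {ρ : Torus d → ℝ} {v : Torus d → Vec d}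

/-- Along a subsequence, finitely many mollified functions converge almost everywhere. -/
lemma exists_subseq_moll_tendsto_finset {ι : Type*} (f : ι → Torus d → ℝ) (S : Finset ι)
    (hf : ∀ i, Integrable (f i)) {ns : ℕ → ℕ} (hns : Tendsto ns atTop atTop) :
    ∃ ms : ℕ → ℕ, StrictMono ms ∧ ∀ i ∈ S,
      ∀ᵐ x, Tendsto (fun k => moll (ns (ms k)) (f i) x) atTop (𝓝 (f i x)) := by
  classical
  induction S using Finset.induction_on with
  | empty => exact ⟨id, strictMono_id, by simp⟩
  | insert a S _ ih =>
    obtain ⟨ms, hms, h⟩ := ih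
    obtain ⟨ks, hks, h'⟩ := exists_subseq_moll_tendsto (hf a) (hns.comp hms.tendsto_atTop)
    refine ⟨ms ∘ ks, hms.comp hks, fun i hi => ?_⟩
    rcases Finset.mem_insert.1 hi with rfl | hi
    · exact h'
    · filter_upwards [h i hi] with x hx using hx.comp hks.tendsto_atTop

/-- The energy density of a state with density `R` and momenta `M`. -/
def energyDensity (γ : ℝ) (R : ℝ) (M : Fin d → ℝ) : ℝ :=
  (∑ i, 1 / 2 * (M i ^ 2 / R)) + 1 / (γ - 1) * R ^ γ

lemma momEnergy_eq_integral {R : Torus d → ℝ} {M : Fin d → Torus d → ℝ}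
    (h1 : ∀ i, Integrable fun x => M i x ^ 2 / R x) (h2 : Integrable fun x => R x ^ γ) :
    momEnergy γ R M = ∫ x, energyDensity γ (R x) (fun i => M i x) := by
  unfold energyDensity
  rw [integral_add (integrable_finsetSum _ fun i _ => (h1 i).const_mul _) (h2.const_mul _),
    integral_finsetSum _ fun i _ => (h1 i).const_mul _, integral_const_mul]
  rfl

lemma energyDensity_momentum {a : ℝ} (ha : 0 < a) (w : Vec d) :
    energyDensity γ a (fun i => a * w i) = 1 / 2 * (a * ‖w‖ ^ 2) + a ^ γ / (γ - 1) := by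
  rw [EuclideanSpace.norm_sq_eq, energyDensity, Finset.mul_sum, Finset.mul_sum]
  congr 1
  · refine Finset.sum_congr rfl fun i _ => ?_
    rw [Real.norm_eq_abs, sq_abs]
    field_simp
  · ring

lemma energyDensity_nonneg (hγ : 1 < γ) {R : ℝ} (hR : 0 ≤ R) (M : Fin d → ℝ) :
    0 ≤ energyDensity γ R M := by
  have : 0 ≤ γ - 1 := by linarith
  unfold energyDensity
  positivity

/-- Finite energy follows from a bound of the energies of the mollified states: Fatou's lemma. -/
lemma energy_le_of_frequently (hγ : 1 < γ) (hc : 0 < c) (hρ : Integrable ρ)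
    (hcρ : ∀ᵐ x, c ≤ ρ x) (hv : AEStronglyMeasurable v volume)
    (hm : ∀ i, Integrable fun x => ρ x * v x i) {B : ℝ}
    (hB : ∃ᶠ n in atTop, momEnergy γ (moll n ρ) (mollMom n ρ v) ≤ B) :
    Integrable (fun x => ρ x ^ γ) ∧ Integrable (fun x => ρ x * ‖v x‖ ^ 2) ∧
      energy γ ρ v ≤ B := by
  have hγ1 : 0 < γ - 1 := by linarith
  have hR : ∀ n x, 0 < moll n ρ x := fun n x => hc.trans_le (le_moll hρ hcρ x)
  have hRc : ∀ n, Continuous (moll n ρ) := fun n => continuous_moll hρ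
  have hMc : ∀ n i, Continuous (mollMom n ρ v i) := fun n i => continuous_moll (hm i)
  have hpc : ∀ n, Continuous fun x => moll n ρ x ^ γ := fun n =>
    (hRc n).rpow_const fun x => Or.inl (hR n x).ne'
  have hkc : ∀ n i, Continuous fun x => mollMom n ρ v i x ^ 2 / moll n ρ x := fun n i =>
    ((hMc n i).pow 2).div (hRc n) fun x => (hR n x).ne'
  have hEc : ∀ n, Continuous fun x => energyDensity γ (moll n ρ x) (fun i => mollMom n ρ v i x) :=
    fun n => (continuous_finsetSum _ fun i _ => continuous_const.mul (hkc n i)).add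
      (continuous_const.mul (hpc n))
  obtain ⟨ns, hns, hnsB⟩ := extraction_of_frequently_atTop hB
  obtain ⟨ms, hms, hae⟩ := exists_subseq_moll_tendsto_finset
    (fun o : Option (Fin d) => o.elim ρ (fun i y => ρ y * v y i)) Finset.univ
    (fun o => by cases o; exacts [hρ, hm _]) hns.tendsto_atTop
  have hlim : ∀ᵐ x, Tendsto (fun k => energyDensity γ (moll (ns (ms k)) ρ x)
      (fun i => mollMom (ns (ms k)) ρ v i x)) atTop
      (𝓝 (1 / 2 * (ρ x * ‖v x‖ ^ 2) + ρ x ^ γ / (γ - 1))) := by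
    filter_upwards [hcρ, hae none (Finset.mem_univ _),
      ae_all_iff.2 fun i => hae (some i) (Finset.mem_univ _)] with x hx h1 h2
    have hpos := hc.trans_le hx
    rw [← energyDensity_momentum hpos]
    refine (tendsto_finsetSum _ fun i _ => ?_).add ?_
    · exact (((h2 i).pow 2).div h1 hpos.ne').const_mul _
    · exact (h1.rpow_const (Or.inl hpos.ne')).const_mul _
  set D : Torus d → ℝ := fun x => 1 / 2 * (ρ x * ‖v x‖ ^ 2) + ρ x ^ γ / (γ - 1) with hD
  have hρm : AEStronglyMeasurable (fun x => ρ x ^ γ) volume :=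
    (hρ.1.aemeasurable.pow_const γ).aestronglyMeasurable
  have hkm : AEStronglyMeasurable (fun x => ρ x * ‖v x‖ ^ 2) volume := hρ.1.mul (hv.norm.pow 2)
  have hDm : AEStronglyMeasurable D volume := (hkm.const_mul _).add (by
    simp only [div_eq_mul_inv]; exact hρm.mul_const _)
  have hρ0 : ∀ᵐ x, 0 ≤ ρ x := by filter_upwards [hcρ] with x hx using hc.le.trans hx
  have hD0 : ∀ᵐ x, 0 ≤ D x := by
    filter_upwards [hρ0] with x hx
    positivity
  have hbound : ∫⁻ x, ENNReal.ofReal (D x) ≤ ENNReal.ofReal B := by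
    calc ∫⁻ x, ENNReal.ofReal (D x)
        ≤ ∫⁻ x, liminf (fun k => ENNReal.ofReal (energyDensity γ (moll (ns (ms k)) ρ x)
            (fun i => mollMom (ns (ms k)) ρ v i x))) atTop := by
          refine lintegral_mono_ae ?_
          filter_upwards [hlim] with x hx
          exact ((ENNReal.continuous_ofReal.tendsto _).comp hx).liminf_eq.ge
      _ ≤ liminf (fun k => ∫⁻ x, ENNReal.ofReal (energyDensity γ (moll (ns (ms k)) ρ x)
            (fun i => mollMom (ns (ms k)) ρ v i x))) atTop :=
          lintegral_liminf_le fun k =>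
            (ENNReal.continuous_ofReal.comp (hEc _)).measurable
      _ ≤ _ := by
          refine liminf_le_of_le ⟨0, Eventually.of_forall fun _ => by simp⟩ fun b hb => ?_
          obtain ⟨k, hk⟩ := hb.exists
          refine hk.trans ?_
          rw [← ofReal_integral_eq_lintegral_ofReal (integrable_of_continuous (hEc _))
            (Eventually.of_forall fun x => energyDensity_nonneg hγ (hR _ x).le _),
            ← momEnergy_eq_integral (fun i => integrable_of_continuous (hkc _ i))
              (integrable_of_continuous (hpc _))]
          exact ENNReal.ofReal_le_ofReal (hnsB _)
  have hDi : Integrable D := by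
    refine ⟨hDm, ?_⟩
    rw [hasFiniteIntegral_iff_ofReal hD0]
    exact hbound.trans_lt ENNReal.ofReal_lt_top
  have hB0 : 0 ≤ B := by
    refine le_trans ?_ (hnsB 0)
    rw [momEnergy_eq_integral (fun i => integrable_of_continuous (hkc _ i))
              (integrable_of_continuous (hpc _))]
    exact integral_nonneg fun x => energyDensity_nonneg hγ (hR _ x).le _
  refine ⟨?_, ?_, ?_⟩
  · refine (hDi.const_mul (γ - 1)).mono' hρm ?_
    filter_upwards [hρ0] with x hx
    rw [Real.norm_of_nonneg (Real.rpow_nonneg hx _), hD]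
    have : (γ - 1) * (1 / 2 * (ρ x * ‖v x‖ ^ 2) + ρ x ^ γ / (γ - 1)) =
        (γ - 1) * (1 / 2 * (ρ x * ‖v x‖ ^ 2)) + ρ x ^ γ := by field_simp
    simp only [this, le_add_iff_nonneg_left]
    positivity
  · refine (hDi.const_mul 2).mono' hkm ?_
    filter_upwards [hρ0] with x hx
    rw [Real.norm_of_nonneg (by positivity), hD]
    have : 0 ≤ ρ x ^ γ / (γ - 1) := by positivity
    simp only
    linarith
  · have h1 := ofReal_integral_eq_lintegral_ofReal hDi hD0
    rw [← h1] at hbound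
    exact (ENNReal.ofReal_le_ofReal_iff hB0).1 hbound

/-- Mollification decreases the energy: Jensen's inequality. -/
lemma momEnergy_moll_le (hγ : 1 < γ) (hc : 0 < c) (hρ : Integrable ρ)
    (hcρ : ∀ᵐ x, c ≤ ρ x) (hv : AEStronglyMeasurable v volume)
    (hm : ∀ i, Integrable fun x => ρ x * v x i)
    (hp : Integrable fun x => ρ x ^ γ) (hk : Integrable fun x => ρ x * ‖v x‖ ^ 2) (n : ℕ) :
    momEnergy γ (moll n ρ) (mollMom n ρ v) ≤ energy γ ρ v := by
  have hγ1 : 0 < γ - 1 := by linarith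
  have hR : ∀ n x, 0 < moll n ρ x := fun n x => hc.trans_le (le_moll hρ hcρ x)
  have hρ0 : ∀ᵐ x, 0 ≤ ρ x := by filter_upwards [hcρ] with x hx using hc.le.trans hx
  have hki : ∀ i, Integrable fun x => ρ x * v x i ^ 2 := fun i => by
    refine hk.mono' (hρ.1.mul ?_) ?_
    · exact ((EuclideanSpace.proj (𝕜 := ℝ) i).continuous.comp_aestronglyMeasurable hv).pow 2
    · filter_upwards [hρ0] with x hx
      rw [Real.norm_of_nonneg (by positivity)]
      refine mul_le_mul_of_nonneg_left ?_ hx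
      rw [← sq_abs, ← Real.norm_eq_abs]
      gcongr
      exact PiLp.norm_apply_le (v x) i
  have hsum : ∫ x, ρ x * ‖v x‖ ^ 2 = ∑ i, ∫ x, ρ x * v x i ^ 2 := by
    rw [← integral_finsetSum _ fun i _ => hki i]
    congr 1
    funext x
    rw [EuclideanSpace.norm_sq_eq, Finset.mul_sum]
    simp
  have hE : energy γ ρ v = (∑ i, 1 / 2 * ∫ x, ρ x * v x i ^ 2) +
      1 / (γ - 1) * ∫ x, ρ x ^ γ := by
    rw [energy, integral_add (hk.const_mul _) (hp.div_const _), integral_const_mul,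
      integral_div, hsum, Finset.mul_sum]
    ring
  rw [hE, momEnergy]
  refine add_le_add (Finset.sum_le_sum fun i _ => ?_) ?_
  · rw [integral_const_mul, ← integral_moll (n := n) (hki i)]
    refine mul_le_mul_of_nonneg_left (integral_mono (integrable_of_continuous ?_)
      (integrable_of_continuous (continuous_moll (hki i))) fun x => ?_) (by norm_num)
    · exact ((continuous_moll (hm i)).pow 2).div (continuous_moll hρ) fun x => (hR n x).ne'
    · exact sq_moll_div_le hρ hρ0 (hm i) (hki i) x (hR n x)
  · rw [← integral_moll (n := n) hp]
    refine mul_le_mul_of_nonneg_left (integral_mono (integrable_of_continuous ?_)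
      (integrable_of_continuous (continuous_moll hp)) fun x => ?_) (by positivity)
    · exact (continuous_moll hρ).rpow_const fun x => Or.inl (hR n x).ne'
    · exact rpow_moll_le hγ.le hρ0 hρ hp x

/-- The energies of the mollifications of a state of finite energy converge. -/
lemma tendsto_momEnergy_moll (hγ : 1 < γ) (hc : 0 < c) (hρ : Integrable ρ)
    (hcρ : ∀ᵐ x, c ≤ ρ x) (hv : AEStronglyMeasurable v volume)
    (hm : ∀ i, Integrable fun x => ρ x * v x i)
    (hp : Integrable fun x => ρ x ^ γ) (hk : Integrable fun x => ρ x * ‖v x‖ ^ 2) :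
    Tendsto (fun n => momEnergy γ (moll n ρ) (mollMom n ρ v)) atTop (𝓝 (energy γ ρ v)) := by
  have hle := momEnergy_moll_le hγ hc hρ hcρ hv hm hp hk
  rw [Metric.tendsto_nhds]
  intro ε hε
  by_contra hcon
  have hfr : ∃ᶠ n in atTop, momEnergy γ (moll n ρ) (mollMom n ρ v) ≤ energy γ ρ v - ε := by
    refine (not_eventually.1 hcon).mono fun n hn => ?_
    rw [Real.dist_eq, abs_of_nonpos (sub_nonpos.2 (hle n))] at hn
    linarith
  linarith [(energy_le_of_frequently hγ hc hρ hcρ hv hm hfr).2.2]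

/-- A state whose mollifications have convergent energies has finite energy, equal to the limit. -/
lemma energy_eq_of_tendsto (hγ : 1 < γ) (hc : 0 < c) (hρ : Integrable ρ)
    (hcρ : ∀ᵐ x, c ≤ ρ x) (hv : AEStronglyMeasurable v volume)
    (hm : ∀ i, Integrable fun x => ρ x * v x i) {L : ℝ}
    (hL : Tendsto (fun n => momEnergy γ (moll n ρ) (mollMom n ρ v)) atTop (𝓝 L)) :
    Integrable (fun x => ρ x ^ γ) ∧ Integrable (fun x => ρ x * ‖v x‖ ^ 2) ∧
      energy γ ρ v = L := by
  have hfin := energy_le_of_frequently hγ hc hρ hcρ hv hm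
    (hL.eventually_le_const (lt_add_one L)).frequently
  exact ⟨hfin.1, hfin.2.1, tendsto_nhds_unique
    (tendsto_momEnergy_moll hγ hc hρ hcρ hv hm hfin.1 hfin.2.1) hL⟩

end State

/-! ### The weakly continuous representative -/

/-- A sequence of functions bounded in `L²` converges weakly in `L²` along an ultrafilter. -/
lemma exists_weak_limit {f : ℕ → Torus d → ℝ} (hf : ∀ n, MemLp (f n) 2) {C : ℝ}
    (hC : ∀ n, ∫ x, f n x ^ 2 ≤ C) :
    ∃ F : Torus d → ℝ, MemLp F 2 ∧ ∀ φ : Torus d → ℝ, MemLp φ 2 →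
      Tendsto (fun n => ∫ x, f n x * φ x) (hyperfilter ℕ) (𝓝 (∫ x, F x * φ x)) := by
  have hinner : ∀ {u w : Torus d → ℝ} (hu : MemLp u 2) (hw : MemLp w 2),
      inner ℝ (hu.toLp u) (hw.toLp w) = ∫ x, u x * w x := fun {u w} hu hw => by
    rw [L2.inner_def]
    refine integral_congr_ae ?_
    filter_upwards [hu.coeFn_toLp, hw.coeFn_toLp] with x h1 h2
    rw [h1, h2]
    simp [mul_comm]
  set a : ℕ → WeakDual ℝ (Lp ℝ 2 (volume : Measure (Torus d))) := fun n =>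
    StrongDual.toWeakDual (InnerProductSpace.toDual ℝ _ ((hf n).toLp (f n))) with ha
  have hK := WeakDual.isCompact_closedBall
    (0 : StrongDual ℝ (Lp ℝ 2 (volume : Measure (Torus d)))) (√C)
  have hmem : ∀ n, a n ∈ WeakDual.toStrongDual ⁻¹' Metric.closedBall
      (0 : StrongDual ℝ (Lp ℝ 2 (volume : Measure (Torus d)))) (√C) := fun n => by
    have h1 : ‖(hf n).toLp (f n)‖ ^ 2 ≤ C := by
      rw [← real_inner_self_eq_norm_sq, hinner]
      simpa only [sq] using hC n
    rw [mem_preimage, mem_closedBall_zero_iff]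
    change ‖InnerProductSpace.toDual ℝ _ ((hf n).toLp (f n))‖ ≤ _
    rw [LinearIsometryEquiv.norm_map]
    exact Real.le_sqrt_of_sq_le h1
  obtain ⟨ℓ, -, hℓ⟩ := hK.ultrafilter_le_nhds ((hyperfilter ℕ).map a) (by
    rw [le_principal_iff]
    exact Ultrafilter.mem_map.2 (Filter.univ_mem' hmem))
  have hlim : Tendsto a (hyperfilter ℕ) (𝓝 ℓ) := hℓ
  set F := (InnerProductSpace.toDual ℝ (Lp ℝ 2 (volume : Measure (Torus d)))).symm
    (WeakDual.toStrongDual ℓ) with hF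
  refine ⟨F, Lp.memLp F, fun φ hφ => ?_⟩
  have h1 := ((WeakDual.eval_continuous (hφ.toLp φ)).tendsto ℓ).comp hlim
  have h2 : ∀ n, a n (hφ.toLp φ) = ∫ x, f n x * φ x := fun n => hinner (hf n) hφ
  have h3 : ℓ (hφ.toLp φ) = ∫ x, F x * φ x := by
    rw [← hinner (Lp.memLp F) hφ, Lp.toLp_coeFn, hF, InnerProductSpace.toDual_symm_apply]
    rfl
  rw [← h3]
  exact h1.congr h2

/-- Weak continuity in time from continuity of all mollifications. -/
lemma continuousOn_integral_of_moll {S : Set ℝ} {f : ℝ → Torus d → ℝ}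
    {F : ℕ → ℝ → Torus d → ℝ} (hF : ∀ n, Continuous fun z : ℝ × Torus d => F n z.1 z.2)
    (hf : ∀ t ∈ S, Integrable (f t)) (hm : ∀ t ∈ S, ∀ n x, moll n (f t) x = F n t x)
    {C : ℝ} (hC : ∀ t ∈ S, ∫ x, |f t x| ≤ C) {φ : Torus d → ℝ} (hφ : Continuous φ) :
    ContinuousOn (fun t => ∫ x, f t x * φ x) S := by
  have hb : ∀ g : Torus d → ℝ, Continuous g → ∀ t ∈ S, Integrable fun x => f t x * g x :=
    fun g hg t ht => by
      obtain ⟨K, -, hK⟩ := exists_bound_of_continuous hg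
      exact (hf t ht).mul_bdd (c := K) hg.aestronglyMeasurable (Eventually.of_forall hK)
  have hunif : TendstoUniformlyOn (fun n t => ∫ x, F n t x * φ x)
      (fun t => ∫ x, f t x * φ x) atTop S := by
    rw [Metric.tendstoUniformlyOn_iff]
    intro ε hε
    have hε' : 0 < ε / (|C| + 1) := by positivity
    filter_upwards [eventually_abs_moll_sub_le hφ (half_pos hε')] with n hn t ht
    have hφm := continuous_moll (n := n) (integrable_of_continuous hφ)
    have e1 : ∫ x, F n t x * φ x = ∫ x, f t x * moll n φ x := by
      rw [← integral_moll_mul (hf t ht) (integrable_of_continuous hφ)]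
      simp only [hm t ht]
    rw [dist_comm, Real.dist_eq, e1, ← integral_sub (hb _ hφm t ht) (hb _ hφ t ht)]
    calc |∫ x, (f t x * moll n φ x - f t x * φ x)|
        ≤ ∫ x, |f t x| * (ε / (|C| + 1) / 2) := by
          rw [← Real.norm_eq_abs]
          refine norm_integral_le_of_norm_le ((hf t ht).abs.mul_const _)
            (Eventually.of_forall fun x => ?_)
          rw [← mul_sub, norm_mul, Real.norm_eq_abs]
          exact mul_le_mul_of_nonneg_left (hn x) (abs_nonneg _)
      _ ≤ C * (ε / (|C| + 1) / 2) := by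
          rw [integral_mul_const]
          gcongr
          exact hC t ht
      _ ≤ (|C| + 1) * (ε / (|C| + 1) / 2) := by
          gcongr
          linarith [le_abs_self C]
      _ < ε := by
          field_simp
          linarith
  refine hunif.continuousOn (Frequently.of_forall fun n => Continuous.continuousOn ?_)
  refine (continuous_parametric_integral_of_continuous (s := univ) (μ := volume)
    (f := fun t x => F n t x * φ x) ?_ isCompact_univ).congr fun t => by simp
  exact (hF n).mul (hφ.comp continuous_snd)

namespace RegularFlow

variable {γ μ lam T c r s g : ℝ} {rho0 : Torus d → ℝ} {v0 : Torus d → Vec d}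
  {rho : ℝ → Torus d → ℝ} {v : ℝ → Torus d → Vec d} {G : ℝ → Torus d → Grad d}

lemma dens_zero (n : ℕ) :
    dens T rho0 rho v n 0 = moll n rho0 :=
  funext fun x => BalanceLaw.smoothVal_zero n x

lemma mom_zero (n : ℕ) : (fun i => mom γ μ lam T rho0 v0 rho v G n i 0) = mollMom n rho0 v0 :=
  funext fun _ => funext fun x => BalanceLaw.smoothVal_zero n x

lemma initial_lower (H : RegularFlow γ μ lam T c r s g rho0 v0 rho v G) :
    ∀ᵐ x, c ≤ rho0 x := by
  obtain ⟨ms, -, h⟩ := exists_subseq_moll_tendsto H.mass.int_init tendsto_id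
  filter_upwards [h] with x hx
  refine ge_of_tendsto' hx fun i => ?_
  have := H.le_dens (ms i) (left_mem_Icc.2 H.time_pos.le) x
  rwa [dens_zero] at this

lemma exists_momEnergy_le (H : RegularFlow γ μ lam T c r s g rho0 v0 rho v G)
    (hv0 : AEStronglyMeasurable v0 volume) :
    ∃ C, ∀ n, ∀ t ∈ Icc 0 T, momEnergy γ (dens T rho0 rho v n t)
      (fun i => mom γ μ lam T rho0 v0 rho v G n i t) ≤ C := by
  obtain ⟨C, hC⟩ := H.exists_momEnergy_sub_le
  refine ⟨energy γ rho0 v0 + C, fun n t ht => (hC n t ht).trans ?_⟩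
  rw [dens_zero, mom_zero]
  exact add_le_add_left (momEnergy_moll_le H.exps.one_lt H.lower_pos H.mass.int_init
    H.initial_lower hv0 (fun i => (H.momentum i).int_init) H.pressure0 H.kinetic0 n) C

/-- The velocities of the mollified states are bounded in `L²`. -/
lemma integral_sq_mom_div_le (H : RegularFlow γ μ lam T c r s g rho0 v0 rho v G) {C : ℝ} {n : ℕ}
    {t : ℝ} (ht : t ∈ Icc 0 T) (hC : momEnergy γ (dens T rho0 rho v n t)
      (fun i => mom γ μ lam T rho0 v0 rho v G n i t) ≤ C) (i : Fin d) :
    ∫ x, (mom γ μ lam T rho0 v0 rho v G n i t x / dens T rho0 rho v n t x) ^ 2 ≤ 2 * C / c := by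
  have hγ : 0 < γ - 1 := by linarith [H.exps.one_lt]
  have hc := H.lower_pos
  set R := dens T rho0 rho v n t with hR
  set M := fun i => mom γ μ lam T rho0 v0 rho v G n i t with hM
  have hpos : ∀ x, 0 < R x := H.dens_pos n ht
  have h1 : ∫ x, 1 / 2 * (M i x ^ 2 / R x) ≤ C := by
    refine le_trans ?_ hC
    have h2 : ∫ x, 1 / 2 * (M i x ^ 2 / R x) ≤ ∑ i, ∫ x, 1 / 2 * (M i x ^ 2 / R x) :=
      Finset.single_le_sum (f := fun i => ∫ x, 1 / 2 * (M i x ^ 2 / R x)) (fun j _ =>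
        integral_nonneg fun x => by have := hpos x; positivity) (Finset.mem_univ i)
    have h3 : 0 ≤ 1 / (γ - 1) * ∫ x, R x ^ γ :=
      mul_nonneg (by positivity) (integral_nonneg fun x => (Real.rpow_pos_of_pos (hpos x) _).le)
    rw [momEnergy]
    linarith
  have hV := H.continuous_mom_div_slice n i ht
  have hK : Continuous fun x => 1 / 2 * (M i x ^ 2 / R x) := continuous_const.mul
    (((H.continuous_mom_slice n i t).pow 2).div (H.continuous_dens_slice n t)
        fun x => (hpos x).ne')
  rw [le_div_iff₀ hc, mul_comm, ← integral_const_mul]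
  calc ∫ x, c * (M i x / R x) ^ 2 ≤ ∫ x, 2 * (1 / 2 * (M i x ^ 2 / R x)) := by
        refine integral_mono (integrable_of_continuous (continuous_const.mul (hV.pow 2)))
          (integrable_of_continuous (continuous_const.mul hK)) fun x => ?_
        have hx := hpos x
        have hcx : c ≤ R x := H.le_dens n ht x
        have : 2 * (1 / 2 * (M i x ^ 2 / R x)) = R x * (M i x / R x) ^ 2 := by field_simp
        simp only [this]
        gcongr
    _ ≤ 2 * C := by
        rw [integral_const_mul]
        linarith

lemma eLpNorm_two_le {f : Torus d → ℝ} (hf : MemLp f 2) {C : ℝ} (hC : ∫ x, f x ^ 2 ≤ C) :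
    eLpNorm f 2 volume ≤ ENNReal.ofReal (C ^ (2⁻¹ : ℝ)) := by
  rw [hf.eLpNorm_eq_integral_rpow_norm (by simp) (by simp)]
  refine ENNReal.ofReal_le_ofReal ?_
  have : ∀ x, ‖f x‖ ^ (2 : ENNReal).toReal = f x ^ 2 := fun x => by
    simp
  simp only [this]
  exact Real.rpow_le_rpow (integral_nonneg fun x => sq_nonneg _) hC (by simp)

/-- A state whose mollifications are the mollified density and momentum at time `t`. -/
structure IsStateAt (γ μ lam T c : ℝ) (rho0 : Torus d → ℝ) (v0 : Torus d → Vec d)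
    (rho : ℝ → Torus d → ℝ) (v : ℝ → Torus d → Vec d) (G : ℝ → Torus d → Grad d) (t : ℝ)
    (ρ : Torus d → ℝ) (u : Torus d → Vec d) : Prop where
  integrable : Integrable ρ
  lower : ∀ᵐ x, c ≤ ρ x
  meas : AEStronglyMeasurable u volume
  integrable_momentum : ∀ i, Integrable fun x => ρ x * u x i
  moll_dens : ∀ n, moll n ρ = dens T rho0 rho v n t
  moll_mom : ∀ n, mollMom n ρ u = fun i => mom γ μ lam T rho0 v0 rho v G n i t

/-- Existence of the state at each time: density and velocity are weak `L²` limits, and the density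
converges strongly because it is recovered by mollification. -/
lemma exists_isStateAt (H : RegularFlow γ μ lam T c r s g rho0 v0 rho v G)
    (hv0 : AEStronglyMeasurable v0 volume) {t : ℝ} (ht : t ∈ Icc 0 T) :
    ∃ ρ u, IsStateAt γ μ lam T c rho0 v0 rho v G t ρ u := by
  obtain ⟨C, hC⟩ := H.exists_integral_dens_sq_le
  obtain ⟨E, hE⟩ := H.exists_momEnergy_le hv0
  set R := fun n => dens T rho0 rho v n t with hR
  set M := fun n i => mom γ μ lam T rho0 v0 rho v G n i t with hM
  set V := fun n i x => M n i x / R n x with hV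
  have hRc : ∀ n, Continuous (R n) := fun n => H.continuous_dens_slice n t
  have hMc : ∀ n i, Continuous (M n i) := fun n i => H.continuous_mom_slice n i t
  have hVc : ∀ n i, Continuous (V n i) := fun n i => H.continuous_mom_div_slice n i ht
  have hpos : ∀ n x, 0 < R n x := fun n => H.dens_pos n ht
  have hV2 : ∀ i n, ∫ x, V n i x ^ 2 ≤ 2 * E / c := fun i n =>
    H.integral_sq_mom_div_le ht (hE n t ht) i
  obtain ⟨ρ, hρ, hρlim⟩ := exists_weak_limit (f := R) (fun n => memLp_of_continuous (hRc n))
    (C := C) fun n => by simpa only [Real.rpow_two] using hC n t ht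
  choose w hw hwlim using fun i => exists_weak_limit (f := fun n => V n i)
    (fun n => memLp_of_continuous (hVc n i)) (hV2 i)
  have hk : ∀ n (x : Torus d), Continuous fun y => kern n (x - y) := fun n x =>
    continuous_kern.comp (continuous_const.sub continuous_id)
  have hρi : Integrable ρ := hρ.integrable one_le_two
  have hmoll : ∀ n, moll n ρ = R n := fun n => funext fun x => by
    have h1 := hρlim _ (memLp_of_continuous (hk n x))
    have h2 : Tendsto (fun m => moll n (R m) x) (hyperfilter ℕ) (𝓝 (R n x)) := by
      refine ((tendsto_moll_of_continuous (hRc n) x).mono_left Nat.hyperfilter_le_atTop).congr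
        fun m => ?_
      exact (H.mass.moll_smoothVal_comm H.time_pos m n t ht x).symm
    exact tendsto_nhds_unique h1 h2
  have hlow : ∀ᵐ x, c ≤ ρ x := by
    obtain ⟨ms, -, h⟩ := exists_subseq_moll_tendsto hρi tendsto_id
    filter_upwards [h] with x hx
    refine ge_of_tendsto' hx fun i => ?_
    rw [hmoll]
    exact H.le_dens _ ht x
  have hmi : ∀ i, Integrable fun x => ρ x * w i x := fun i => hρ.integrable_mul (hw i)
  have hstrong := tendsto_eLpNorm_moll_sub (p := 2) one_le_two (by simp) hρ
  simp only [hmoll] at hstrong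
  have hmom : ∀ n i, moll n (fun x => ρ x * w i x) = M n i := fun n i => funext fun x => by
    have hφ := hk n x
    obtain ⟨K, hK0, hK⟩ := exists_bound_of_continuous hφ
    -- the product of the strong and the weak limit
    have h1 : Tendsto (fun m => ∫ y, V m i y * (ρ y * kern n (x - y))) (hyperfilter ℕ)
        (𝓝 (∫ y, w i y * (ρ y * kern n (x - y)))) :=
      hwlim i _ (hρ.of_le_mul (c := K) (hρ.1.mul hφ.aestronglyMeasurable)
        (Eventually.of_forall fun y => by
          rw [norm_mul, mul_comm]
          exact mul_le_mul_of_nonneg_right (hK y) (norm_nonneg _)))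
    have hint1 : ∀ m, Integrable fun y => (R m y - ρ y) * V m i y * kern n (x - y) := fun m => by
      obtain ⟨K', -, hK'⟩ := exists_bound_of_continuous ((hVc m i).mul hφ)
      simp only [mul_assoc]
      exact ((integrable_of_continuous (hRc m)).sub hρi).mul_bdd (c := K')
        ((hVc m i).mul hφ).aestronglyMeasurable (Eventually.of_forall hK')
    have hint2 : ∀ m, Integrable fun y => V m i y * (ρ y * kern n (x - y)) := fun m => by
      obtain ⟨K', -, hK'⟩ := exists_bound_of_continuous ((hVc m i).mul hφ)
      refine (hρi.mul_bdd (c := K')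
        ((hVc m i).mul hφ).aestronglyMeasurable (Eventually.of_forall hK')).congr
        (Eventually.of_forall fun y => ?_)
      simp only [Pi.mul_apply]
      ring
    have h2 : Tendsto (fun m => ∫ y, (R m y - ρ y) * V m i y * kern n (x - y)) atTop (𝓝 0) := by
      rw [tendsto_zero_iff_enorm_tendsto_zero]
      have t := ENNReal.Tendsto.mul_const (b := ENNReal.ofReal ((2 * E / c) ^ (2⁻¹ : ℝ)) *
        ENNReal.ofReal K) hstrong (Or.inr (ENNReal.mul_ne_top ENNReal.ofReal_ne_top
          ENNReal.ofReal_ne_top))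
      rw [zero_mul] at t
      refine tendsto_of_tendsto_of_tendsto_of_le_of_le tendsto_const_nhds t (fun _ => by simp)
        fun m => ?_
      have hRm : AEStronglyMeasurable (fun y => R m y - ρ y) volume :=
        (hRc m).aestronglyMeasurable.sub hρ.1
      have hhalf : ∀ f : Torus d → ℝ, nrm (1 / 2) f = eLpNorm f 2 volume := fun f => by
        simp [nrm]
      calc ‖∫ y, (R m y - ρ y) * V m i y * kern n (x - y)‖ₑ
          ≤ ∫⁻ y, ‖R m y - ρ y‖ₑ * ‖V m i y‖ₑ * ENNReal.ofReal K := by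
            refine (enorm_integral_le_lintegral_enorm _).trans (lintegral_mono fun y => ?_)
            rw [enorm_mul, enorm_mul]
            gcongr
            rw [← ofReal_norm]
            exact ENNReal.ofReal_le_ofReal (hK y)
        _ = (∫⁻ y, ‖R m y - ρ y‖ₑ * ‖V m i y‖ₑ) * ENNReal.ofReal K :=
            lintegral_mul_const' _ _ ENNReal.ofReal_ne_top
        _ ≤ eLpNorm (fun y => R m y - ρ y) 2 volume * eLpNorm (V m i) 2 volume *
              ENNReal.ofReal K := by
            gcongr
            rw [← hhalf, ← hhalf]
            exact lintegral_mul_le_nrm (by norm_num) (by norm_num) (by norm_num) hRm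
              (hVc m i).aestronglyMeasurable
        _ ≤ _ := by
            rw [mul_assoc]
            gcongr
            exact eLpNorm_two_le (memLp_of_continuous (hVc m i)) (hV2 i m)
    have h3 := (h2.mono_left Nat.hyperfilter_le_atTop).add h1
    have h4 : Tendsto (fun m => moll n (M m i) x) (hyperfilter ℕ) (𝓝 (M n i x)) := by
      refine ((tendsto_moll_of_continuous (hMc n i) x).mono_left Nat.hyperfilter_le_atTop).congr
        fun m => ?_
      exact ((H.momentum i).moll_smoothVal_comm H.time_pos m n t ht x).symm
    rw [zero_add] at h3
    have h5 : moll n (fun x => ρ x * w i x) x = ∫ y, w i y * (ρ y * kern n (x - y)) := by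
      rw [moll, cv]
      congr 1
      funext y
      ring
    rw [h5]
    refine tendsto_nhds_unique h3 (h4.congr fun m => ?_)
    rw [← integral_add (hint1 m) (hint2 m), moll, cv]
    congr 1
    funext y
    have := (hpos m y).ne'
    simp only [hV]
    field_simp
    ring
  refine ⟨ρ, fun x => WithLp.toLp 2 fun i => w i x, hρi, hlow, ?_, hmi, hmoll,
    fun n => funext fun i => hmom n i⟩
  exact (PiLp.continuous_toLp 2 _).comp_aestronglyMeasurable
    (aemeasurable_pi_lambda _ fun i => (hw i).1.aemeasurable).aestronglyMeasurable

/-- The energy equality for the weakly continuous representative. -/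
theorem exists_representative (H : RegularFlow γ μ lam T c r s g rho0 v0 rho v G)
    (hv0 : AEStronglyMeasurable v0 volume) :
    ∃ (rho' : ℝ → Torus d → ℝ) (v' : ℝ → Torus d → Vec d),
      IsWeaklyContinuousRepresentative γ T rho0 v0 rho v rho' v' ∧
      ∀ t ∈ Icc 0 T, energy γ (rho' t) (v' t) + dissipation μ lam G t = energy γ rho0 v0 := by
  have hex : ∀ t, ∃ ρ u, t ∈ Icc 0 T → IsStateAt γ μ lam T c rho0 v0 rho v G t ρ u := fun t => by
    by_cases ht : t ∈ Icc 0 T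
    · obtain ⟨ρ, u, h⟩ := H.exists_isStateAt hv0 ht
      exact ⟨ρ, u, fun _ => h⟩
    · exact ⟨0, 0, fun h => absurd h ht⟩
  choose rho' v' hst using hex
  have hγ := H.exps.one_lt
  have hc := H.lower_pos
  have hE : ∀ t ∈ Icc 0 T, Integrable (fun x => rho' t x ^ γ) ∧
      Integrable (fun x => rho' t x * ‖v' t x‖ ^ 2) ∧
      energy γ (rho' t) (v' t) = energy γ rho0 v0 - dissipation μ lam G t := fun t ht => by
    have h := hst t ht
    refine energy_eq_of_tendsto hγ hc h.integrable h.lower h.meas h.integrable_momentum ?_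
    have h0 := tendsto_momEnergy_moll hγ hc H.mass.int_init H.initial_lower hv0
      (fun i => (H.momentum i).int_init) H.pressure0 H.kinetic0
    have h1 := (H.tendsto_momEnergy_sub ht).add h0
    rw [neg_add_eq_sub] at h1
    refine h1.congr fun n => ?_
    rw [h.moll_dens, h.moll_mom, ← dens_zero (T := T) (rho := rho) (v := v),
      ← mom_zero (γ := γ) (μ := μ) (lam := lam) (T := T) (rho := rho) (v := v) (G := G)]
    ring
  obtain ⟨C, hC⟩ := H.exists_integral_dens_sq_le
  obtain ⟨B, hB⟩ := H.exists_momEnergy_le hv0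
  have hρ0 : ∀ t ∈ Icc 0 T, ∀ᵐ x, 0 ≤ rho' t x := fun t ht => by
    filter_upwards [(hst t ht).lower] with x hx using hc.le.trans hx
  have hmass : ∀ t ∈ Icc 0 T, ∫ x, |rho' t x| ≤ 1 + C := fun t ht => by
    have h := hst t ht
    have hR := H.continuous_dens_slice 0 t
    have e1 : ∫ x, |rho' t x| = ∫ x, rho' t x := by
      refine integral_congr_ae ?_
      filter_upwards [hρ0 t ht] with x hx using abs_of_nonneg hx
    rw [e1, ← integral_moll (n := 0) h.integrable, h.moll_dens]
    calc ∫ x, dens T rho0 rho v 0 t x ≤ ∫ x, (1 + dens T rho0 rho v 0 t x ^ (2 : ℝ)) := by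
          refine integral_mono (integrable_of_continuous hR) (integrable_of_continuous
            (continuous_const.add (H.continuous_dens_rpow_slice 0 2 ht))) fun x => ?_
          simp only [Real.rpow_two]
          nlinarith [sq_nonneg (dens T rho0 rho v 0 t x - 1)]
      _ = 1 + ∫ x, dens T rho0 rho v 0 t x ^ (2 : ℝ) := by
          rw [integral_add (integrable_const _)
            (integrable_of_continuous (H.continuous_dens_rpow_slice 0 2 ht))]
          simp
      _ ≤ 1 + C := by gcongr; exact hC 0 t ht
  have hkin : ∀ t ∈ Icc 0 T, ∫ x, rho' t x * ‖v' t x‖ ^ 2 ≤ 2 * B := fun t ht => by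
    have h := hst t ht
    have h1 := (energy_le_of_frequently hγ hc h.integrable h.lower h.meas h.integrable_momentum
      (B := B) (Frequently.of_forall fun n => by
        rw [h.moll_dens, h.moll_mom]
        exact hB n t ht)).2.2
    have h2 : 0 ≤ ∫ x, rho' t x ^ γ / (γ - 1) := by
      refine integral_nonneg_of_ae ?_
      filter_upwards [hρ0 t ht] with x hx
      exact div_nonneg (Real.rpow_nonneg hx _) (by linarith)
    rw [energy, integral_add ((hE t ht).2.1.const_mul _) ((hE t ht).1.div_const _),
      integral_const_mul] at h1
    linarith
  have hmomb : ∀ i, ∀ t ∈ Icc 0 T, ∫ x, |rho' t x * v' t x i| ≤ 1 + C + 2 * B := fun i t ht => by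
    have h := hst t ht
    have e1 : ∫ x, |rho' t x * v' t x i| ≤ ∫ x, (|rho' t x| + rho' t x * ‖v' t x‖ ^ 2) := by
      refine integral_mono_ae (h.integrable_momentum i).abs
        (h.integrable.abs.add (hE t ht).2.1) ?_
      filter_upwards [hρ0 t ht] with x hx
      have h1 : |v' t x i| ≤ ‖v' t x‖ := PiLp.norm_apply_le (v' t x) i
      have h2 : |v' t x i| ≤ 1 + ‖v' t x‖ ^ 2 := by nlinarith [sq_nonneg (‖v' t x‖ - 1)]
      rw [abs_mul, abs_of_nonneg hx]
      nlinarith [mul_le_mul_of_nonneg_left h2 hx]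
    rw [integral_add h.integrable.abs (hE t ht).2.1] at e1
    linarith [hmass t ht, hkin t ht]
  refine ⟨rho', v', ?_, fun t ht => by rw [(hE t ht).2.2]; ring⟩
  refine
    { ae_eq := ?_
      rho_meas := fun t ht => (hst t ht).integrable.1
      v_meas := fun t ht => (hst t ht).meas
      rho_nonneg := hρ0
      pressure := fun t ht => (hE t ht).1
      kinetic := fun t ht => (hE t ht).2.1
      rho_cont := fun φ hφ => continuousOn_integral_of_moll (F := dens T rho0 rho v)
        H.continuous_dens (fun t ht => (hst t ht).integrable)
        (fun t ht n x => congrFun ((hst t ht).moll_dens n) x) hmass hφ.continuous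
      momentum_cont := fun i φ hφ => continuousOn_integral_of_moll
        (F := fun n => mom γ μ lam T rho0 v0 rho v G n i)
        (fun n => H.continuous_mom n i) (fun t ht => (hst t ht).integrable_momentum i)
        (fun t ht n x => congrFun (congrFun ((hst t ht).moll_mom n) i) x) (hmomb i) hφ.continuous
      rho_init := ?_
      momentum_init := ?_ }
  · filter_upwards [ae_restrict_mem measurableSet_Ioo, H.slice,
      ae_all_iff.2 fun n => H.mass.ae_smoothVal_eq H.time_pos n,
      ae_all_iff.2 fun n => ae_all_iff.2 fun i => (H.momentum i).ae_smoothVal_eq H.time_pos n]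
      with t ht hsl h1 h2
    have h := hst t (Ioo_subset_Icc_self ht)
    have hsl0 := hsl ⟨0, H.dim_pos⟩
    have e1 : rho' t =ᵐ[volume] rho t := ae_eq_of_moll_eq h.integrable
      (hsl0.integrable_rho H.exps) fun n x => (congrFun (h.moll_dens n) x).trans (h1 n x)
    have e2 : ∀ᵐ x, ∀ i, rho' t x * v' t x i = rho t x * v t x i := ae_all_iff.2 fun i =>
      ae_eq_of_moll_eq (h.integrable_momentum i) ((hsl i).integrable_momentum H.exps)
        fun n x => (congrFun (congrFun (h.moll_mom n) i) x).trans (h2 n i x)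
    refine ⟨e1, ?_⟩
    filter_upwards [e1, e2, h.lower] with x hx1 hx2 hx3
    ext i
    have := hx2 i
    rw [← hx1] at this
    exact mul_left_cancel₀ (hc.trans_le hx3).ne' this
  · have h := hst 0 (left_mem_Icc.2 H.time_pos.le)
    refine ae_eq_of_moll_eq h.integrable H.mass.int_init fun n x => ?_
    rw [h.moll_dens, dens_zero]
  · have h := hst 0 (left_mem_Icc.2 H.time_pos.le)
    have e2 : ∀ᵐ x, ∀ i, rho' 0 x * v' 0 x i = rho0 x * v0 x i := ae_all_iff.2 fun i =>
      ae_eq_of_moll_eq (h.integrable_momentum i) (H.momentum i).int_init fun n x => by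
        have h1 := congrFun (congrFun (h.moll_mom n) i) x
        exact h1.trans (BalanceLaw.smoothVal_zero n x)
    filter_upwards [e2] with x hx
    ext i
    exact hx i

end RegularFlow

/-! ### Weak solutions in mixed Lebesgue spaces -/

section Mixed

variable {T : ℝ} {E : Type*} [NormedAddCommGroup E]

lemma aemeasurable_nrm {θ : ℝ} (hθ : 0 < θ) {f : ℝ → Torus d → E}
    (hf : AEStronglyMeasurable (fun z : ℝ × Torus d => f z.1 z.2) (cylinder d T)) :
    AEMeasurable (fun t => nrm θ (f t)) (volume.restrict (Ioo 0 T)) := by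
  have h0 : ENNReal.ofReal θ⁻¹ ≠ 0 := by simpa using hθ
  simp only [nrm, eLpNorm_eq_lintegral_rpow_enorm_toReal h0 ENNReal.ofReal_ne_top]
  exact (AEMeasurable.lintegral_prod_right' (hf.enorm.pow_const _)).pow_const _

lemma lintegral_nrm_rpow_lt_top {k θ : ℝ} (hk : 0 < k) {f : ℝ → Torus d → E}
    (hf : MemMixed T (ENNReal.ofReal k) (ENNReal.ofReal θ⁻¹) f) :
    ∫⁻ t in Ioo 0 T, nrm θ (f t) ^ k < ⊤ := by
  have h0 : ENNReal.ofReal k ≠ 0 := by simpa using hk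
  have := (eLpNorm_lt_top_iff_lintegral_rpow_enorm_lt_top h0 ENNReal.ofReal_ne_top).1 hf.2
  rwa [ENNReal.toReal_ofReal hk.le] at this

lemma ae_lt_top_of_lintegral_rpow {k : ℝ} (hk : 0 < k) {X : ℝ → ENNReal}
    (hX : AEMeasurable X (volume.restrict (Ioo 0 T))) (h : ∫⁻ t in Ioo 0 T, X t ^ k < ⊤) :
    ∀ᵐ t ∂(volume.restrict (Ioo 0 T)), X t < ⊤ := by
  filter_upwards [ae_lt_top' (hX.pow_const k) h.ne] with t ht
  rw [lt_top_iff_ne_top] at ht ⊢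
  rintro h
  rw [h, ENNReal.top_rpow_of_pos hk] at ht
  exact ht rfl

/-- Functions bounded in time with values in `L¹` are integrable on the cylinder. -/
lemma MemMixed.integrable_of_top_one {f : ℝ → Torus d → ℝ} (hf : MemMixed T ⊤ 1 f) :
    Integrable (fun z : ℝ × Torus d => f z.1 z.2) (cylinder d T) := by
  refine ⟨hf.1, ?_⟩
  rw [HasFiniteIntegral, cylinder, lintegral_prod _ hf.1.enorm]
  have h1 := hf.2
  rw [eLpNorm_exponent_top] at h1
  have h2 := enorm_ae_le_eLpNormEssSup (fun t => eLpNorm (f t) 1 volume)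
    (volume.restrict (Ioo 0 T))
  calc ∫⁻ t in Ioo 0 T, ∫⁻ x, ‖f t x‖ₑ
      ≤ ∫⁻ _t in Ioo 0 T, eLpNormEssSup (fun t => eLpNorm (f t) 1 volume)
          (volume.restrict (Ioo 0 T)) := by
        refine lintegral_mono_ae ?_
        filter_upwards [h2] with t ht
        rw [eLpNorm_one_eq_lintegral_enorm] at ht
        exact ht
    _ < ⊤ := by
        rw [lintegral_const]
        exact ENNReal.mul_lt_top h1 (measure_lt_top _ _)

end Mixed

/-- Young's inequality for a product of three powers. -/
lemma mul_rpow_mul_rpow_le {X Y Z : ENNReal} {k p m a b e : ℝ} (hk : 0 < k) (hp : 0 < p)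
    (hm : 0 < m) (ha : 0 ≤ a) (hb : 0 ≤ b) (he : 0 ≤ e) (h : a / k + b / p + e / m ≤ 1) :
    X ^ a * Y ^ b * Z ^ e ≤ 1 + X ^ k + Y ^ p + Z ^ m := by
  set W := 1 + X ^ k + Y ^ p + Z ^ m with hW
  have h1 : 1 ≤ W := by
    rw [hW, add_assoc, add_assoc]; exact le_self_add
  have aux : ∀ {U : ENNReal} {κ α : ℝ}, 0 < κ → 0 ≤ α → U ^ κ ≤ W → U ^ α ≤ W ^ (α / κ) := by
    intro U κ α hκ hα hU
    calc U ^ α = (U ^ κ) ^ (α / κ) := by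
          rw [← ENNReal.rpow_mul, mul_div_cancel₀ _ hκ.ne']
      _ ≤ _ := ENNReal.rpow_le_rpow hU (by positivity)
  have hX : X ^ a ≤ W ^ (a / k) := aux hk ha (by
    rw [hW]; exact le_add_self.trans (le_self_add.trans le_self_add))
  have hY : Y ^ b ≤ W ^ (b / p) := aux hp hb (by rw [hW]; exact le_add_self.trans le_self_add)
  have hZ : Z ^ e ≤ W ^ (e / m) := aux hm he (by rw [hW]; exact le_add_self)
  calc X ^ a * Y ^ b * Z ^ e ≤ W ^ (a / k) * W ^ (b / p) * W ^ (e / m) := by gcongr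
    _ = W ^ (a / k + b / p + e / m) := by
        rw [ENNReal.rpow_add_of_nonneg _ _ (by positivity) (by positivity),
          ENNReal.rpow_add_of_nonneg _ _ (by positivity) (by positivity)]
    _ ≤ W ^ (1 : ℝ) := ENNReal.rpow_le_rpow_of_exponent_le h1 h
    _ = W := ENNReal.rpow_one W

/-- The products of norms in the energy balance have a common integrable bound as soon as the
exponents in time satisfy the same relations as those in space. -/
lemma exists_integrable_bound {T γ k p m : ℝ} (e : ExpRel γ k⁻¹ p⁻¹ m⁻¹) {X Y Z : ℝ → ENNReal}
    (hX : AEMeasurable X (volume.restrict (Ioo 0 T)))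
    (hY : AEMeasurable Y (volume.restrict (Ioo 0 T)))
    (hZ : AEMeasurable Z (volume.restrict (Ioo 0 T)))
    (iX : ∫⁻ t in Ioo 0 T, X t ^ k < ⊤) (iY : ∫⁻ t in Ioo 0 T, Y t ^ p < ⊤)
    (iZ : ∫⁻ t in Ioo 0 T, Z t ^ m < ⊤) :
    ∃ h : ℝ → ℝ, IntegrableOn h (Ioo 0 T) ∧ (∀ t, 0 ≤ h t) ∧
      ∀ᵐ t ∂(volume.restrict (Ioo 0 T)),
        X t ^ 2 * Y t ^ 2 * Z t ≤ ENNReal.ofReal (h t) ∧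
        X t ^ 3 * Y t ^ 2 * Z t ≤ ENNReal.ofReal (h t) ∧
        X t ^ γ * X t * Z t ≤ ENNReal.ofReal (h t) ∧
        X t * Z t ^ 2 ≤ ENNReal.ofReal (h t) ∧
        X t ^ 3 * Z t ≤ ENNReal.ofReal (h t) := by
  have hk : 0 < k := inv_pos.1 e.r_pos
  have hp : 0 < p := inv_pos.1 e.s_pos
  have hm : 0 < m := inv_pos.1 e.g_pos
  have h1 := e.one_lt
  set W : ℝ → ENNReal := fun t => 1 + X t ^ k + Y t ^ p + Z t ^ m with hW
  have hWm : AEMeasurable W (volume.restrict (Ioo 0 T)) :=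
    ((aemeasurable_const.add (hX.pow_const k)).add (hY.pow_const p)).add (hZ.pow_const m)
  have hWi : ∫⁻ t in Ioo 0 T, W t < ⊤ := by
    rw [lintegral_add_right' _ (hZ.pow_const m), lintegral_add_right' _ (hY.pow_const p),
      lintegral_add_right' _ (hX.pow_const k)]
    refine ENNReal.add_lt_top.2 ⟨ENNReal.add_lt_top.2 ⟨ENNReal.add_lt_top.2 ⟨?_, iX⟩, iY⟩, iZ⟩
    simp
  refine ⟨fun t => (W t).toReal, integrable_toReal_of_lintegral_ne_top hWm hWi.ne,
    fun t => ENNReal.toReal_nonneg, ?_⟩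
  filter_upwards [ae_lt_top' hWm hWi.ne] with t ht
  simp only [ENNReal.ofReal_toReal ht.ne]
  have hy : ∀ a b c : ℝ, 0 ≤ a → 0 ≤ b → 0 ≤ c → a * k⁻¹ + b * p⁻¹ + c * m⁻¹ ≤ 1 →
      X t ^ a * Y t ^ b * Z t ^ c ≤ W t := fun a b c ha hb hc h =>
    mul_rpow_mul_rpow_le hk hp hm ha hb hc (by simpa only [div_eq_mul_inv] using h)
  refine ⟨?_, ?_, ?_, ?_, ?_⟩
  · have := hy 2 2 1 (by norm_num) (by norm_num) (by norm_num)
      (by linarith [e.convective, e.r_pos])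
    simpa using this
  · have := hy 3 2 1 (by norm_num) (by norm_num) (by norm_num)
      (by linarith [e.convective, e.r_pos])
    simpa [ENNReal.rpow_ofNat] using this
  · have := hy (γ + 1) 0 1 (by linarith) (by norm_num) (by norm_num)
      (by linarith [e.pressure])
    rw [ENNReal.rpow_add_of_nonneg _ _ (by linarith) zero_le_one] at this
    simpa using this
  · have := hy 1 0 2 (by norm_num) (by norm_num) (by norm_num)
      (by linarith [e.viscous])
    simpa using this
  · have := hy 3 0 1 (by norm_num) (by norm_num) (by norm_num)
      (by linarith [e.convective, e.s_pos])
    simpa [ENNReal.rpow_ofNat] using this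

/-- The exponents of the theorem, in terms of their reciprocals. -/
lemma expRel_of_lt {γ k p : ℝ} (hγ : 1 < γ) (hp : 2 < p)
    (hk : max (4 * p / (p - 2)) ((γ - 2) * p / 2) < k) (hkp : 0 ≤ k * (4 - p) + 7 * p) :
    ExpRel γ k⁻¹ p⁻¹ (k * p / (k * (p - 2) - 4 * p))⁻¹ := by
  obtain ⟨h1, h2⟩ := max_lt_iff.1 hk
  have hp2 : 0 < p - 2 := by linarith
  have hp0 : 0 < p := by linarith
  have hk0 : 0 < k := lt_trans (by positivity) h1
  rw [div_lt_iff₀ hp2] at h1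
  have hg : (k * p / (k * (p - 2) - 4 * p))⁻¹ = 1 - 2 * p⁻¹ - 4 * k⁻¹ := by
    rw [inv_div]
    field_simp
  have hgpos : 0 < 1 - 2 * p⁻¹ - 4 * k⁻¹ := by
    rw [← hg]
    have : 0 < k * (p - 2) - 4 * p := by linarith
    positivity
  have hkinv : 0 < k⁻¹ := inv_pos.2 hk0
  have hpinv : 0 < p⁻¹ := inv_pos.2 hp0
  rw [hg]
  refine ⟨hγ, hkinv, hpinv, hgpos, by linarith, ?_, ?_⟩
  · have : (γ - 2) * k⁻¹ ≤ 2 * p⁻¹ := by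
      field_simp
      linarith
    linarith
  · have : 1 ≤ 4 * p⁻¹ + 7 * k⁻¹ := by
      field_simp
      linarith
    linarith

/-- States of finite energy: density, momentum and convective flux are integrable. -/
lemma integrable_of_finite_energy {α : Type*} [MeasurableSpace α] {ν : Measure α}
    [IsFiniteMeasure ν] {γ : ℝ} (hγ : 1 < γ) {ρ : α → ℝ} {w : α → Vec d}
    (hρ : AEStronglyMeasurable ρ ν) (hw : AEStronglyMeasurable w ν) (h0 : ∀ᵐ z ∂ν, 0 ≤ ρ z)
    (hp : Integrable (fun z => ρ z ^ γ) ν) (hk : Integrable (fun z => ρ z * ‖w z‖ ^ 2) ν) :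
    Integrable ρ ν ∧ (∀ i, Integrable (fun z => ρ z * w z i) ν) ∧
      ∀ i j, Integrable (fun z => ρ z * w z i * w z j) ν := by
  have hwi : ∀ i, AEStronglyMeasurable (fun z => w z i) ν := fun i =>
    (EuclideanSpace.proj (𝕜 := ℝ) i).continuous.comp_aestronglyMeasurable hw
  have hle : ∀ z i, |w z i| ≤ ‖w z‖ := fun z i => PiLp.norm_apply_le (w z) i
  have hρi : Integrable ρ ν := by
    refine ((integrable_const (1 : ℝ)).add hp).mono' hρ ?_
    filter_upwards [h0] with z hz
    rw [Real.norm_of_nonneg hz, Pi.add_apply]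
    rcases le_total (ρ z) 1 with h | h
    · linarith [Real.rpow_nonneg hz γ]
    · linarith [Real.self_le_rpow_of_one_le h hγ.le]
  refine ⟨hρi, fun i => ?_, fun i j => ?_⟩
  · refine (hρi.add hk).mono' (hρ.mul (hwi i)) ?_
    filter_upwards [h0] with z hz
    have h2 : |w z i| ≤ 1 + ‖w z‖ ^ 2 := by nlinarith [sq_nonneg (‖w z‖ - 1), hle z i]
    rw [norm_mul, Real.norm_of_nonneg hz, Real.norm_eq_abs, Pi.add_apply]
    nlinarith [mul_le_mul_of_nonneg_left h2 hz]
  · refine hk.mono' ((hρ.mul (hwi i)).mul (hwi j)) ?_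
    filter_upwards [h0] with z hz
    rw [norm_mul, norm_mul, Real.norm_of_nonneg hz, Real.norm_eq_abs, Real.norm_eq_abs, mul_assoc,
      sq]
    exact mul_le_mul_of_nonneg_left (mul_le_mul (hle z i) (hle z j) (abs_nonneg _)
      (norm_nonneg _)) hz

/-- The slices of a distributional gradient are gradients after mollification. -/
lemma IsWeakGradient.ae_isMollGradient {T : ℝ} {v : ℝ → Torus d → Vec d}
    {G : ℝ → Torus d → Grad d} (h : IsWeakGradient T v G) :
    ∀ᵐ t ∂(volume.restrict (Ioo 0 T)), ∀ i,
      IsMollGradient (fun x => v t x i) (fun j x => G t x (i, j)) := by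
  have hvi : ∀ i, Integrable (fun z : ℝ × Torus d => v z.1 z.2 i) (cylinder d T) := fun i =>
    (EuclideanSpace.proj (𝕜 := ℝ) i).integrable_comp h.integrable
  have hGi : ∀ i j, Integrable (fun z : ℝ × Torus d => G z.1 z.2 (i, j)) (cylinder d T) :=
    fun i j => (EuclideanSpace.proj (𝕜 := ℝ) (i, j)).integrable_comp h.integrable_grad
  have key : ∀ n i j (x : Torus d), ∀ᵐ t ∂(volume.restrict (Ioo 0 T)),
      mollD n j (fun x => v t x i) x - moll n (fun x => G t x (i, j)) x = 0 := fun n i j x => by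
    have i1 := integrable_cv_time (f := fun t x => v t x i) (hvi i)
      (continuous_pderiv_kern (n := n) (j := j)) x
    have i2 := integrable_cv_time (f := fun t x => G t x (i, j)) (hGi i j)
      (continuous_kern (n := n)) x
    rw [ae_restrict_iff' measurableSet_Ioo]
    refine isOpen_Ioo.ae_eq_zero_of_integral_contDiff_smul_eq_zero
      (f := fun t => mollD n j (fun x => v t x i) x - moll n (fun x => G t x (i, j)) x)
      ((i1.sub i2).locallyIntegrableOn) fun χ hχ hχc hχs => ?_
    have hker := smoothSpace_kern.comp_sub_left (ψ := (kern n : Torus d → ℝ)) x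
    have htest : IsTestInterior T (fun t (y : Torus d) => χ t * kern n (x - y)) := by
      refine ⟨ContDiff.mul (hχ.comp contDiff_fst)
        (ContDiff.comp (g := fun y : Fin d → ℝ => kern n (x - proj y)) hker contDiff_snd), ?_⟩
      rcases (tsupport χ).eq_empty_or_nonempty with he | hne
      · have h0 : χ = 0 := tsupport_eq_empty_iff.1 he
        exact ⟨1, T - 1, one_pos, sub_one_lt T, fun t _ y => by simp [h0]⟩
      · have hcomp : IsCompact (tsupport χ) := hχc
        refine ⟨sInf (tsupport χ), sSup (tsupport χ), (hχs (hcomp.sInf_mem hne)).1,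
          (hχs (hcomp.sSup_mem hne)).2, fun t ht y => ?_⟩
        have : t ∉ tsupport χ := fun hmem =>
          ht ⟨csInf_le hcomp.bddBelow hmem, le_csSup hcomp.bddAbove hmem⟩
        simp only [image_eq_zero_of_notMem_tsupport this, zero_mul]
    have h1 := h.integral_eq i j _ htest
    have e2 : ∀ t y, pderiv j (fun y => χ t * kern n (x - y)) y =
        -(χ t * pderiv j (kern n) (x - y)) := fun t y => by
      have : pderiv j (fun y => χ t * kern n (x - y)) y =
        χ t * pderiv j (fun y => kern n (x - y)) y := deriv_const_mul_field _
      rw [this, smoothSpace_kern.pderiv_comp_sub_left, mul_neg]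
    have e3 : ∀ t, ∫ y, v t y i * pderiv j (fun y => χ t * kern n (x - y)) y =
        -(χ t * mollD n j (fun x => v t x i) x) := fun t => by
      simp only [e2, mollD, cv]
      rw [← integral_const_mul, ← integral_neg]
      congr 1
      funext y
      ring
    have e4 : ∀ t, ∫ y, G t y (i, j) * (χ t * kern n (x - y)) =
        χ t * moll n (fun x => G t x (i, j)) x := fun t => by
      simp only [moll, cv]
      rw [← integral_const_mul]
      congr 1
      funext y
      ring
    simp only [e3, e4, integral_neg, neg_inj] at h1
    obtain ⟨K, hK⟩ := hχc.exists_bound_of_continuous hχ.continuous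
    have j1 : IntegrableOn (fun t => χ t * mollD n j (fun x => v t x i) x) (Ioo 0 T) :=
      Integrable.bdd_mul (c := K) i1 hχ.continuous.aestronglyMeasurable
        (Eventually.of_forall hK)
    have j2 : IntegrableOn (fun t => χ t * moll n (fun x => G t x (i, j)) x) (Ioo 0 T) :=
      Integrable.bdd_mul (c := K) i2 hχ.continuous.aestronglyMeasurable
        (Eventually.of_forall hK)
    have hsub := integral_sub j1 j2
    rw [h1, sub_self] at hsub
    rw [← setIntegral_eq_integral_of_forall_compl_eq_zero (s := Ioo 0 T)]
    · refine Eq.trans ?_ hsub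
      congr 1
      funext t
      rw [smul_eq_mul]
      ring
    · intro t ht
      rw [image_eq_zero_of_notMem_tsupport fun hmem => ht (hχs hmem), zero_smul]
  have hden : ∀ᵐ t ∂(volume.restrict (Ioo 0 T)), ∀ n i j (m : ℕ),
      mollD n j (fun x => v t x i) (TopologicalSpace.denseSeq (Torus d) m) -
        moll n (fun x => G t x (i, j)) (TopologicalSpace.denseSeq (Torus d) m) = 0 :=
    ae_all_iff.2 fun n => ae_all_iff.2 fun i => ae_all_iff.2 fun j => ae_all_iff.2 fun m =>
      key n i j _
  filter_upwards [hden, ae_all_iff.2 fun i => ae_integrable_slice (f := fun t x => v t x i) (hvi i),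
    ae_all_iff.2 fun i => ae_all_iff.2 fun j =>
      ae_integrable_slice (f := fun t x => G t x (i, j)) (hGi i j)] with t ht h1 h2 i n j x
  have := Continuous.ext_on (TopologicalSpace.denseRange_denseSeq (Torus d))
    (continuous_mollD (n := n) (j := j) (h1 i)) (continuous_moll (n := n) (h2 i j))
    (by rintro _ ⟨m, rfl⟩; exact sub_eq_zero.1 (ht n i j m))
  exact congrFun this x

namespace IsWeakSolution

variable {γ μ lam T c : ℝ} {rho0 : Torus d → ℝ} {v0 : Torus d → Vec d}
  {rho : ℝ → Torus d → ℝ} {v : ℝ → Torus d → Vec d} {G : ℝ → Torus d → Grad d}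

lemma balanceLaw_mass (h : IsWeakSolution γ μ lam T rho0 v0 rho v G) (hγ : 1 < γ) :
    BalanceLaw T rho rho0 (fun j t x => rho t x * v t x j) := by
  obtain ⟨h1, h2, -⟩ := integrable_of_finite_energy hγ h.rho_meas h.weakGradient.integrable.1
    h.rho_nonneg h.pressure.integrable_of_top_one h.kinetic.integrable_of_top_one
  exact ⟨h1, h2, (integrable_of_finite_energy hγ h.rho0_meas h.v0_meas h.rho0_nonneg
    h.pressure0 h.kinetic0).1, h.mass⟩

lemma balanceLaw_momentum (h : IsWeakSolution γ μ lam T rho0 v0 rho v G) (hγ : 1 < γ)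
    (i : Fin d) : BalanceLaw T (fun t x => rho t x * v t x i) (fun x => rho0 x * v0 x i)
      (fun j t x => momFlux γ μ lam (rho t x) (v t x) (G t x) i j) := by
  have hp := h.pressure.integrable_of_top_one
  obtain ⟨-, h2, h3⟩ := integrable_of_finite_energy hγ h.rho_meas h.weakGradient.integrable.1
    h.rho_nonneg hp h.kinetic.integrable_of_top_one
  have hG : ∀ i j, Integrable (fun z : ℝ × Torus d => G z.1 z.2 (i, j)) (cylinder d T) :=
    fun i j => (EuclideanSpace.proj (𝕜 := ℝ) (i, j)).integrable_comp h.weakGradient.integrable_grad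
  refine ⟨h2 i, fun j => ?_, (integrable_of_finite_energy hγ h.rho0_meas h.v0_meas h.rho0_nonneg
    h.pressure0 h.kinetic0).2.1 i, fun φ hφ => ?_⟩
  · unfold momFlux stress divergence
    have hdiv : Integrable (fun z : ℝ × Torus d => ∑ k, G z.1 z.2 (k, k)) (cylinder d T) :=
      integrable_finsetSum _ fun k _ => hG k k
    refine Integrable.sub (f := fun z : ℝ × Torus d => rho z.1 z.2 * v z.1 z.2 i * v z.1 z.2 j +
      if i = j then rho z.1 z.2 ^ γ else 0) (g := fun z : ℝ × Torus d => μ * G z.1 z.2 (i, j) +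
      if i = j then (μ + lam) * ∑ k, G z.1 z.2 (k, k) else 0)
      ((h3 i j).add ?_) (((hG i j).const_mul μ).add ?_)
    · split_ifs
      · exact hp
      · simp
    · split_ifs
      · exact hdiv.const_mul _
      · simp
  · refine Eq.trans ?_ (h.momentum i φ hφ)
    congr 1
    congr 1
    funext t
    congr 1
    funext x
    have e1 : ∀ j, momFlux γ μ lam (rho t x) (v t x) (G t x) i j * pderiv j (φ t) x =
        rho t x * v t x i * v t x j * pderiv j (φ t) x +
          (if i = j then rho t x ^ γ * pderiv j (φ t) x else 0) -
          μ * (G t x (i, j) * pderiv j (φ t) x) -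
          (if i = j then (μ + lam) * divergence (G t x) * pderiv j (φ t) x else 0) := fun j => by
      unfold momFlux stress
      split_ifs <;> ring
    simp only [e1, Finset.sum_sub_distrib, Finset.sum_add_distrib, Finset.sum_ite_eq,
      Finset.mem_univ, if_true, ← Finset.mul_sum]
    ring

/-- Weak solutions in the mixed Lebesgue spaces of the theorem are regular flows. -/
lemma regularFlow {k l p q m M : ℝ} (h : IsWeakSolution γ μ lam T rho0 v0 rho v G) (hd : 0 < d)
    (hT : 0 < T) (hc : 0 < c) (et : ExpRel γ k⁻¹ p⁻¹ m⁻¹) (ex : ExpRel γ l⁻¹ q⁻¹ M⁻¹)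
    (hlower : ∀ᵐ z ∂(cylinder d T), c ≤ rho z.1 z.2)
    (hrho : MemMixed T (ENNReal.ofReal k) (ENNReal.ofReal l) rho)
    (hv : MemMixed T (ENNReal.ofReal p) (ENNReal.ofReal q) v)
    (hG : MemMixed T (ENNReal.ofReal m) (ENNReal.ofReal M) G) :
    RegularFlow γ μ lam T c l⁻¹ q⁻¹ M⁻¹ rho0 v0 rho v G := by
  have hk : 0 < k := inv_pos.1 et.r_pos
  have hp : 0 < p := inv_pos.1 et.s_pos
  have hm : 0 < m := inv_pos.1 et.g_pos
  rw [← inv_inv l] at hrho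
  rw [← inv_inv q] at hv
  rw [← inv_inv M] at hG
  have mX := aemeasurable_nrm ex.r_pos hrho.1
  have mY := aemeasurable_nrm ex.s_pos hv.1
  have mZ := aemeasurable_nrm ex.g_pos hG.1
  have iX := lintegral_nrm_rpow_lt_top hk hrho
  have iY := lintegral_nrm_rpow_lt_top hp hv
  have iZ := lintegral_nrm_rpow_lt_top hm hG
  have hvm : ∀ i, AEStronglyMeasurable (fun z : ℝ × Torus d => v z.1 z.2 i) (cylinder d T) :=
    fun i => (EuclideanSpace.proj (𝕜 := ℝ) i).continuous.comp_aestronglyMeasurable hv.1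
  have hGm : ∀ i j, AEStronglyMeasurable (fun z : ℝ × Torus d => G z.1 z.2 (i, j))
      (cylinder d T) := fun i j =>
    (EuclideanSpace.proj (𝕜 := ℝ) (i, j)).continuous.comp_aestronglyMeasurable hG.1
  have hvle : ∀ t i, nrm q⁻¹ (fun x => v t x i) ≤ nrm q⁻¹ (v t) := fun t i =>
    eLpNorm_mono fun x => PiLp.norm_apply_le (v t x) i
  have hGle : ∀ t i j, nrm M⁻¹ (fun x => G t x (i, j)) ≤ nrm M⁻¹ (G t) := fun t i j =>
    eLpNorm_mono fun x => PiLp.norm_apply_le (G t x) (i, j)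
  have mY' : AEMeasurable (fun t => velNrm q⁻¹ (v t)) (volume.restrict (Ioo 0 T)) :=
    Finset.aemeasurable_fun_sum _ fun i _ =>
      aemeasurable_nrm (f := fun t x => v t x i) ex.s_pos (hvm i)
  have mZ' : AEMeasurable (fun t => gradNrm M⁻¹ (G t)) (volume.restrict (Ioo 0 T)) :=
    Finset.aemeasurable_fun_sum _ fun i _ => Finset.aemeasurable_fun_sum _ fun j _ =>
      aemeasurable_nrm (f := fun t x => G t x (i, j)) ex.g_pos (hGm i j)
  have iY' : ∫⁻ t in Ioo 0 T, velNrm q⁻¹ (v t) ^ p < ⊤ := by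
    have hle : ∀ t, velNrm q⁻¹ (v t) ^ p ≤ (d : ENNReal) ^ p * nrm q⁻¹ (v t) ^ p := fun t => by
      rw [← ENNReal.mul_rpow_of_nonneg _ _ hp.le]
      refine ENNReal.rpow_le_rpow ?_ hp.le
      exact (Finset.sum_le_sum fun i _ => hvle t i).trans (by simp)
    refine (lintegral_mono hle).trans_lt ?_
    rw [lintegral_const_mul' _ _ (ENNReal.rpow_ne_top_of_nonneg hp.le (by simp))]
    exact ENNReal.mul_lt_top (ENNReal.rpow_lt_top_of_nonneg hp.le (by simp)) iY
  have iZ' : ∫⁻ t in Ioo 0 T, gradNrm M⁻¹ (G t) ^ m < ⊤ := by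
    have hle : ∀ t, gradNrm M⁻¹ (G t) ^ m ≤
        ((d : ENNReal) * d) ^ m * nrm M⁻¹ (G t) ^ m := fun t => by
      rw [← ENNReal.mul_rpow_of_nonneg _ _ hm.le]
      refine ENNReal.rpow_le_rpow ?_ hm.le
      exact (Finset.sum_le_sum fun i _ => Finset.sum_le_sum fun j _ => hGle t i j).trans
        (by simp [mul_assoc])
    have hdd : (d : ENNReal) * d ≠ ⊤ := ENNReal.mul_ne_top (by simp) (by simp)
    refine (lintegral_mono hle).trans_lt ?_
    rw [lintegral_const_mul' _ _ (ENNReal.rpow_ne_top_of_nonneg hm.le hdd)]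
    exact ENNReal.mul_lt_top (ENNReal.rpow_lt_top_of_nonneg hm.le hdd) iZ
  refine ⟨hd, hT, hc, ex, h.balanceLaw_mass ex.one_lt, h.balanceLaw_momentum ex.one_lt, ?_,
    exists_integrable_bound et mX mY' mZ' iX iY' iZ', h.pressure0, h.kinetic0⟩
  filter_upwards [ae_ae_of_ae_cylinder hlower, h.weakGradient.ae_isMollGradient,
    hrho.1.prodMk_left, ae_all_iff.2 fun i => (hvm i).prodMk_left,
    ae_all_iff.2 fun i => ae_all_iff.2 fun j => (hGm i j).prodMk_left,
    ae_lt_top_of_lintegral_rpow hk mX iX, ae_lt_top_of_lintegral_rpow hp mY iY,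
    ae_lt_top_of_lintegral_rpow hm mZ iZ] with t h1 h2 h3 h4 h5 h6 h7 h8 i
  exact ⟨h3, h4 i, h5 i, h1, h6, (hvle t i).trans_lt h7, fun j => (hGle t i j).trans_lt h8, h2 i⟩

end IsWeakSolution

end CompressibleNS

end

theorem theorem1p2 {d : ℕ} (hd : 2 ≤ d)
    {γ μ lam T c k l p q : ℝ} (hγ : 1 < γ) (hμ : 0 ≤ μ) (hlam : 0 < 2 * μ + d * lam)
    (hT : 0 < T) (hc : 0 < c) (hp : 2 < p) (hq : 2 < q)
    (hk : max (4 * p / (p - 2)) ((γ - 2) * p / 2) < k)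
    (hl : max (4 * q / (q - 2)) ((γ - 2) * q / 2) < l)
    (hkp : 0 ≤ k * (4 - p) + 7 * p) (hlq : 0 ≤ l * (4 - q) + 7 * q)
    (rho0 : CompressibleNS.Torus d → ℝ)
    (v0 : CompressibleNS.Torus d → CompressibleNS.Vec d)
    (rho : ℝ → CompressibleNS.Torus d → ℝ)
    (v : ℝ → CompressibleNS.Torus d → CompressibleNS.Vec d)
    (G : ℝ → CompressibleNS.Torus d → CompressibleNS.Grad d)
    (hsol : CompressibleNS.IsWeakSolution γ μ lam T rho0 v0 rho v G)
    (hlower : ∀ᵐ z ∂(CompressibleNS.cylinder d T), c ≤ rho z.1 z.2)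
    (hrho : CompressibleNS.MemMixed T (ENNReal.ofReal k) (ENNReal.ofReal l) rho)
    (hv : CompressibleNS.MemMixed T (ENNReal.ofReal p) (ENNReal.ofReal q) v)
    (hG : CompressibleNS.MemMixed T (ENNReal.ofReal (k * p / (k * (p - 2) - 4 * p)))
      (ENNReal.ofReal (l * q / (l * (q - 2) - 4 * q))) G) :
    (∀ᵐ t ∂(volume.restrict (Ioo 0 T)),
      CompressibleNS.energy γ (rho t) (v t) + CompressibleNS.dissipation μ lam G t =
        CompressibleNS.energy γ rho0 v0) ∧
    ∃ (rho' : ℝ → CompressibleNS.Torus d → ℝ)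
      (v' : ℝ → CompressibleNS.Torus d → CompressibleNS.Vec d),
      CompressibleNS.IsWeaklyContinuousRepresentative γ T rho0 v0 rho v rho' v' ∧
      ∀ t ∈ Icc 0 T,
        CompressibleNS.energy γ (rho' t) (v' t) + CompressibleNS.dissipation μ lam G t =
          CompressibleNS.energy γ rho0 v0 := by
  have H := hsol.regularFlow (by omega) hT hc (CompressibleNS.expRel_of_lt hγ hp hk hkp)
    (CompressibleNS.expRel_of_lt hγ hq hl hlq) hlower hrho hv hG
  obtain ⟨rho', v', hrep, hE⟩ := H.exists_representative hsol.v0_meas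
  refine ⟨?_, rho', v', hrep, hE⟩
  filter_upwards [hrep.ae_eq, ae_restrict_mem measurableSet_Ioo] with t ht hmem
  rw [← hE t (Ioo_subset_Icc_self hmem)]
  congr 1
  refine integral_congr_ae ?_
  filter_upwards [ht.1, ht.2] with x h1 h2
  rw [h1, h2]
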